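/- Let $d\in\{2,3\}$ and let $\Omega\subset\mathbb{R}^d$ be a bounded Lipschitz domain (a bounded connected open set with Lipschitz boundary). Let $\nu>0$, $\gamma\in(0,1)$, $\mathbf f\in L^2(\Omega)^d$, and let $\mathbf g\in H^{1/2}(\partial\Omega)^d$ vanish on a set $\Gamma\subset\partial\Omega$ with $\mathcal H^{d-1}(\Gamma)>0$. Let $\alpha:[0,1]\to[\underline\alpha,\overline\alpha]$, with $0\le\underline\alpha\le\overline\alpha<\infty$, be convex, monotonically decreasing (not necessarily strictly) and twice continuously differentiable on $[0,1]$, with $\alpha(0)=\overline\alpha$ and $\alpha(1)=\underline\alpha$. Define $$J(\mathbf v,\eta)=\tfrac12\int_\Omega\big(\alpha(\eta)|\mathbf v|^2+\nu|\nabla\mathbf v|^2-2\,\mathbf f\cdot\mathbf v\big)\,\mathrm dx,$$ $$H^1_{\mathbf g,\mathrm{div}}(\Omega)^d=\{\mathbf v\in H^1(\Omega)^d:\ \mathbf v|_{\partial\Omega}=\mathbf g \text{ in the sense of traces},\ \operatorname{div}\mathbf v=0\text{ a.e. in }\Omega\},$$ $$C_\gamma=\Big\{\eta\in L^\infty(\Omega):\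 0\le\eta\le1\text{ a.e.},\ \int_\Omega\eta\,\mathrm dx\le\gamma|\Omega|\Big\},\qquad L^2_0(\Omega)=\Big\{q\in L^2(\Omega):\int_\Omega q\,\mathrm dx=0\Big\}.$$ Let $(\mathbf u,\rho)\in H^1_{\mathbf g,\mathrm{div}}(\Omega)^d\times C_\gamma$ be a global minimizer of $J$ over $H^1_{\mathbf g,\mathrm{div}}(\Omega)^d\times C_\gamma$, or a local one, i.e. there is an $r>0$ such that $J(\mathbf u,\rho)\le J(\mathbf w,\eta)$ for all $(\mathbf w,\eta)\in H^1_{\mathbf g,\mathrm{div}}(\Omega)^d\times C_\gamma$ with $\|\mathbf u-\mathbf w\|_{H^1(\Omega)}+\|\rho-\eta\|_{L^\infty(\Omega)}<r$. Then there exists a unique $p\in L^2_0(\Omega)$ such that $$\int_\Omega\big[\alpha(\rho)\,\mathbf u\cdot\mathbf v+\nu\,\nabla\mathbf u:\nabla\mathbf v\big]\,\mathrm dx-\int_\Omega p\,\operatorname{div}(\mathbf v)\,\mathrm dx=\int_\Omega\mathbf f\cdot\mathbf v\,\mathrm dx\quad\text{for all }\mathbf v\in H^1_0(\Omega)^d,$$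 $$-\int_\Omega q\,\operatorname{div}(\mathbf u)\,\mathrm dx=0\quad\text{for all }q\in L^2_0(\Omega),$$ $$\tfrac12\int_\Omega\alpha'(\rho)\,(\eta-\rho)\,|\mathbf u|^2\,\mathrm dx\ge0\quad\text{for all }\eta\in C_\gamma.$$ -/

import Mathlib

open MeasureTheory Filter Topology Set
open scoped ENNReal NNReal ContDiff

noncomputable section

namespace BorrvallPetersson

/-- Euclidean space `ℝ^d`. -/
abbrev Vec (d : ℕ) : Type := EuclideanSpace ℝ (Fin d)

/-- `d × d` matrices with the Frobenius inner product `A : B` and the Frobenius norm. -/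
abbrev Mat (d : ℕ) : Type := EuclideanSpace ℝ (Fin d × Fin d)

/-- `L^q(Ω; F)`, with respect to Lebesgue measure on `Ω`. -/
abbrev LSp {d : ℕ} (F : Type) [NormedAddCommGroup F] (q : ℝ≥0∞) (Ω : Set (Vec d)) : Type :=
  Lp F q ((volume : Measure (Vec d)).restrict Ω)

/-- A bounded Lipschitz domain: a bounded, nonempty, connected open set which near each of its
boundary points is, for a suitable unit vector `e`, the set of points lying strictly above
(in direction `e`) the graph of a Lipschitz function on the hyperplane orthogonal to `e`. -/
structure IsLipschitzDomain {d : ℕ} (Ω : Set (Vec d)) : Prop where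
  isOpen : IsOpen Ω
  isConnected : IsConnected Ω
  isBounded : Bornology.IsBounded Ω
  lipschitz_boundary : ∀ x₀ ∈ frontier Ω, ∃ e : Vec d, ‖e‖ = 1 ∧
    ∃ (K : ℝ≥0) (φ : (Submodule.span ℝ {e})ᗮ → ℝ), LipschitzWith K φ ∧
      ∃ r : ℝ, 0 < r ∧ ∀ x ∈ Metric.ball x₀ r,
        (x ∈ Ω ↔ φ ((Submodule.span ℝ {e})ᗮ.orthogonalProjectionOnto x) < inner ℝ e x)

/-- The partial derivative `∂_j φ (x)` of a differentiable function. -/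
def partialDeriv {d : ℕ} (φ : Vec d → ℝ) (j : Fin d) (x : Vec d) : ℝ :=
  fderiv ℝ φ x (EuclideanSpace.single j 1)

/-- The Jacobian matrix `(∂_j φ_i (x))_{i,j}` of a differentiable vector field. -/
def jacobian {d : ℕ} (φ : Vec d → Vec d) (x : Vec d) : Mat d :=
  WithLp.toLp 2 fun ij => fderiv ℝ φ x (EuclideanSpace.single ij.2 1) ij.1

/-- Test functions: `φ ∈ C_c^∞(Ω; F)`, extended by zero to `ℝ^d`. -/
structure IsTestFunction {d : ℕ} {F : Type} [NormedAddCommGroup F] [NormedSpace ℝ F]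
    (Ω : Set (Vec d)) (φ : Vec d → F) : Prop where
  smooth : ContDiff ℝ ∞ φ
  compact : HasCompactSupport φ
  subset : tsupport φ ⊆ Ω

/-- `G ∈ L²(Ω)^{d×d}` is the weak gradient of `u ∈ L²(Ω)^d`: `G_{ij} = ∂_j u_i` weakly in `Ω`. -/
def IsWeakGradient {d : ℕ} (Ω : Set (Vec d)) (u : LSp (Vec d) 2 Ω) (G : LSp (Mat d) 2 Ω) : Prop :=
  ∀ φ : Vec d → ℝ, IsTestFunction Ω φ → ∀ i j : Fin d,
    ∫ x in Ω, u x i * partialDeriv φ j x = - ∫ x in Ω, G x (i, j) * φ x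

theorem IsTestFunction.memLp {d : ℕ} {Ω : Set (Vec d)} {φ : Vec d → ℝ}
    (h : IsTestFunction Ω φ) : MemLp φ 2 ((volume : Measure (Vec d)).restrict Ω) :=
  (h.smooth.continuous.memLp_of_hasCompactSupport h.compact).restrict Ω

theorem IsTestFunction.memLp_partialDeriv {d : ℕ} {Ω : Set (Vec d)} {φ : Vec d → ℝ}
    (h : IsTestFunction Ω φ) (j : Fin d) :
    MemLp (partialDeriv φ j) 2 ((volume : Measure (Vec d)).restrict Ω) := by
  have hc : Continuous (partialDeriv φ j) :=
    (h.smooth.continuous_fderiv (by simp)).clm_apply continuous_const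
  have hs : HasCompactSupport (partialDeriv φ j) :=
    h.compact.fderiv_apply (𝕜 := ℝ) (EuclideanSpace.single j 1)
  exact (hc.memLp_of_hasCompactSupport hs).restrict Ω

theorem integrable_coord_mul {d : ℕ} {ι : Type} [Fintype ι] {Ω : Set (Vec d)}
    (u : LSp (EuclideanSpace ℝ ι) 2 Ω) (i : ι) {ψ : Vec d → ℝ}
    (hψ : MemLp ψ 2 ((volume : Measure (Vec d)).restrict Ω)) :
    Integrable (fun x => u x i * ψ x) ((volume : Measure (Vec d)).restrict Ω) := by
  have hu : MemLp (fun x => u x i) 2 ((volume : Measure (Vec d)).restrict Ω) :=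
    (EuclideanSpace.proj (𝕜 := ℝ) i).comp_memLp' (Lp.memLp u)
  exact hu.integrable_mul hψ

theorem integral_coord_add {d : ℕ} {ι : Type} [Fintype ι] {Ω : Set (Vec d)}
    (u v : LSp (EuclideanSpace ℝ ι) 2 Ω) (i : ι) {ψ : Vec d → ℝ}
    (hψ : MemLp ψ 2 ((volume : Measure (Vec d)).restrict Ω)) :
    ∫ x in Ω, (u + v) x i * ψ x = (∫ x in Ω, u x i * ψ x) + ∫ x in Ω, v x i * ψ x := by
  rw [← integral_add (integrable_coord_mul u i hψ) (integrable_coord_mul v i hψ)]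
  refine integral_congr_ae ?_
  filter_upwards [Lp.coeFn_add u v] with x hx
  rw [hx]
  exact add_mul (u x i) (v x i) (ψ x)

theorem integral_coord_smul {d : ℕ} {ι : Type} [Fintype ι] {Ω : Set (Vec d)} (c : ℝ)
    (u : LSp (EuclideanSpace ℝ ι) 2 Ω) (i : ι) (ψ : Vec d → ℝ) :
    ∫ x in Ω, (c • u) x i * ψ x = c * ∫ x in Ω, u x i * ψ x := by
  rw [← integral_const_mul]
  refine integral_congr_ae ?_
  filter_upwards [Lp.coeFn_smul c u] with x hx
  rw [hx]
  exact mul_assoc c (u x i) (ψ x)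

/-- The Sobolev space `H¹(Ω)^d`. An element is stored as the pair `(u, ∇u)`, where the second
component is determined by the first one. The norm is
`‖u‖²_{H¹(Ω)} = ‖u‖²_{L²(Ω)} + ‖∇u‖²_{L²(Ω)}`. -/
def H1 {d : ℕ} (Ω : Set (Vec d)) :
    Submodule ℝ (WithLp 2 (LSp (Vec d) 2 Ω × LSp (Mat d) 2 Ω)) where
  carrier := {w | IsWeakGradient Ω w.fst w.snd}
  zero_mem' := by
    intro φ hφ i j
    have h1 := integral_coord_smul (0 : ℝ) (0 : LSp (Vec d) 2 Ω) i (partialDeriv φ j)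
    have h2 := integral_coord_smul (0 : ℝ) (0 : LSp (Mat d) 2 Ω) (i, j) φ
    rw [smul_zero, zero_mul] at h1 h2
    exact h1.trans (by rw [← neg_zero, ← h2]; rfl)
  add_mem' := by
    intro v w hv hw φ hφ i j
    have h1 := integral_coord_add v.fst w.fst i (hφ.memLp_partialDeriv j)
    have h2 := integral_coord_add v.snd w.snd (i, j) hφ.memLp
    rw [hv φ hφ i j, hw φ hφ i j, ← neg_add, ← h2] at h1
    exact h1
  smul_mem' := by
    intro c v hv φ hφ i j
    have h1 := integral_coord_smul c v.fst i (partialDeriv φ j)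
    have h2 := integral_coord_smul c v.snd (i, j) φ
    rw [hv φ hφ i j, mul_neg, ← h2] at h1
    exact h1

/-- The `L²(Ω)^d` function underlying an element of `H¹(Ω)^d`. -/
def vel {d : ℕ} {Ω : Set (Vec d)} (v : H1 Ω) : LSp (Vec d) 2 Ω := v.1.fst

/-- The weak gradient of an element of `H¹(Ω)^d`. -/
def grad {d : ℕ} {Ω : Set (Vec d)} (v : H1 Ω) : LSp (Mat d) 2 Ω := v.1.snd

/-- The weak divergence of an element of `H¹(Ω)^d`. -/
def div {d : ℕ} {Ω : Set (Vec d)} (v : H1 Ω) (x : Vec d) : ℝ := ∑ i : Fin d, grad v x (i, i)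

/-- `v ∈ H¹(Ω)^d` is the restriction to `Ω` of the (smooth) vector field `φ` on `ℝ^d`. -/
def IsRestriction {d : ℕ} {Ω : Set (Vec d)} (v : H1 Ω) (φ : Vec d → Vec d) : Prop :=
  (∀ᵐ x ∂((volume : Measure (Vec d)).restrict Ω), vel v x = φ x) ∧
  (∀ᵐ x ∂((volume : Measure (Vec d)).restrict Ω), grad v x = jacobian φ x)

/-- `H¹₀(Ω)^d`: the closure of `C_c^∞(Ω)^d` in `H¹(Ω)^d`. -/
def H10 {d : ℕ} (Ω : Set (Vec d)) : Set (H1 Ω) :=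
  closure {v | ∃ φ : Vec d → Vec d, IsTestFunction Ω φ ∧ IsRestriction v φ}

/-- Surface measure on `∂Ω`: the `(d-1)`-dimensional Hausdorff measure, up to a constant factor
depending on `d` only. -/
def surfaceMeasure {d : ℕ} (Ω : Set (Vec d)) : Measure (Vec d) :=
  (Measure.hausdorffMeasure ((d : ℝ) - 1)).restrict (frontier Ω)

/-- `v|_{∂Ω} = g` in the sense of traces. The trace operator `H¹(Ω)^d → L²(∂Ω)^d` is the continuous
extension of `φ ↦ φ|_{∂Ω}` from the vector fields `φ` that are smooth up to the boundary. Only the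
values of `g` on `∂Ω` matter. The range of the trace operator is `H^{1/2}(∂Ω)^d`. -/
def HasTrace {d : ℕ} {Ω : Set (Vec d)} (v : H1 Ω) (g : Vec d → Vec d) : Prop :=
  MemLp g 2 (surfaceMeasure Ω) ∧
  ∃ (φ : ℕ → Vec d → Vec d) (w : ℕ → H1 Ω),
    (∀ n, ContDiff ℝ ∞ (φ n) ∧ IsRestriction (w n) (φ n)) ∧
    Tendsto w atTop (𝓝 v) ∧
    Tendsto (fun n => eLpNorm (φ n - g) 2 (surfaceMeasure Ω)) atTop (𝓝 0)

/-- `H¹_g(Ω)^d`. -/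
def H1g {d : ℕ} (Ω : Set (Vec d)) (g : Vec d → Vec d) : Set (H1 Ω) := {v | HasTrace v g}

/-- `H¹_{g,div}(Ω)^d`. -/
def H1gdiv {d : ℕ} (Ω : Set (Vec d)) (g : Vec d → Vec d) : Set (H1 Ω) :=
  {v | v ∈ H1g Ω g ∧ ∀ᵐ x ∂((volume : Measure (Vec d)).restrict Ω), div v x = 0}

/-- The admissible material distributions `C_γ ⊆ L^∞(Ω)`. -/
def Cγ {d : ℕ} (Ω : Set (Vec d)) (γ : ℝ) : Set (LSp ℝ ∞ Ω) :=
  {η | (∀ᵐ x ∂((volume : Measure (Vec d)).restrict Ω), 0 ≤ η x ∧ η x ≤ 1) ∧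
    ∫ x in Ω, η x ≤ γ * (volume Ω).toReal}

/-- `L²₀(Ω)`. -/
def L20 {d : ℕ} (Ω : Set (Vec d)) : Set (LSp ℝ 2 Ω) := {q | ∫ x in Ω, q x = 0}

/-- The power dissipation functional `J(v, η)`. -/
def J {d : ℕ} {Ω : Set (Vec d)} (α : ℝ → ℝ) (ν : ℝ) (f : LSp (Vec d) 2 Ω)
    (v : H1 Ω) (η : LSp ℝ ∞ Ω) : ℝ :=
  (1 / 2) * ∫ x in Ω,
    (α (η x) * ‖vel v x‖ ^ 2 + ν * ‖grad v x‖ ^ 2 - 2 * inner ℝ (f x) (vel v x))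

/-- `(u, ρ)` is a global minimizer of `J` over `H¹_{g,div}(Ω)^d × C_γ`. -/
def IsGlobalMinimizer {d : ℕ} {Ω : Set (Vec d)} (α : ℝ → ℝ) (ν γ : ℝ) (f : LSp (Vec d) 2 Ω)
    (g : Vec d → Vec d) (u : H1 Ω) (ρ : LSp ℝ ∞ Ω) : Prop :=
  u ∈ H1gdiv Ω g ∧ ρ ∈ Cγ Ω γ ∧
    ∀ w ∈ H1gdiv Ω g, ∀ η ∈ Cγ Ω γ, J α ν f u ρ ≤ J α ν f w η

/-- `(u, ρ)` is a local minimizer of `J` over `H¹_{g,div}(Ω)^d × C_γ`, with respect to the norms of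
`H¹(Ω)^d` and `L^∞(Ω)`. -/
def IsLocalMinimizer {d : ℕ} {Ω : Set (Vec d)} (α : ℝ → ℝ) (ν γ : ℝ) (f : LSp (Vec d) 2 Ω)
    (g : Vec d → Vec d) (u : H1 Ω) (ρ : LSp ℝ ∞ Ω) : Prop :=
  u ∈ H1gdiv Ω g ∧ ρ ∈ Cγ Ω γ ∧
    ∃ r : ℝ, 0 < r ∧ ∀ w ∈ H1gdiv Ω g, ∀ η ∈ Cγ Ω γ,
      ‖u - w‖ + ‖ρ - η‖ < r → J α ν f u ρ ≤ J α ν f w η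

/-- `a_ρ(u, v) = ∫_Ω α(ρ) u · v + ν ∇u : ∇v dx`. -/
def aForm {d : ℕ} {Ω : Set (Vec d)} (α : ℝ → ℝ) (ν : ℝ) (ρ : LSp ℝ ∞ Ω) (u v : H1 Ω) : ℝ :=
  ∫ x in Ω, (α (ρ x) * inner ℝ (vel u x) (vel v x) + ν * inner ℝ (grad u x) (grad v x))

/-- `b(v, q) = -∫_Ω q div(v) dx`. -/
def bForm {d : ℕ} {Ω : Set (Vec d)} (v : H1 Ω) (q : LSp ℝ 2 Ω) : ℝ :=
  - ∫ x in Ω, q x * div v x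

/-- `l_f(v) = ∫_Ω f · v dx`. -/
def lForm {d : ℕ} {Ω : Set (Vec d)} (f : LSp (Vec d) 2 Ω) (v : H1 Ω) : ℝ :=
  ∫ x in Ω, inner ℝ (f x) (vel v x)

/-- `c_u(ρ, η) = ½ ∫_Ω α'(ρ) η |u|² dx`, where `α'` is the (one-sided at `0` and `1`) derivative of
`α : [0,1] → ℝ`. -/
def cForm {d : ℕ} {Ω : Set (Vec d)} (α : ℝ → ℝ) (u : H1 Ω) (ρ η : LSp ℝ ∞ Ω) : ℝ :=
  (1 / 2) * ∫ x in Ω, derivWithin α (Icc 0 1) (ρ x) * η x * ‖vel u x‖ ^ 2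

end BorrvallPetersson

end

open BorrvallPetersson

/-! A global minimizer is a local one, so only local minimality is used. Perturb `u` by `s • v` with
`v` in `H10 Ω` divergence free: the competitor keeps its trace and its divergence, and `J` is a
quadratic polynomial in `s`, so its linear coefficient vanishes. Hence the functional `v ↦ aForm α ν
ρ u v - lForm f v` on `H10 Ω` vanishes on the kernel of the divergence. Perturbing `ρ` along the
segment to `η`, which stays in the convex set `Cγ Ω γ`, gives nonnegative difference quotients, and
dominated convergence gives the variational inequality.

The pressure comes from the fact that `div` maps `H10 Ω` onto `L20 Ω`
(`IsLipschitzDomain.exists_divL_eq`). A bounded functional that vanishes on the kernel of a bounded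
surjection of Hilbert spaces factors through it, and Riesz represents the factor by `p`.
Surjectivity also makes `p` unique: a difference of two pressures is itself a divergence, hence
orthogonal to itself.

Surjectivity is the hard part. On a set star-shaped with respect to a ball, it is obtained from
Bogovskii's formula, truncated to `t ≥ ε`. With `w = (x - (1 - t) y) / t`, the field is the integral
of `t⁻ᵈ f(y) (w - y) θ(w)` over `y` and `t ∈ (ε, 1]`. Its divergence integrand is an exact
`t`-derivative, so the divergence equals an approximation of `f` minus `θ ∫ f`
(`sum_fderiv_bogovskii`). The `H¹` bounds are uniform in `ε`: under the Fourier transform the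
averages become `∫ t⁻ᵏ ĥ(tξ) ĝ((1 - t)ξ) dt`, and the symbols are dominated by a weight whose
`t`-integral is bounded independently of `ξ`. No singular integral is ever formed: a bounded
sequence whose divergences converge already forces the limit into the range
(`mem_range_of_tendsto_of_bounded`).

A Lipschitz domain is covered by finitely many such star-shaped pieces, and connectedness allows
mass to be moved from one piece to the next, which glues the local results (`L20_subset_of_cover`).
-/

namespace BorrvallPetersson

/-! ### Range and factorization arguments in Hilbert spaces -/

section Hilbert

variable {H K : Type*} [NormedAddCommGroup H] [InnerProductSpace ℝ H]
  [NormedAddCommGroup K] [InnerProductSpace ℝ K]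

/-- The bound makes `F` vanish on the kernel of `T`, so `F` descends to a functional on the range of
`T`, bounded for the norm of `K`. Hahn–Banach extends it to `K` and Riesz represents it; the range
need not be closed. -/
theorem exists_inner_comp_eq_of_abs_le [CompleteSpace K] (T : H →L[ℝ] K) (F : H →ₗ[ℝ] ℝ) (C : ℝ)
    (hF : ∀ x, |F x| ≤ C * ‖T x‖) : ∃ p : K, ∀ x, F x = inner ℝ p (T x) := by
  have hker : F ∈ (LinearMap.ker T.toLinearMap).dualAnnihilator := by
    rw [Submodule.mem_dualAnnihilator]
    intro x hx
    have h := hF x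
    have hx' : T x = 0 := hx
    rw [hx', norm_zero, mul_zero] at h
    exact abs_nonpos_iff.mp h
  rw [← LinearMap.range_dualMap_eq_dualAnnihilator_ker] at hker
  obtain ⟨G, hG⟩ := hker
  let G' : LinearMap.range T.toLinearMap →L[ℝ] ℝ :=
    (G.comp (LinearMap.range T.toLinearMap).subtype).mkContinuous C (by
      rintro ⟨_, x, rfl⟩
      have h := hF x
      rw [← hG] at h
      exact h)
  obtain ⟨g, hg, -⟩ := exists_extension_norm_eq _ G'
  refine ⟨(InnerProductSpace.toDual ℝ K).symm g, fun x => ?_⟩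
  rw [InnerProductSpace.toDual_symm_apply, ← hG]
  exact (hg ⟨T x, x, rfl⟩).symm

/-- This replaces extraction of a weakly convergent subsequence. Since `⟨T uₙ, q⟩ = ⟨uₙ, T* q⟩`, the
limit satisfies `|⟨f, q⟩| ≤ C ‖T* q‖`, and the preceding lemma applied to the adjoint produces the
preimage. -/
theorem mem_range_of_tendsto_of_bounded [CompleteSpace H] [CompleteSpace K] (T : H →L[ℝ] K)
    {u : ℕ → H} {C : ℝ} (hu : ∀ n, ‖u n‖ ≤ C) {f : K}
    (hf : Tendsto (fun n => T (u n)) atTop (𝓝 f)) : ∃ v, T v = f := by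
  obtain ⟨v, hv⟩ := exists_inner_comp_eq_of_abs_le (T.adjoint) (innerSL ℝ f).toLinearMap C (by
    intro q
    have h1 : Tendsto (fun n => |inner ℝ (T (u n)) q|) atTop (𝓝 |inner ℝ f q|) :=
      (hf.inner tendsto_const_nhds).abs
    refine le_of_tendsto h1 (Eventually.of_forall fun n => ?_)
    rw [← ContinuousLinearMap.adjoint_inner_right]
    exact (abs_real_inner_le_norm _ _).trans
      (mul_le_mul_of_nonneg_right (hu n) (norm_nonneg _)))
  refine ⟨v, ext_inner_right ℝ fun q => ?_⟩
  rw [← ContinuousLinearMap.adjoint_inner_right, ← hv q]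
  rfl

/-- By the open mapping theorem `T x` has a preimage of norm at most `C ‖T x‖`, on which `F` takes
the same value as at `x`. So `F` is bounded by a multiple of `‖T x‖`. -/
theorem exists_inner_comp_eq_of_surjective [CompleteSpace H] [CompleteSpace K] (T : H →L[ℝ] K)
    (hT : Function.Surjective T) (F : H →L[ℝ] ℝ) (hF : ∀ x, T x = 0 → F x = 0) :
    ∃ p : K, ∀ x, F x = inner ℝ p (T x) := by
  obtain ⟨C, -, hC⟩ := T.exists_preimage_norm_le hT
  refine exists_inner_comp_eq_of_abs_le T F.toLinearMap (‖F‖ * C) fun x => ?_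
  obtain ⟨y, hy, hle⟩ := hC (T x)
  have h : F x = F y := by
    rw [← sub_eq_zero, ← map_sub]
    exact hF _ (by rw [map_sub, hy, sub_self])
  calc |F x| = ‖F y‖ := by rw [h]; rfl
    _ ≤ ‖F‖ * ‖y‖ := F.le_opNorm y
    _ ≤ ‖F‖ * C * ‖T x‖ := by rw [mul_assoc]; gcongr

end Hilbert

/-! ### Smoothness of integrals of a fixed profile under affine maps -/

section ParametricIntegral

variable {E : Type} [NormedAddCommGroup E] [NormedSpace ℝ E] [FiniteDimensional ℝ E]
  [MeasurableSpace E] [BorelSpace E]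
  {P : Type} [MeasurableSpace P] {μ : Measure P}

theorem integrable_smul_comp_affine {F : Type} [NormedAddCommGroup F] [NormedSpace ℝ F]
    {h : E → F} (hh : Continuous h) (hs : HasCompactSupport h)
    {c m : P → ℝ} {b : P → E} (hc : Measurable c) (hb : Measurable b) (hm : Integrable m μ)
    (x : E) : Integrable (fun p => m p • h (c p • x + b p)) μ := by
  obtain ⟨B, hB⟩ := hh.bounded_above_of_compact_support hs
  have hmeas : AEStronglyMeasurable (fun p => h (c p • x + b p)) μ :=
    hh.comp_aestronglyMeasurable ((hc.smul_const x).add hb).aestronglyMeasurable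
  exact hm.smul_bdd B hmeas (Eventually.of_forall fun p => hB _)

theorem hasFDerivAt_integral_smul_comp_affine {F : Type} [NormedAddCommGroup F] [NormedSpace ℝ F]
    {h : E → F} (hh : ContDiff ℝ ∞ h) (hs : HasCompactSupport h)
    {c m : P → ℝ} {b : P → E} (hc : Measurable c) (hb : Measurable b) (hm : Integrable m μ)
    (hmc : Integrable (fun p => m p * c p) μ) (x : E) :
    HasFDerivAt (fun x => ∫ p, m p • h (c p • x + b p) ∂μ)
      (∫ p, (m p * c p) • fderiv ℝ h (c p • x + b p) ∂μ) x := by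
  have hd : Continuous (fderiv ℝ h) := hh.continuous_fderiv (by simp)
  obtain ⟨B, hB⟩ := hd.bounded_above_of_compact_support (hs.fderiv ℝ)
  refine hasFDerivAt_integral_of_dominated_of_fderiv_le (s := univ)
    (F' := fun x p => (m p * c p) • fderiv ℝ h (c p • x + b p))
    (bound := fun p => ‖m p * c p‖ * B) univ_mem
    (Eventually.of_forall fun y =>
      (integrable_smul_comp_affine hh.continuous hs hc hb hm y).aestronglyMeasurable)
    (integrable_smul_comp_affine hh.continuous hs hc hb hm x)
    (integrable_smul_comp_affine hd (hs.fderiv ℝ) hc hb hmc x).aestronglyMeasurable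
    (Eventually.of_forall fun p y _ => ?_) (hmc.norm.mul_const B)
    (Eventually.of_forall fun p y _ => ?_)
  · rw [norm_smul]
    exact mul_le_mul_of_nonneg_left (hB _) (norm_nonneg _)
  · have h1 : HasFDerivAt (fun y => c p • y + b p) (c p • ContinuousLinearMap.id ℝ E) y :=
      ((hasFDerivAt_id y).const_smul (c p)).add_const (b p)
    have h2 := ((hh.differentiable (by simp) (c p • y + b p)).hasFDerivAt.comp y h1).const_smul
      (m p)
    refine h2.congr_fderiv ?_
    ext v
    simp [mul_smul]

/-- The class of these integrals is closed under differentiation: a derivative replaces `h` by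
`fderiv ℝ h` and the weight `m` by `m * c`. The induction on the order therefore has to generalize
both the target space and the weight, and all moments of `c` are assumed integrable. -/
theorem contDiff_integral_smul_comp_affine {F : Type} [NormedAddCommGroup F] [NormedSpace ℝ F]
    {h : E → F} (hh : ContDiff ℝ ∞ h) (hs : HasCompactSupport h)
    {c m : P → ℝ} {b : P → E} (hc : Measurable c) (hb : Measurable b)
    (hm : ∀ k : ℕ, Integrable (fun p => m p * c p ^ k) μ) :
    ContDiff ℝ ∞ (fun x => ∫ p, m p • h (c p • x + b p) ∂μ) := by
  rw [contDiff_infty]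
  intro n
  induction n generalizing F m with
  | zero =>
    have h0 : Integrable m μ := by simpa using hm 0
    have h1 : Integrable (fun p => m p * c p) μ := by simpa using hm 1
    rw [Nat.cast_zero, contDiff_zero]
    exact continuous_iff_continuousAt.mpr fun x =>
      (hasFDerivAt_integral_smul_comp_affine hh hs hc hb h0 h1 x).continuousAt
  | succ n ih =>
    have h0 : Integrable m μ := by simpa using hm 0
    have h1 : Integrable (fun p => m p * c p) μ := by simpa using hm 1
    have hder := hasFDerivAt_integral_smul_comp_affine hh hs hc hb h0 h1
    rw [Nat.cast_succ, contDiff_succ_iff_fderiv]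
    refine ⟨fun x => (hder x).differentiableAt, by simp, ?_⟩
    have heq : fderiv ℝ (fun x => ∫ p, m p • h (c p • x + b p) ∂μ) =
        fun x => ∫ p, (m p * c p) • fderiv ℝ h (c p • x + b p) ∂μ :=
      funext fun x => (hder x).fderiv
    rw [heq]
    refine ih (hh.fderiv_right (by simp)) (hs.fderiv ℝ) fun k => ?_
    refine (hm (k + 1)).congr (Eventually.of_forall fun p => ?_)
    simp only [pow_succ]
    ring

end ParametricIntegral

/-! ### Segments joining two sets -/

section Join

variable {E : Type} [NormedAddCommGroup E] [InnerProductSpace ℝ E]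

/-- All the points `t w + (1 - t) y` with `t ∈ [a, b]`, `w ∈ A` and `y ∈ B`. -/
def join (a b : ℝ) (A B : Set E) : Set E :=
  (fun q : ℝ × E × E => q.1 • q.2.1 + (1 - q.1) • q.2.2) '' (Icc a b ×ˢ A ×ˢ B)

theorem isCompact_join (a b : ℝ) {A B : Set E} (hA : IsCompact A) (hB : IsCompact B) :
    IsCompact (join a b A B) :=
  (isCompact_Icc.prod (hA.prod hB)).image (by fun_prop)

theorem join_subset_closedBall {a b R : ℝ} (ha : 0 ≤ a) (hb : b ≤ 1) {A B : Set E}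
    (hA : A ⊆ Metric.closedBall 0 R) (hB : B ⊆ Metric.closedBall 0 R) :
    join a b A B ⊆ Metric.closedBall 0 R := by
  rintro _ ⟨⟨t, w, y⟩, ⟨ht, hw, hy⟩, rfl⟩
  exact convex_closedBall (0 : E) R (hA hw) (hB hy) (ha.trans ht.1)
    (sub_nonneg.2 (ht.2.trans hb)) (by ring)

end Join

/-! ### Cone averages: smoothness, derivatives and support -/

section ConeAverage

variable {E : Type} [NormedAddCommGroup E] [InnerProductSpace ℝ E] [FiniteDimensional ℝ E]
  [MeasurableSpace E] [BorelSpace E] {F : Type} [NormedAddCommGroup F] [NormedSpace ℝ F]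

/-- Lebesgue measure on `(a, b] × E`. -/
noncomputable def slabMeasure (E : Type) [NormedAddCommGroup E] [InnerProductSpace ℝ E]
    [FiniteDimensional ℝ E] [MeasurableSpace E] [BorelSpace E] (a b : ℝ) : Measure (ℝ × E) :=
  ((volume : Measure ℝ).restrict (Ioc a b)).prod volume

instance (a b : ℝ) : SFinite (slabMeasure E a b) := by
  unfold slabMeasure
  infer_instance

/-- `∫_a^b ∫ t⁻ᵏ g(y) h((x - (1 - t) y) / t) dy dt`. -/
noncomputable def coneAverage (k : ℕ) (a b : ℝ) (h : E → F) (g : E → ℝ) (x : E) : F :=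
  ∫ p, ((p.1 ^ k)⁻¹ * g p.2) • h (p.1⁻¹ • x + (1 - p.1⁻¹) • p.2) ∂slabMeasure E a b

theorem integrable_inv_pow_Ioc (k : ℕ) {a : ℝ} (ha : 0 < a) (b : ℝ) :
    Integrable (fun t : ℝ => (t ^ k)⁻¹) (volume.restrict (Ioc a b)) := by
  have h : ContinuousOn (fun t : ℝ => (t ^ k)⁻¹) (Icc a b) :=
    ContinuousOn.inv₀ (by fun_prop) fun t ht => pow_ne_zero k (ha.trans_le ht.1).ne'
  exact (h.integrableOn_compact isCompact_Icc).mono_set Ioc_subset_Icc_self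

theorem integrable_slab_weight (k : ℕ) {a : ℝ} (ha : 0 < a) (b : ℝ) {g : E → ℝ}
    (hg : Integrable g) :
    Integrable (fun p : ℝ × E => (p.1 ^ k)⁻¹ * g p.2) (slabMeasure E a b) :=
  (integrable_inv_pow_Ioc k ha b).mul_prod hg

theorem measurable_slab_shift : Measurable fun p : ℝ × E => (1 - p.1⁻¹) • p.2 :=
  (measurable_const.sub measurable_fst.inv).smul measurable_snd

theorem integrable_coneAverage (k : ℕ) {a : ℝ} (ha : 0 < a) (b : ℝ) {h : E → F}
    (hh : Continuous h) (hs : HasCompactSupport h) {g : E → ℝ} (hg : Integrable g) (x : E) :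
    Integrable (fun p : ℝ × E => ((p.1 ^ k)⁻¹ * g p.2) • h (p.1⁻¹ • x + (1 - p.1⁻¹) • p.2))
      (slabMeasure E a b) :=
  integrable_smul_comp_affine hh hs measurable_fst.inv measurable_slab_shift
    (integrable_slab_weight k ha b hg) x

/-- The argument of `h` depends on `x` through `t⁻¹ • x`, so each derivative costs one more power of
`t⁻¹`; this is why the exponent `k` is a parameter. -/
theorem hasFDerivAt_coneAverage (k : ℕ) {a : ℝ} (ha : 0 < a) (b : ℝ) {h : E → F}
    (hh : ContDiff ℝ ∞ h) (hs : HasCompactSupport h) {g : E → ℝ} (hg : Integrable g) (x : E) :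
    HasFDerivAt (coneAverage k a b h g) (coneAverage (k + 1) a b (fderiv ℝ h) g x) x := by
  have hw : (fun p : ℝ × E => (p.1 ^ k)⁻¹ * g p.2 * p.1⁻¹) =
      fun p => (p.1 ^ (k + 1))⁻¹ * g p.2 := by
    funext p
    rw [pow_succ, mul_inv]
    ring
  have hi : Integrable (fun p : ℝ × E => (p.1 ^ k)⁻¹ * g p.2 * p.1⁻¹) (slabMeasure E a b) := by
    rw [hw]
    exact integrable_slab_weight (k + 1) ha b hg
  have key := hasFDerivAt_integral_smul_comp_affine (F := F) hh hs measurable_fst.inv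
    measurable_slab_shift (integrable_slab_weight k ha b hg) hi x
  refine key.congr_fderiv ?_
  refine integral_congr_ae (Eventually.of_forall fun p => ?_)
  exact congrArg (· • fderiv ℝ h (p.1⁻¹ • x + (1 - p.1⁻¹) • p.2)) (congrFun hw p)

theorem contDiff_coneAverage (k : ℕ) {a : ℝ} (ha : 0 < a) (b : ℝ) {h : E → F}
    (hh : ContDiff ℝ ∞ h) (hs : HasCompactSupport h) {g : E → ℝ} (hg : Integrable g) :
    ContDiff ℝ ∞ (coneAverage k a b h g) := by
  refine contDiff_integral_smul_comp_affine hh hs measurable_fst.inv measurable_slab_shift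
    fun j => ?_
  have hw : (fun p : ℝ × E => (p.1 ^ k)⁻¹ * g p.2 * p.1⁻¹ ^ j) =
      fun p => (p.1 ^ (k + j))⁻¹ * g p.2 := by
    funext p
    rw [pow_add, mul_inv, inv_pow]
    ring
  rw [show (fun p : ℝ × E => (p.1 ^ k)⁻¹ * g p.2 * (p.1)⁻¹ ^ j) = _ from hw]
  exact integrable_slab_weight (k + j) ha b hg

theorem coneAverage_fderiv_apply (k : ℕ) {a : ℝ} (ha : 0 < a) (b : ℝ) {h : E → F}
    (hh : ContDiff ℝ ∞ h) (hs : HasCompactSupport h) {g : E → ℝ} (hg : Integrable g) (x v : E) :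
    coneAverage k a b (fderiv ℝ h) g x v = coneAverage k a b (fun w => fderiv ℝ h w v) g x := by
  unfold coneAverage
  rw [ContinuousLinearMap.integral_apply (integrable_coneAverage k ha b
    (hh.continuous_fderiv (by simp)) (hs.fderiv ℝ) hg x)]
  rfl

theorem fderiv_coneAverage_apply (k : ℕ) {a : ℝ} (ha : 0 < a) (b : ℝ) {h : E → F}
    (hh : ContDiff ℝ ∞ h) (hs : HasCompactSupport h) {g : E → ℝ} (hg : Integrable g) (x v : E) :
    fderiv ℝ (coneAverage k a b h g) x v =
      coneAverage (k + 1) a b (fun w => fderiv ℝ h w v) g x := by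
  rw [(hasFDerivAt_coneAverage k ha b hh hs hg x).fderiv,
    coneAverage_fderiv_apply (k + 1) ha b hh hs hg]

/-- With `w = t⁻¹ x + (1 - t⁻¹) y` one has `x = t w + (1 - t) y`, and the integrand is nonzero only
if `w` and `y` lie in the supports of `h` and `g`. This is how star-shapedness later keeps the
constructed fields inside the domain. -/
theorem support_coneAverage_subset (k : ℕ) {a : ℝ} (ha : 0 < a) (b : ℝ) (h : E → F) (g : E → ℝ) :
    Function.support (coneAverage k a b h g) ⊆ join a b (tsupport h) (tsupport g) := by
  intro x hx
  by_contra hcon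
  refine hx ?_
  unfold coneAverage
  have hae : ∀ᵐ p ∂slabMeasure E a b, p.1 ∈ Ioc a b :=
    Measure.quasiMeasurePreserving_fst.ae (ae_restrict_mem measurableSet_Ioc)
  rw [integral_eq_zero_of_ae]
  filter_upwards [hae] with p hp
  by_contra hne
  refine hcon ⟨(p.1, p.1⁻¹ • x + (1 - p.1⁻¹) • p.2, p.2), ⟨⟨hp.1.le, hp.2⟩, ?_, ?_⟩, ?_⟩
  · refine subset_tsupport _ fun h0 => hne ?_
    simp [h0]
  · refine subset_tsupport _ fun h0 => hne ?_
    simp [h0]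
  · have : p.1 ≠ 0 := (ha.trans hp.1).ne'
    simp only [smul_add, smul_smul, mul_sub, mul_inv_cancel₀ this, one_smul, mul_one]
    rw [add_assoc, ← add_smul]
    simp

theorem tsupport_coneAverage_subset (k : ℕ) {a : ℝ} (ha : 0 < a) (b : ℝ) {h : E → F} {g : E → ℝ}
    (hh : HasCompactSupport h) (hg : HasCompactSupport g) :
    tsupport (coneAverage k a b h g) ⊆ join a b (tsupport h) (tsupport g) :=
  closure_minimal (support_coneAverage_subset k ha b h g) (isCompact_join a b hh hg).isClosed

theorem hasCompactSupport_coneAverage (k : ℕ) {a : ℝ} (ha : 0 < a) (b : ℝ) {h : E → F} {g : E → ℝ}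
    (hh : HasCompactSupport h) (hg : HasCompactSupport g) :
    HasCompactSupport (coneAverage k a b h g) :=
  (isCompact_join a b hh hg).of_isClosed_subset (isClosed_tsupport _)
    (tsupport_coneAverage_subset k ha b hh hg)

theorem coneAverage_add_adjacent (k : ℕ) {a b c : ℝ} (ha : 0 < a) (hab : a ≤ b) (hbc : b ≤ c)
    {h : E → F} (hh : Continuous h) (hs : HasCompactSupport h) {g : E → ℝ} (hg : Integrable g)
    (x : E) :
    coneAverage k a c h g x = coneAverage k a b h g x + coneAverage k b c h g x := by
  have hm : slabMeasure E a c = slabMeasure E a b + slabMeasure E b c := by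
    unfold slabMeasure
    rw [← Ioc_union_Ioc_eq_Ioc hab hbc, Measure.restrict_union (Ioc_disjoint_Ioc_of_le le_rfl)
      measurableSet_Ioc, Measure.add_prod]
  unfold coneAverage
  rw [hm, integral_add_measure (integrable_coneAverage k ha b hh hs hg x)
    (integrable_coneAverage k (ha.trans_le hab) c hh hs hg x)]

end ConeAverage

/-! ### Fourier transforms of test functions and of cone averages -/

section Fourier

open scoped FourierTransform RealInnerProductSpace

variable {E : Type} [NormedAddCommGroup E] [InnerProductSpace ℝ E] [FiniteDimensional ℝ E]
  [MeasurableSpace E] [BorelSpace E]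

/-- The Fourier transform of a real-valued function. -/
noncomputable def realFourier (f : E → ℝ) (ξ : E) : ℂ := 𝓕 (fun x => (f x : ℂ)) ξ

theorem exists_schwartz_ofReal {f : E → ℝ} (hf : ContDiff ℝ ∞ f) (hs : HasCompactSupport f) :
    ∃ F : SchwartzMap E ℂ, (∀ x, F x = f x) ∧ ∀ ξ, (𝓕 F) ξ = realFourier f ξ := by
  have h1 : HasCompactSupport (fun x => (f x : ℂ)) := hs.comp_left Complex.ofReal_zero
  have h2 : ContDiff ℝ ∞ (fun x => (f x : ℂ)) := Complex.ofRealCLM.contDiff.comp hf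
  exact ⟨h1.toSchwartzMap h2, fun x => rfl, fun ξ => by rw [SchwartzMap.fourier_coe]; rfl⟩

theorem continuous_realFourier {f : E → ℝ} (hf : ContDiff ℝ ∞ f) (hs : HasCompactSupport f) :
    Continuous (realFourier f) := by
  obtain ⟨F, -, hF⟩ := exists_schwartz_ofReal hf hs
  rw [← funext hF]
  exact (𝓕 F).continuous

theorem integral_norm_sq_realFourier {f : E → ℝ} (hf : ContDiff ℝ ∞ f)
    (hs : HasCompactSupport f) : ∫ ξ, ‖realFourier f ξ‖ ^ 2 = ∫ x, f x ^ 2 := by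
  obtain ⟨F, hF1, hF2⟩ := exists_schwartz_ofReal hf hs
  have h := F.integral_norm_sq_fourier
  simpa [hF1, hF2] using h

theorem integrable_norm_sq_realFourier {f : E → ℝ} (hf : ContDiff ℝ ∞ f)
    (hs : HasCompactSupport f) : Integrable fun ξ => ‖realFourier f ξ‖ ^ 2 := by
  obtain ⟨F, hF1, hF2⟩ := exists_schwartz_ofReal hf hs
  rw [← funext fun ξ => congrArg (‖·‖ ^ 2) (hF2 ξ)]
  exact ((𝓕 F).memLp 2 volume).integrable_norm_pow two_ne_zero

theorem exists_norm_realFourier_le {f : E → ℝ} (hf : ContDiff ℝ ∞ f) (hs : HasCompactSupport f) :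
    ∃ C, 0 < C ∧ ∀ ξ, ‖realFourier f ξ‖ * (1 + ‖ξ‖ ^ 2) ≤ C := by
  obtain ⟨F, -, hF⟩ := exists_schwartz_ofReal hf hs
  obtain ⟨C0, hC0, h0⟩ := (𝓕 F).decay 0 0
  obtain ⟨C2, hC2, h2⟩ := (𝓕 F).decay 2 0
  refine ⟨C0 + C2, by positivity, fun ξ => ?_⟩
  have h0' := h0 ξ
  have h2' := h2 ξ
  rw [norm_iteratedFDeriv_zero, hF] at h0' h2'
  rw [pow_zero, one_mul] at h0'
  linarith

/-- The Fourier transform of a directional derivative carries the factor `2πi⟨ξ, v⟩`. Its vanishing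
at the origin is what compensates the factor `t⁻¹` in the differentiated cone averages for small
`t`. -/
theorem exists_norm_realFourier_fderiv_le {f : E → ℝ} (hf : ContDiff ℝ ∞ f)
    (hs : HasCompactSupport f) (v : E) :
    ∃ C, 0 < C ∧ ∀ ξ, ‖realFourier (fun x => fderiv ℝ f x v) ξ‖ * (1 + ‖ξ‖ ^ 2) ≤ C * ‖ξ‖ := by
  obtain ⟨C, hC, h⟩ := exists_norm_realFourier_le hf hs
  set fc : E → ℂ := fun x => (f x : ℂ) with hfc
  have hs' : HasCompactSupport fc := hs.comp_left Complex.ofReal_zero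
  have hf' : ContDiff ℝ ∞ fc := Complex.ofRealCLM.contDiff.comp hf
  have hder : ∀ x, fderiv ℝ fc x = Complex.ofRealCLM.comp (fderiv ℝ f x) := fun x =>
    (Complex.ofRealCLM.hasFDerivAt.comp x (hf.differentiable (by simp) x).hasFDerivAt).fderiv
  have hint : Integrable (fderiv ℝ fc) :=
    (hf'.continuous_fderiv (by simp)).integrable_of_hasCompactSupport (hs'.fderiv ℝ)
  have key := Real.fourier_fderiv (hf'.continuous.integrable_of_hasCompactSupport hs')
    (hf'.differentiable (by simp)) hint
  have hF : ∀ ξ, realFourier (fun x => fderiv ℝ f x v) ξ = (𝓕 (fderiv ℝ fc) ξ) v := by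
    intro ξ
    unfold realFourier
    rw [Real.fourier_eq, Real.fourier_eq, ContinuousLinearMap.integral_apply]
    · refine integral_congr_ae (Eventually.of_forall fun x => ?_)
      simp only [hder, Circle.smul_def]
      rfl
    · exact (Real.fourierIntegral_convergent_iff ξ).2 hint
  have hle : ∀ ξ, ‖realFourier (fun x => fderiv ℝ f x v) ξ‖ ≤
      2 * Real.pi * ‖v‖ * ‖ξ‖ * ‖realFourier f ξ‖ := by
    intro ξ
    rw [hF, key, VectorFourier.fourierSMulRight_apply]
    have h1 : |⟪ξ, v⟫| ≤ ‖ξ‖ * ‖v‖ := abs_real_inner_le_norm ξ v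
    have h2 : ‖realFourier f ξ‖ = ‖𝓕 fc ξ‖ := rfl
    have h3 : ‖-(2 * (Real.pi : ℂ) * Complex.I) • ((-innerSL ℝ) ξ v • 𝓕 fc ξ)‖ =
        2 * Real.pi * (|⟪ξ, v⟫| * ‖𝓕 fc ξ‖) := by
      simp [abs_of_pos Real.pi_pos]
    rw [h2, h3]
    have hp := Real.pi_pos
    calc _ ≤ 2 * Real.pi * ((‖ξ‖ * ‖v‖) * ‖𝓕 fc ξ‖) := by gcongr
      _ = _ := by ring
  -- Using `‖v‖ + 1` in place of `‖v‖` keeps the constant positive when `v = 0`.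
  refine ⟨2 * Real.pi * (‖v‖ + 1) * C, by positivity, fun ξ => ?_⟩
  calc _ ≤ 2 * Real.pi * ‖v‖ * ‖ξ‖ * ‖realFourier f ξ‖ * (1 + ‖ξ‖ ^ 2) := by
        gcongr; exact hle ξ
    _ = 2 * Real.pi * ‖v‖ * ‖ξ‖ * (‖realFourier f ξ‖ * (1 + ‖ξ‖ ^ 2)) := by ring
    _ ≤ 2 * Real.pi * (‖v‖ + 1) * ‖ξ‖ * C := by
        gcongr
        · linarith
        · exact h ξ
    _ = _ := by ring

theorem integral_comp_smul_add {G : Type} [NormedAddCommGroup G] [NormedSpace ℝ G]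
    (φ : E → G) (r : ℝ) (c : E) :
    ∫ x, φ (r • x + c) = |(r ^ Module.finrank ℝ E)⁻¹| • ∫ x, φ x := by
  rw [Measure.integral_comp_smul volume (fun x => φ (x + c)), integral_add_right_eq_self]

/-- Substitute `x = t w + (1 - t) y`: the phase splits as `⟨x, ξ⟩ = ⟨w, tξ⟩ + ⟨y, (1 - t)ξ⟩` and the
Jacobian `tⁿ` cancels all of the singular weight except `t⁻ᵏ`. Fubini then separates the transforms
of `h` and `g`. -/
theorem realFourier_coneAverage (k : ℕ) {a : ℝ} (ha : 0 < a) (b : ℝ) {h : E → ℝ}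
    (hh : Continuous h) (hs : HasCompactSupport h) {g : E → ℝ} (hg : Integrable g) (ξ : E) :
    realFourier (coneAverage (Module.finrank ℝ E + k) a b h g) ξ =
      ∫ t in Ioc a b, ((t ^ k)⁻¹ : ℝ) * realFourier h (t • ξ) * realFourier g ((1 - t) • ξ) := by
  set n := Module.finrank ℝ E with hn
  set μ := slabMeasure E a b with hμ
  set m : ℝ × E → ℝ := fun p => (p.1 ^ (n + k))⁻¹ * g p.2 with hm
  have hmi : Integrable m μ := integrable_slab_weight (n + k) ha b hg
  have hpos : ∀ᵐ p ∂μ, 0 < p.1 := by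
    have : ∀ᵐ p ∂μ, p.1 ∈ Ioc a b :=
      Measure.quasiMeasurePreserving_fst.ae (ae_restrict_mem measurableSet_Ioc)
    filter_upwards [this] with p hp using ha.trans hp.1
  let K : E → ℝ × E → ℂ := fun x p =>
    Real.fourierChar (-⟪x, ξ⟫) • ((m p * h (p.1⁻¹ • x + (1 - p.1⁻¹) • p.2) : ℝ) : ℂ)
  have hKnorm : ∀ x p, ‖K x p‖ = |m p| * |h (p.1⁻¹ • x + (1 - p.1⁻¹) • p.2)| := by
    intro x p
    simp only [K, Circle.norm_smul, Complex.norm_real, Real.norm_eq_abs, abs_mul]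
  have hhi : Integrable h := hh.integrable_of_hasCompactSupport hs
  have hKm : AEStronglyMeasurable (Function.uncurry K) (volume.prod μ) := by
    have h1 : AEStronglyMeasurable (fun q : E × ℝ × E => m q.2) (volume.prod μ) :=
      hmi.aestronglyMeasurable.comp_snd
    have h2 : Measurable fun q : E × ℝ × E => q.2.1⁻¹ • q.1 + (1 - q.2.1⁻¹) • q.2.2 := by
      fun_prop
    have h3 : AEStronglyMeasurable
        (fun q : E × ℝ × E => h (q.2.1⁻¹ • q.1 + (1 - q.2.1⁻¹) • q.2.2)) (volume.prod μ) :=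
      hh.comp_aestronglyMeasurable h2.aestronglyMeasurable
    have h4 : Continuous fun q : E × ℝ × E => (Real.fourierChar (-⟪q.1, ξ⟫) : Circle) := by
      fun_prop
    exact h4.aestronglyMeasurable.smul
      (Complex.continuous_ofReal.comp_aestronglyMeasurable (h1.mul h3))
  -- Integrating the norm in `x` first produces `tⁿ |m| ∫ |h|`, which is integrable over the slab
  -- because `t ≥ a > 0` there.
  have hKi : Integrable (Function.uncurry K) (volume.prod μ) := by
    rw [integrable_prod_iff' hKm]
    constructor
    · filter_upwards [hpos] with p hp
      have hcomp : Integrable fun x => h (p.1⁻¹ • x + (1 - p.1⁻¹) • p.2) :=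
        (hhi.comp_add_right ((1 - p.1⁻¹) • p.2)).comp_smul (inv_ne_zero hp.ne')
      have h1 : Integrable fun x => ((m p * h (p.1⁻¹ • x + (1 - p.1⁻¹) • p.2) : ℝ) : ℂ) :=
        (hcomp.const_mul (m p)).ofReal
      exact (Real.fourierIntegral_convergent_iff ξ).2 h1
    · have h2 : ∀ᵐ p ∂μ, ((p.1 ^ k)⁻¹ * g p.2) * ∫ x, |h x| =
          (p.1 ^ n * m p) * ∫ x, |h x| := by
        filter_upwards [hpos] with p hp
        simp only [hm, pow_add]
        field_simp
      have h3 : Integrable (fun p => ‖((p.1 ^ k)⁻¹ * g p.2) * ∫ x, |h x|‖) μ :=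
        ((integrable_slab_weight k ha b hg).mul_const _).norm
      refine h3.congr ?_
      filter_upwards [hpos, h2] with p hp h2p
      have habs : |(p.1⁻¹ ^ Module.finrank ℝ E)⁻¹| = p.1 ^ n := by
        rw [inv_pow, inv_inv, abs_of_nonneg (pow_nonneg hp.le _)]
      simp only [Function.uncurry, hKnorm]
      rw [integral_const_mul, integral_comp_smul_add (fun x => |h x|), h2p, norm_mul, norm_mul,
        Real.norm_of_nonneg (pow_nonneg hp.le n),
        Real.norm_of_nonneg (integral_nonneg fun x => abs_nonneg (h x)),
        habs, smul_eq_mul, Real.norm_eq_abs]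
      ring
  have hinner : ∀ᵐ p ∂μ, ∫ x, K x p =
      (((p.1 ^ k)⁻¹ : ℝ) * realFourier h (p.1 • ξ)) *
        (Real.fourierChar (-⟪p.2, (1 - p.1) • ξ⟫) • (g p.2 : ℂ)) := by
    filter_upwards [hpos] with p hp
    have hne : p.1 ≠ 0 := hp.ne'
    have hsub : ∀ x, K x p = (fun w => (m p : ℂ) * (Real.fourierChar (-⟪p.2, (1 - p.1) • ξ⟫) •
        (Real.fourierChar (-⟪w, p.1 • ξ⟫) • (h w : ℂ)))) (p.1⁻¹ • x + (1 - p.1⁻¹) • p.2) := by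
      intro x
      simp only [K, smul_smul, ← AddChar.map_add_eq_mul]
      rw [mul_smul_comm]
      push_cast
      congr 2
      simp only [inner_add_left, inner_smul_left, inner_smul_right, conj_trivial]
      field_simp
      ring
    rw [integral_congr_ae (Eventually.of_forall hsub), integral_comp_smul_add (fun w =>
      (m p : ℂ) * (Real.fourierChar (-⟪p.2, (1 - p.1) • ξ⟫) •
        (Real.fourierChar (-⟪w, p.1 • ξ⟫) • (h w : ℂ)))),
      integral_const_mul]
    simp only [Circle.smul_def (Real.fourierChar (-⟪p.2, (1 - p.1) • ξ⟫))]
    rw [integral_smul, ← Real.fourier_eq,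
      abs_of_nonneg (by positivity), inv_pow, inv_inv]
    change (p.1 ^ n) • ((m p : ℂ) * (_ • realFourier h (p.1 • ξ))) = _
    simp only [hm, Complex.real_smul, smul_eq_mul, pow_add]
    push_cast
    have : (p.1 : ℂ) ≠ 0 := by exact_mod_cast hne
    field_simp
  have hIp : Integrable (fun p : ℝ × E => (((p.1 ^ k)⁻¹ : ℝ) * realFourier h (p.1 • ξ)) *
        (Real.fourierChar (-⟪p.2, (1 - p.1) • ξ⟫) • (g p.2 : ℂ))) μ :=
    hKi.integral_prod_right.congr hinner
  calc realFourier (coneAverage (n + k) a b h g) ξ = ∫ x, ∫ p, K x p ∂μ := by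
        unfold realFourier
        rw [Real.fourier_eq]
        refine integral_congr_ae (Eventually.of_forall fun x => ?_)
        simp only [K, Circle.smul_def (Real.fourierChar (-⟪x, ξ⟫))]
        rw [integral_smul, integral_complex_ofReal]
        rfl
    _ = ∫ p, (∫ x, K x p) ∂μ := integral_integral_swap hKi
    _ = ∫ p, (((p.1 ^ k)⁻¹ : ℝ) * realFourier h (p.1 • ξ)) *
        (Real.fourierChar (-⟪p.2, (1 - p.1) • ξ⟫) • (g p.2 : ℂ)) ∂μ := integral_congr_ae hinner
    _ = _ := by
        rw [hμ, slabMeasure, integral_prod _ hIp]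
        refine integral_congr_ae (Eventually.of_forall fun t => ?_)
        simp only
        rw [integral_const_mul]
        congr 1

end Fourier

/-! ### Weighted Cauchy–Schwarz and the weight dominating the symbols -/

/-- Expand `∫ W (G - I/S)² ≥ 0`, where `I = ∫ W G`, and bound `∫ W` by `S`. -/
theorem sq_integral_mul_le {P : Type*} [MeasurableSpace P] {μ : Measure P} {W G : P → ℝ} {S : ℝ}
    (hS : 0 < S) (hWi : Integrable W μ) (hWG : Integrable (fun p => W p * G p ^ 2) μ)
    (hW : ∀ p, 0 ≤ W p) (hWS : ∫ p, W p ∂μ ≤ S) :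
    (∫ p, W p * G p ∂μ) ^ 2 ≤ S * ∫ p, W p * G p ^ 2 ∂μ := by
  by_cases hi : Integrable (fun p => W p * G p) μ
  · set I := ∫ p, W p * G p ∂μ with hI
    have h1 : 0 ≤ ∫ p, (W p * G p ^ 2 - 2 * (I / S) * (W p * G p) + (I / S) ^ 2 * W p) ∂μ :=
      integral_nonneg fun p => by
        have : W p * G p ^ 2 - 2 * (I / S) * (W p * G p) + (I / S) ^ 2 * W p =
          W p * (G p - I / S) ^ 2 := by ring
        rw [Pi.zero_apply, this]
        exact mul_nonneg (hW p) (sq_nonneg _)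
    have h0 : Integrable (fun p => W p * G p ^ 2 - 2 * (I / S) * (W p * G p)) μ :=
      hWG.sub (hi.const_mul _)
    rw [integral_add h0 (hWi.const_mul _),
      integral_sub hWG (hi.const_mul _), integral_const_mul, integral_const_mul, ← hI] at h1
    have h2 : (I / S) ^ 2 * ∫ p, W p ∂μ ≤ (I / S) ^ 2 * S :=
      mul_le_mul_of_nonneg_left hWS (sq_nonneg _)
    have h3 : 2 * (I / S) * I - (I / S) ^ 2 * S = I ^ 2 / S := by
      field_simp
      ring
    have h4 : I ^ 2 / S ≤ ∫ p, W p * G p ^ 2 ∂μ := by linarith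
    rw [div_le_iff₀ hS] at h4
    linarith
  -- If `W G` is not integrable its integral is `0` by convention, and the inequality is trivial.
  · rw [integral_undef hi]
    have : 0 ≤ ∫ p, W p * G p ^ 2 ∂μ :=
      integral_nonneg fun p => mul_nonneg (hW p) (sq_nonneg _)
    rw [zero_pow two_ne_zero]
    exact mul_nonneg hS.le this

section Weight

/-- A weight dominating the Fourier symbols of the cone averages. -/
noncomputable def symbolWeight (t r : ℝ) : ℝ := 1 + r / (1 + (t * r) ^ 2)

theorem continuous_symbolWeight : Continuous fun q : ℝ × ℝ => symbolWeight q.1 q.2 := by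
  unfold symbolWeight
  refine continuous_const.add (continuous_snd.div (by fun_prop) fun q => ?_)
  positivity

theorem symbolWeight_nonneg (t : ℝ) {r : ℝ} (hr : 0 ≤ r) : 0 ≤ symbolWeight t r := by
  unfold symbolWeight
  positivity

theorem integrable_symbolWeight (a b r : ℝ) :
    Integrable (fun t => symbolWeight t r) (volume.restrict (Ioc a b)) := by
  have h : Continuous fun t => symbolWeight t r :=
    continuous_symbolWeight.comp (by fun_prop : Continuous fun t : ℝ => (t, r))
  exact (h.continuousOn.integrableOn_compact isCompact_Icc).mono_set Ioc_subset_Icc_self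

/-- In `t`, the weight has primitive `t + arctan (t r)`, so the integral is at most `1/2 + π/2`,
whatever `r` and `ε`. This uniformity in the frequency is the heart of the `L²` bounds. -/
theorem integral_symbolWeight_le {ε r : ℝ} (hε : 0 < ε) (hε' : ε ≤ 1 / 2) (hr : 0 ≤ r) :
    ∫ t in Ioc ε (1 / 2), symbolWeight t r ≤ 3 := by
  have hd : ∀ t ∈ uIcc ε (1 / 2),
      HasDerivAt (fun t => t + Real.arctan (t * r)) (symbolWeight t r) t := by
    intro t _
    have h1 := (hasDerivAt_id t).add
      ((Real.hasDerivAt_arctan (t * r)).comp t ((hasDerivAt_id t).mul_const r))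
    refine h1.congr_deriv ?_
    simp [symbolWeight]
    ring
  have hc : Continuous fun t => symbolWeight t r :=
    continuous_symbolWeight.comp (by fun_prop : Continuous fun t : ℝ => (t, r))
  rw [← intervalIntegral.integral_of_le hε',
    intervalIntegral.integral_eq_sub_of_hasDerivAt hd (hc.intervalIntegrable _ _)]
  have h1 : 0 ≤ Real.arctan (ε * r) := Real.arctan_nonneg.2 (by positivity)
  have h2 := Real.arctan_lt_pi_div_two (1 / 2 * r)
  have h3 := Real.pi_lt_d2
  linarith

/-- Needed to change variables to `(1 - t)ξ`: for `t ≤ 1/2` the factor `1 - t` lies between `1/2`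
and `1`, so the numerator loses at most a factor `2` while the denominator only decreases. -/
theorem symbolWeight_le_two_mul {t r : ℝ} (ht : t ≤ 1 / 2) (ht0 : 0 ≤ t) (hr : 0 ≤ r) :
    symbolWeight t r ≤ 2 * symbolWeight t ((1 - t) * r) := by
  unfold symbolWeight
  have h1 : r ≤ 2 * ((1 - t) * r) := by nlinarith
  have h2 : (t * ((1 - t) * r)) ^ 2 ≤ (t * r) ^ 2 := by
    have : (1 - t) * r ≤ r := by nlinarith
    have h0 : 0 ≤ (1 - t) * r := by nlinarith
    gcongr
  have h0 : 0 ≤ 2 * ((1 - t) * r) := hr.trans h1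
  have h3 : r / (1 + (t * r) ^ 2) ≤ 2 * ((1 - t) * r) / (1 + (t * ((1 - t) * r)) ^ 2) := by
    gcongr
  rw [mul_add, ← mul_div_assoc]
  linarith

end Weight

/-! ### Uniform `L²` bounds for cone averages -/

section Bounds

variable {E : Type} [NormedAddCommGroup E] [InnerProductSpace ℝ E] [FiniteDimensional ℝ E]
  [MeasurableSpace E] [BorelSpace E]

theorem lintegral_comp_smul (f : E → ℝ≥0∞) {r : ℝ} (hr : r ≠ 0) :
    ∫⁻ x, f (r • x) = ENNReal.ofReal |(r ^ Module.finrank ℝ E)⁻¹| * ∫⁻ x, f x := by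
  have h := lintegral_map_equiv (μ := (volume : Measure E)) f (MeasurableEquiv.smul₀ r hr)
  rw [MeasurableEquiv.coe_smul₀, Measure.map_addHaar_smul volume hr, lintegral_smul_measure] at h
  exact h.symm

/-- Exchange the integrals, substitute `(1 - t)ξ` for each fixed `t` (Jacobian at most `2ⁿ`, weight
comparison `2`), exchange back and integrate the weight in `t` (at most `3`). The constant is `2ⁿ *
2 * 3`. -/
theorem lintegral_symbolWeight_mul_le {G : E → ℝ} (hG : Continuous G) (hG0 : ∀ ξ, 0 ≤ G ξ)
    {ε : ℝ} (hε : 0 < ε) (hε' : ε ≤ 1 / 2) :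
    ∫⁻ ξ, ∫⁻ t in Ioc ε (1 / 2), ENNReal.ofReal (symbolWeight t ‖ξ‖ * G ((1 - t) • ξ)) ≤
      ENNReal.ofReal (2 ^ Module.finrank ℝ E * 6) * ∫⁻ ξ, ENNReal.ofReal (G ξ) := by
  set n := Module.finrank ℝ E
  have hm1 : Measurable (Function.uncurry fun (ξ : E) (t : ℝ) =>
      ENNReal.ofReal (symbolWeight t ‖ξ‖ * G ((1 - t) • ξ))) := by
    refine ENNReal.measurable_ofReal.comp (Continuous.measurable ?_)
    exact (continuous_symbolWeight.comp
      (by fun_prop : Continuous fun q : E × ℝ => (q.2, ‖q.1‖))).mul (hG.comp (by fun_prop))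
  have hm2 : Measurable (Function.uncurry fun (t : ℝ) (ξ : E) =>
      ENNReal.ofReal (2 * symbolWeight t ‖ξ‖ * G ξ)) := by
    refine ENNReal.measurable_ofReal.comp (Continuous.measurable ?_)
    exact (continuous_const.mul (continuous_symbolWeight.comp
      (by fun_prop : Continuous fun q : ℝ × E => (q.1, ‖q.2‖)))).mul (hG.comp (by fun_prop))
  rw [lintegral_lintegral_swap hm1.aemeasurable]
  have hstep : ∀ t ∈ Ioc ε (1 / 2),
      ∫⁻ ξ, ENNReal.ofReal (symbolWeight t ‖ξ‖ * G ((1 - t) • ξ)) ≤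
        ENNReal.ofReal (2 ^ n) * ∫⁻ ξ, ENNReal.ofReal (2 * symbolWeight t ‖ξ‖ * G ξ) := by
    intro t ht
    have ht0 : 0 < t := hε.trans ht.1
    have h1t : (1 : ℝ) / 2 ≤ 1 - t := by linarith [ht.2]
    have hpos : 0 < 1 - t := by linarith
    calc _ ≤ ∫⁻ ξ : E, (fun η : E => ENNReal.ofReal (2 * symbolWeight t ‖η‖ * G η))
          ((1 - t) • ξ) := by
          refine lintegral_mono fun ξ => ENNReal.ofReal_le_ofReal ?_
          refine mul_le_mul_of_nonneg_right ?_ (hG0 _)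
          rw [norm_smul, Real.norm_of_nonneg hpos.le]
          exact symbolWeight_le_two_mul ht.2 ht0.le (norm_nonneg _)
      _ = ENNReal.ofReal |((1 - t) ^ n)⁻¹| *
          ∫⁻ ξ, ENNReal.ofReal (2 * symbolWeight t ‖ξ‖ * G ξ) :=
          lintegral_comp_smul (E := E)
            (fun η => ENNReal.ofReal (2 * symbolWeight t ‖η‖ * G η)) hpos.ne'
      _ ≤ _ := by
          gcongr
          rw [abs_of_pos (by positivity), ← inv_pow]
          gcongr
          rw [inv_le_comm₀ hpos two_pos]
          linarith
  calc _ ≤ ∫⁻ t in Ioc ε (1 / 2), ENNReal.ofReal (2 ^ n) *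
        ∫⁻ ξ, ENNReal.ofReal (2 * symbolWeight t ‖ξ‖ * G ξ) :=
        setLIntegral_mono' measurableSet_Ioc hstep
    _ = ENNReal.ofReal (2 ^ n) * ∫⁻ ξ, ∫⁻ t in Ioc ε (1 / 2),
        ENNReal.ofReal (2 * symbolWeight t ‖ξ‖ * G ξ) := by
        rw [lintegral_const_mul' _ _ ENNReal.ofReal_ne_top,
          lintegral_lintegral_swap hm2.aemeasurable]
    _ ≤ ENNReal.ofReal (2 ^ n) * ∫⁻ ξ, ENNReal.ofReal 6 * ENNReal.ofReal (G ξ) := by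
        gcongr with ξ
        have hi : Integrable (fun t => 2 * symbolWeight t ‖ξ‖ * G ξ)
            (volume.restrict (Ioc ε (1 / 2))) :=
          ((integrable_symbolWeight ε (1 / 2) ‖ξ‖).const_mul 2).mul_const _
        rw [← ofReal_integral_eq_lintegral_ofReal hi (Eventually.of_forall fun t =>
          mul_nonneg (mul_nonneg two_pos.le (symbolWeight_nonneg t (norm_nonneg ξ))) (hG0 ξ)),
          integral_mul_const, integral_const_mul, ← ENNReal.ofReal_mul (by norm_num)]
        refine ENNReal.ofReal_le_ofReal (mul_le_mul_of_nonneg_right ?_ (hG0 ξ))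
        linarith [integral_symbolWeight_le hε hε' (norm_nonneg ξ)]
    _ = _ := by
        rw [lintegral_const_mul' _ _ ENNReal.ofReal_ne_top, ← mul_assoc,
          ← ENNReal.ofReal_mul (by positivity)]

/-- A Schur-type argument on the Fourier side: Plancherel, then Cauchy–Schwarz in `t` against the
weight, then integration in `ξ`. The bound does not see the lower cut-off `ε`. -/
theorem integral_sq_coneAverage_le_of_symbol (k : ℕ) {h : E → ℝ} (hh : ContDiff ℝ ∞ h)
    (hs : HasCompactSupport h) {C : ℝ}
    (hC : ∀ t ∈ Ioc (0 : ℝ) (1 / 2), ∀ ξ,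
      (t ^ k)⁻¹ * ‖realFourier h (t • ξ)‖ ≤ C * symbolWeight t ‖ξ‖)
    {ε : ℝ} (hε : 0 < ε) (hε' : ε ≤ 1 / 2) {g : E → ℝ} (hg : ContDiff ℝ ∞ g)
    (hgs : HasCompactSupport g) :
    ∫ x, coneAverage (Module.finrank ℝ E + k) ε (1 / 2) h g x ^ 2 ≤
      C ^ 2 * 3 * (2 ^ Module.finrank ℝ E * 6) * ∫ x, g x ^ 2 := by
  set n := Module.finrank ℝ E
  have hgi : Integrable g := hg.continuous.integrable_of_hasCompactSupport hgs
  set A := coneAverage (n + k) ε (1 / 2) h g with hA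
  have hAd : ContDiff ℝ ∞ A := contDiff_coneAverage _ hε _ hh hs hgi
  have hAs : HasCompactSupport A := hasCompactSupport_coneAverage _ hε _ hs hgs
  set G : E → ℝ := fun ξ => ‖realFourier g ξ‖ ^ 2 with hG
  have hgc : Continuous (realFourier g) := continuous_realFourier hg hgs
  have hGc : Continuous G := hgc.norm.pow 2
  have hWc : ∀ ξ : E, Continuous fun t : ℝ => symbolWeight t ‖ξ‖ := fun ξ =>
    continuous_symbolWeight.comp (by fun_prop : Continuous fun t : ℝ => (t, ‖ξ‖))
  have hIoc : ∀ {φ : ℝ → ℝ}, Continuous φ → Integrable φ (volume.restrict (Ioc ε (1 / 2))) :=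
    fun hφ => (hφ.continuousOn.integrableOn_compact isCompact_Icc).mono_set Ioc_subset_Icc_self
  have hpt : ∀ ξ, ‖realFourier A ξ‖ ^ 2 ≤
      C ^ 2 * 3 * ∫ t in Ioc ε (1 / 2), symbolWeight t ‖ξ‖ * G ((1 - t) • ξ) := by
    intro ξ
    have hc1 : Continuous fun t : ℝ => ‖realFourier g ((1 - t) • ξ)‖ :=
      (hgc.comp (by fun_prop)).norm
    have h1 : ‖realFourier A ξ‖ ≤
        ∫ t in Ioc ε (1 / 2), C * (symbolWeight t ‖ξ‖ * ‖realFourier g ((1 - t) • ξ)‖) := by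
      rw [hA, realFourier_coneAverage k hε _ hh.continuous hs hgi]
      refine norm_integral_le_of_norm_le (hIoc (continuous_const.mul ((hWc ξ).mul hc1))) ?_
      filter_upwards [ae_restrict_mem measurableSet_Ioc] with t ht
      have ht0 : 0 < t := hε.trans ht.1
      rw [norm_mul, norm_mul, Complex.norm_real, Real.norm_of_nonneg (by positivity), ← mul_assoc]
      exact mul_le_mul_of_nonneg_right (hC t ⟨ht0, ht.2⟩ ξ) (norm_nonneg _)
    rw [integral_const_mul] at h1
    calc ‖realFourier A ξ‖ ^ 2
        ≤ (C * ∫ t in Ioc ε (1 / 2), symbolWeight t ‖ξ‖ * ‖realFourier g ((1 - t) • ξ)‖) ^ 2 := by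
          gcongr
      _ = C ^ 2 * (∫ t in Ioc ε (1 / 2),
          symbolWeight t ‖ξ‖ * ‖realFourier g ((1 - t) • ξ)‖) ^ 2 := mul_pow _ _ _
      _ ≤ C ^ 2 * (3 * ∫ t in Ioc ε (1 / 2), symbolWeight t ‖ξ‖ * G ((1 - t) • ξ)) := by
          gcongr
          exact sq_integral_mul_le three_pos (hIoc (hWc ξ)) (hIoc ((hWc ξ).mul (hc1.pow 2)))
            (fun t => symbolWeight_nonneg t (norm_nonneg ξ))
            (integral_symbolWeight_le hε hε' (norm_nonneg ξ))
      _ = _ := by ring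
  rw [← integral_norm_sq_realFourier hAd hAs, ← integral_norm_sq_realFourier hg hgs]
  have hGi : Integrable G := integrable_norm_sq_realFourier hg hgs
  have hI0 : 0 ≤ ∫ ξ, G ξ := integral_nonneg fun ξ => by positivity
  -- With lower integrals the exchange of `ξ` and `t` needs measurability only.
  rw [← ENNReal.ofReal_le_ofReal_iff (by positivity),
    ofReal_integral_eq_lintegral_ofReal (integrable_norm_sq_realFourier hAd hAs)
      (Eventually.of_forall fun ξ => by positivity),
    ENNReal.ofReal_mul (by positivity),
    ofReal_integral_eq_lintegral_ofReal hGi (Eventually.of_forall fun ξ => by positivity)]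
  calc ∫⁻ ξ, ENNReal.ofReal (‖realFourier A ξ‖ ^ 2)
      ≤ ∫⁻ ξ, ENNReal.ofReal (C ^ 2 * 3) * ∫⁻ t in Ioc ε (1 / 2),
        ENNReal.ofReal (symbolWeight t ‖ξ‖ * G ((1 - t) • ξ)) := by
        refine lintegral_mono fun ξ => ?_
        have hi : Integrable (fun t => symbolWeight t ‖ξ‖ * G ((1 - t) • ξ))
            (volume.restrict (Ioc ε (1 / 2))) :=
          hIoc ((hWc ξ).mul (hGc.comp (by fun_prop : Continuous fun t : ℝ => (1 - t) • ξ)))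
        rw [← ofReal_integral_eq_lintegral_ofReal hi
          (Eventually.of_forall fun t => mul_nonneg (symbolWeight_nonneg t (norm_nonneg ξ))
            (by positivity)), ← ENNReal.ofReal_mul (by positivity)]
        exact ENNReal.ofReal_le_ofReal (hpt ξ)
    _ ≤ ENNReal.ofReal (C ^ 2 * 3) * (ENNReal.ofReal (2 ^ n * 6) *
        ∫⁻ ξ, ENNReal.ofReal (G ξ)) := by
        rw [lintegral_const_mul' _ _ ENNReal.ofReal_ne_top]
        gcongr
        exact lintegral_symbolWeight_mul_le hGc (fun ξ => by positivity) hε hε'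
    _ = _ := by
        rw [← mul_assoc, ← ENNReal.ofReal_mul (by positivity)]

theorem _root_.HasCompactSupport.integrable_sq {g : E → ℝ} (hgs : HasCompactSupport g)
    (hg : Continuous g) : Integrable fun x => g x ^ 2 := by
  have h : HasCompactSupport fun x => g x ^ 2 :=
    hgs.mono fun x hx h0 => hx (by simp only [h0, zero_pow two_ne_zero])
  exact (hg.pow 2).integrable_of_hasCompactSupport h

theorem sq_integral_abs_le {g : E → ℝ} (hg : Continuous g) (hgs : HasCompactSupport g) {R : ℝ}
    (hR : tsupport g ⊆ Metric.closedBall 0 R) :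
    (∫ x, |g x|) ^ 2 ≤ (volume.real (Metric.closedBall (0 : E) R) + 1) * ∫ x, g x ^ 2 := by
  set B := Metric.closedBall (0 : E) R
  have hB : MeasurableSet B := Metric.isClosed_closedBall.measurableSet
  have hBf : volume B ≠ ⊤ := (isCompact_closedBall (0 : E) R).measure_lt_top.ne
  have hind : ∀ x, x ∉ B → g x = 0 := fun x hx => image_eq_zero_of_notMem_tsupport fun h => hx (hR h)
  have hWG : ∀ φ : ℝ → ℝ, φ 0 = 0 → (fun x => B.indicator (1 : E → ℝ) x * φ (g x)) =
      fun x => φ (g x) := by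
    intro φ hφ
    funext x
    by_cases hx : x ∈ B
    · simp [hx]
    · simp [hx, hind x hx, hφ]
  have h1 := hWG (fun r => |r|) abs_zero
  have h2 : (fun x => B.indicator (1 : E → ℝ) x * |g x| ^ 2) = fun x => g x ^ 2 := by
    simpa [sq_abs] using hWG (fun r => r ^ 2) (by simp)
  have hi2 : Integrable fun x => g x ^ 2 := hgs.integrable_sq hg
  -- Cauchy–Schwarz with the indicator of the ball as weight; the summand `1` makes the constant
  -- positive even when the ball has measure zero.
  have key := sq_integral_mul_le (μ := volume) (W := B.indicator (1 : E → ℝ))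
    (G := fun x => |g x|) (S := volume.real B + 1) (by positivity)
    ((integrable_indicator_iff hB).2 (integrableOn_const hBf))
    (by rw [h2]; exact hi2) (fun x => indicator_nonneg (fun _ _ => zero_le_one) x)
    (by rw [integral_indicator_one hB]; linarith)
  rwa [h2, h1] at key

/-- Away from `t = 0` the kernel is bounded: the average is at most a multiple of `∫ |g|` pointwise
and lives in the ball. The Fourier argument is reserved for `t ≤ 1/2`, where `(1 - t)ξ` is
comparable to `ξ`. -/
theorem exists_integral_sq_coneAverage_half_one_le (k : ℕ) {h : E → ℝ} (hh : Continuous h)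
    (hs : HasCompactSupport h) {R : ℝ} (hR : tsupport h ⊆ Metric.closedBall 0 R) :
    ∃ C, 0 ≤ C ∧ ∀ g : E → ℝ, Continuous g → HasCompactSupport g →
      tsupport g ⊆ Metric.closedBall 0 R →
      ∫ x, coneAverage k (1 / 2) 1 h g x ^ 2 ≤ C * ∫ x, g x ^ 2 := by
  obtain ⟨M, hM⟩ := hh.bounded_above_of_compact_support hs
  have hM0 : 0 ≤ M := (norm_nonneg _).trans (hM 0)
  set B := Metric.closedBall (0 : E) R
  have hB : MeasurableSet B := Metric.isClosed_closedBall.measurableSet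
  have hBf : volume B ≠ ⊤ := (isCompact_closedBall (0 : E) R).measure_lt_top.ne
  set D := ∫ t in Ioc (1 / 2 : ℝ) 1, |(t ^ k)⁻¹| with hD
  refine ⟨volume.real B * ((M * D) ^ 2 * (volume.real B + 1)), by positivity,
    fun g hg hgs hgR => ?_⟩
  have hgi : Integrable g := hg.integrable_of_hasCompactSupport hgs
  have hpt : ∀ x, ‖coneAverage k (1 / 2) 1 h g x‖ ≤ M * D * ∫ x, |g x| := by
    intro x
    have h1 : ∫ p, |(p.1 ^ k)⁻¹| * |g p.2| ∂slabMeasure E (1 / 2) 1 = D * ∫ x, |g x| :=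
      integral_prod_mul (fun t : ℝ => |(t ^ k)⁻¹|) (fun x => |g x|)
    have h2 : Integrable (fun p : ℝ × E => |(p.1 ^ k)⁻¹| * |g p.2|) (slabMeasure E (1 / 2) 1) :=
      (integrable_inv_pow_Ioc k one_half_pos 1).abs.mul_prod hgi.abs
    rw [mul_assoc, ← h1, ← integral_const_mul]
    refine norm_integral_le_of_norm_le (h2.const_mul M) (Eventually.of_forall fun p => ?_)
    rw [smul_eq_mul, norm_mul, norm_mul, Real.norm_eq_abs, Real.norm_eq_abs, mul_comm]
    exact mul_le_mul_of_nonneg_right (hM _) (by positivity)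
  have hsupp : ∀ x, x ∉ B → coneAverage k (1 / 2) 1 h g x = 0 := by
    intro x hx
    by_contra hne
    exact hx (join_subset_closedBall one_half_pos.le le_rfl hR hgR
      (support_coneAverage_subset k one_half_pos 1 h g hne))
  have hle : ∀ x, coneAverage k (1 / 2) 1 h g x ^ 2 ≤
      B.indicator (fun _ => (M * D * ∫ x, |g x|) ^ 2) x := by
    intro x
    by_cases hx : x ∈ B
    · rw [indicator_of_mem hx, ← sq_abs, ← Real.norm_eq_abs]
      gcongr
      exact hpt x
    · rw [indicator_of_notMem hx, hsupp x hx]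
      simp
  calc ∫ x, coneAverage k (1 / 2) 1 h g x ^ 2
      ≤ ∫ x, B.indicator (fun _ => (M * D * ∫ x, |g x|) ^ 2) x :=
        integral_mono_of_nonneg (Eventually.of_forall fun x => sq_nonneg _)
          ((integrable_indicator_iff hB).2 (integrableOn_const hBf)) (Eventually.of_forall hle)
    _ = volume.real B * ((M * D) ^ 2 * (∫ x, |g x|) ^ 2) := by
        rw [integral_indicator hB, setIntegral_const, smul_eq_mul, mul_pow]
    _ ≤ volume.real B * ((M * D) ^ 2 * ((volume.real B + 1) * ∫ x, g x ^ 2)) := by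
        gcongr
        exact sq_integral_abs_le hg hgs hgR
    _ = _ := by ring

/-- The cone averages over `(ε, 1]` and their derivatives are bounded in `L²`, uniformly
in `ε`. -/
theorem exists_integral_sq_coneAverage_le {h : E → ℝ} (hh : ContDiff ℝ ∞ h)
    (hs : HasCompactSupport h) {R : ℝ} (hR : tsupport h ⊆ Metric.closedBall 0 R) (v : E) :
    ∃ C, 0 ≤ C ∧ ∀ ε ∈ Ioc (0 : ℝ) (1 / 2), ∀ g : E → ℝ, ContDiff ℝ ∞ g → HasCompactSupport g →
      tsupport g ⊆ Metric.closedBall 0 R →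
      ∫ x, coneAverage (Module.finrank ℝ E) ε 1 h g x ^ 2 ≤ C * ∫ x, g x ^ 2 ∧
      ∫ x, fderiv ℝ (coneAverage (Module.finrank ℝ E) ε 1 h g) x v ^ 2 ≤ C * ∫ x, g x ^ 2 := by
  set n := Module.finrank ℝ E
  set h' : E → ℝ := fun w => fderiv ℝ h w v with hh'
  have hd' : ContDiff ℝ ∞ h' := (hh.fderiv_right (by simp)).clm_apply contDiff_const
  have hs' : HasCompactSupport h' := hs.fderiv_apply (𝕜 := ℝ) v
  have hR' : tsupport h' ⊆ Metric.closedBall 0 R := (tsupport_fderiv_apply_subset ℝ v).trans hR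
  obtain ⟨C0, hC0, h0⟩ := exists_norm_realFourier_le hh hs
  obtain ⟨C1, hC1, h1⟩ := exists_norm_realFourier_fderiv_le hh hs v
  obtain ⟨D0, hD0, hi0⟩ := exists_integral_sq_coneAverage_half_one_le n hh.continuous hs hR
  obtain ⟨D1, hD1, hi1⟩ := exists_integral_sq_coneAverage_half_one_le (n + 1) hd'.continuous hs' hR'
  have hsym0 : ∀ t ∈ Ioc (0 : ℝ) (1 / 2), ∀ ξ : E,
      (t ^ 0)⁻¹ * ‖realFourier h (t • ξ)‖ ≤ C0 * symbolWeight t ‖ξ‖ := by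
    intro t ht ξ
    rw [pow_zero, inv_one, one_mul]
    have hW : 1 ≤ symbolWeight t ‖ξ‖ := le_add_of_nonneg_right (by positivity)
    have h2 : ‖realFourier h (t • ξ)‖ ≤ C0 :=
      (le_mul_of_one_le_right (norm_nonneg _) (by nlinarith [sq_nonneg ‖t • ξ‖])).trans (h0 (t • ξ))
    nlinarith
  -- The factor `t` in the bound `C₁ t|ξ| / (1 + (t|ξ|)²)` for the transform at `tξ` cancels `t⁻¹`,
  -- leaving the second summand of the weight.
  have hsym1 : ∀ t ∈ Ioc (0 : ℝ) (1 / 2), ∀ ξ : E,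
      (t ^ 1)⁻¹ * ‖realFourier h' (t • ξ)‖ ≤ C1 * symbolWeight t ‖ξ‖ := by
    intro t ht ξ
    have h2 := h1 (t • ξ)
    rw [norm_smul, Real.norm_of_nonneg ht.1.le] at h2
    have h3 : (0 : ℝ) < 1 + (t * ‖ξ‖) ^ 2 := by positivity
    have ht0 := ht.1
    rw [← le_div_iff₀ h3] at h2
    calc (t ^ 1)⁻¹ * ‖realFourier h' (t • ξ)‖
        ≤ (t ^ 1)⁻¹ * (C1 * (t * ‖ξ‖) / (1 + (t * ‖ξ‖) ^ 2)) := by gcongr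
      _ = C1 * (‖ξ‖ / (1 + (t * ‖ξ‖) ^ 2)) := by field_simp
      _ ≤ _ := by
        unfold symbolWeight
        gcongr
        linarith
  have hcomb : ∀ {φ ψ χ : E → ℝ} {a b I : ℝ}, (∀ x, φ x = ψ x + χ x) →
      Integrable (fun x => ψ x ^ 2) → Integrable (fun x => χ x ^ 2) → ∫ x, ψ x ^ 2 ≤ a * I →
      ∫ x, χ x ^ 2 ≤ b * I → ∫ x, φ x ^ 2 ≤ (2 * a + 2 * b) * I := by
    intro φ ψ χ a b I hφ hψ hχ ha hb
    calc ∫ x, φ x ^ 2 ≤ ∫ x, (2 * ψ x ^ 2 + 2 * χ x ^ 2) := by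
          refine integral_mono_of_nonneg (Eventually.of_forall fun x => sq_nonneg _)
            ((hψ.const_mul 2).add (hχ.const_mul 2)) (Eventually.of_forall fun x => ?_)
          simp only [hφ]
          nlinarith [sq_nonneg (ψ x - χ x)]
      _ = 2 * (∫ x, ψ x ^ 2) + 2 * ∫ x, χ x ^ 2 := by
          rw [integral_add (hψ.const_mul 2) (hχ.const_mul 2), integral_const_mul,
            integral_const_mul]
      _ ≤ _ := by linarith
  have hsq : ∀ (k : ℕ) {a : ℝ} (b : ℝ) {q g : E → ℝ}, 0 < a → ContDiff ℝ ∞ q →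
      HasCompactSupport q → Continuous g → HasCompactSupport g →
      Integrable (fun x => coneAverage k a b q g x ^ 2) := by
    intro k a b q g ha hq hqs hg hgs
    exact (hasCompactSupport_coneAverage k ha b hqs hgs).integrable_sq
      (contDiff_coneAverage k ha b hq hqs (hg.integrable_of_hasCompactSupport hgs)).continuous
  set A0 := C0 ^ 2 * 3 * (2 ^ n * 6)
  set A1 := C1 ^ 2 * 3 * (2 ^ n * 6)
  refine ⟨(2 * A0 + 2 * D0) + (2 * A1 + 2 * D1), by positivity, fun ε hε g hg hgs hgR => ?_⟩
  have hgi : Integrable g := hg.continuous.integrable_of_hasCompactSupport hgs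
  have hI : 0 ≤ ∫ x, g x ^ 2 := integral_nonneg fun x => sq_nonneg _
  constructor
  · refine (hcomb (fun x => coneAverage_add_adjacent n hε.1 hε.2 (by norm_num) hh.continuous hs
      hgi x) (hsq _ _ hε.1 hh hs hg.continuous hgs)
      (hsq _ _ one_half_pos hh hs hg.continuous hgs)
      (integral_sq_coneAverage_le_of_symbol 0 hh hs hsym0 hε.1 hε.2 hg hgs)
      (hi0 g hg.continuous hgs hgR)).trans ?_
    exact mul_le_mul_of_nonneg_right (le_add_of_nonneg_right (by positivity)) hI
  · simp only [fderiv_coneAverage_apply n hε.1 1 hh hs hgi]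
    refine (hcomb (fun x => coneAverage_add_adjacent (n + 1) hε.1 hε.2 (by norm_num)
      hd'.continuous hs' hgi x) (hsq _ _ hε.1 hd' hs' hg.continuous hgs)
      (hsq _ _ one_half_pos hd' hs' hg.continuous hgs)
      (integral_sq_coneAverage_le_of_symbol 1 hd' hs' hsym1 hε.1 hε.2 hg hgs)
      (hi1 g hg.continuous hgs hgR)).trans ?_
    exact mul_le_mul_of_nonneg_right (le_add_of_nonneg_left (by positivity)) hI

end Bounds

/-! ### Convergence of the approximation of `f` as the truncation is removed -/

section DilateAverage

variable {E : Type} [NormedAddCommGroup E] [InnerProductSpace ℝ E] [FiniteDimensional ℝ E]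
  [MeasurableSpace E] [BorelSpace E]

/-- `∫ ε⁻ⁿ θ((x - (1 - ε) y) / ε) f(y) dy`. -/
noncomputable def dilateAverage (ε : ℝ) (θ f : E → ℝ) (x : E) : ℝ :=
  ∫ y, (ε ^ Module.finrank ℝ E)⁻¹ * θ (ε⁻¹ • x + (1 - ε⁻¹) • y) * f y

/-- Taking `z = ε⁻¹ x + (1 - ε⁻¹) y` as variable moves `ε` from the concentrating kernel into the
argument of `f`, which tends to `x` as `ε → 0`. -/
theorem dilateAverage_eq {ε : ℝ} (hε : 0 < ε) (hε' : ε < 1) (θ f : E → ℝ) (x : E) :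
    dilateAverage ε θ f x =
      ((1 - ε) ^ Module.finrank ℝ E)⁻¹ * ∫ z, θ z * f ((1 - ε)⁻¹ • (x - ε • z)) := by
  have h1 : 0 < 1 - ε := by linarith
  have hr : 1 - ε⁻¹ = -((1 - ε) / ε) := by
    field_simp
    ring
  have hsub : ∀ y, (ε ^ Module.finrank ℝ E)⁻¹ * θ (ε⁻¹ • x + (1 - ε⁻¹) • y) * f y =
      (ε ^ Module.finrank ℝ E)⁻¹ *
        (fun z => θ z * f ((1 - ε)⁻¹ • (x - ε • z))) ((1 - ε⁻¹) • y + ε⁻¹ • x) := by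
    intro y
    have : (1 - ε)⁻¹ • (x - ε • ((1 - ε⁻¹) • y + ε⁻¹ • x)) = y := by
      rw [smul_add, smul_smul, smul_smul, mul_inv_cancel₀ hε.ne', one_smul, sub_add_cancel_right,
        smul_neg, smul_smul, ← neg_smul]
      have : -((1 - ε)⁻¹ * (ε * (1 - ε⁻¹))) = 1 := by
        rw [hr]
        field_simp
      rw [this, one_smul]
    simp only [this]
    rw [add_comm ((1 - ε⁻¹) • y), mul_assoc]
  unfold dilateAverage
  rw [integral_congr_ae (Eventually.of_forall hsub), integral_const_mul,
    integral_comp_smul_add (fun z => θ z * f ((1 - ε)⁻¹ • (x - ε • z))), smul_eq_mul, ← mul_assoc]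
  congr 1
  rw [hr, abs_inv, abs_pow, abs_neg, abs_of_pos (div_pos h1 hε), ← mul_inv, ← mul_pow]
  congr 2
  field_simp

theorem support_dilateAverage_subset {ε : ℝ} (hε : 0 < ε) (hε' : ε ≤ 1) (θ f : E → ℝ) :
    Function.support (dilateAverage ε θ f) ⊆ join ε 1 (tsupport θ) (tsupport f) := by
  intro x hx
  by_contra hcon
  refine hx ?_
  unfold dilateAverage
  rw [integral_eq_zero_of_ae (Eventually.of_forall fun y => ?_)]
  by_contra hne
  refine hcon ⟨(ε, ε⁻¹ • x + (1 - ε⁻¹) • y, y), ⟨⟨le_rfl, hε'⟩, ?_, ?_⟩, ?_⟩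
  · refine subset_tsupport _ fun h0 => hne ?_
    simp [h0]
  · refine subset_tsupport _ fun h0 => hne ?_
    simp [h0]
  · simp only [smul_add, smul_smul, mul_sub, mul_inv_cancel₀ hε.ne', one_smul, mul_one]
    rw [add_assoc, ← add_smul]
    simp

/-- Dominated convergence twice: in `z` for the pointwise limit, using `∫ θ = 1`, and in `x`, where
for `ε ≤ 1/2` the averages are uniformly bounded and supported in one ball. -/
theorem tendsto_integral_sq_dilateAverage_sub {θ f : E → ℝ} (hθ : Continuous θ)
    (hθs : HasCompactSupport θ) (hθ1 : ∫ x, θ x = 1) (hf : Continuous f)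
    (hfs : HasCompactSupport f) {R : ℝ} (hθR : tsupport θ ⊆ Metric.closedBall 0 R)
    (hfR : tsupport f ⊆ Metric.closedBall 0 R) :
    Tendsto (fun ε => ∫ x, (dilateAverage ε θ f x - f x) ^ 2) (𝓝[>] 0) (𝓝 0) := by
  set n := Module.finrank ℝ E with hn
  obtain ⟨M, hM⟩ := hf.bounded_above_of_compact_support hfs
  have hM0 : 0 ≤ M := (norm_nonneg _).trans (hM 0)
  have hθi : Integrable θ := hθ.integrable_of_hasCompactSupport hθs
  set B := Metric.closedBall (0 : E) R
  have hB : MeasurableSet B := Metric.isClosed_closedBall.measurableSet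
  have hBf : volume B ≠ ⊤ := (isCompact_closedBall (0 : E) R).measure_lt_top.ne
  have hev : ∀ᶠ ε in 𝓝[>] (0 : ℝ), ε ∈ Ioc (0 : ℝ) (1 / 2) := Ioc_mem_nhdsGT (by norm_num)
  set D := 2 ^ n * (M * ∫ z, |θ z|) with hD
  have hbound : ∀ ε ∈ Ioc (0 : ℝ) (1 / 2), ∀ x, |dilateAverage ε θ f x| ≤ D := by
    intro ε hε x
    have h1 : (1 : ℝ) / 2 ≤ 1 - ε := by linarith [hε.2]
    have h0 : 0 < 1 - ε := by linarith
    rw [dilateAverage_eq hε.1 (by linarith [hε.2]), abs_mul, hD]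
    have h2 : |∫ z, θ z * f ((1 - ε)⁻¹ • (x - ε • z))| ≤ M * ∫ z, |θ z| := by
      rw [← integral_const_mul, ← Real.norm_eq_abs]
      refine norm_integral_le_of_norm_le (hθi.abs.const_mul M) (Eventually.of_forall fun z => ?_)
      rw [norm_mul, mul_comm, Real.norm_eq_abs (θ z)]
      exact mul_le_mul_of_nonneg_right (hM _) (abs_nonneg _)
    have h3 : |((1 - ε) ^ n)⁻¹| ≤ 2 ^ n := by
      rw [abs_of_pos (by positivity), ← inv_pow]
      gcongr
      rw [inv_le_comm₀ h0 two_pos]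
      linarith
    gcongr
  have hlim : ∀ x, Tendsto (fun ε => dilateAverage ε θ f x) (𝓝[>] 0) (𝓝 (f x)) := by
    intro x
    have h1 : Tendsto (fun ε : ℝ => ((1 - ε) ^ n)⁻¹) (𝓝[>] 0) (𝓝 1) := by
      have : ContinuousAt (fun ε : ℝ => ((1 - ε) ^ n)⁻¹) 0 :=
        ContinuousAt.inv₀ (by fun_prop) (by simp)
      have h := this.tendsto
      simp only [sub_zero, one_pow, inv_one] at h
      exact h.mono_left nhdsWithin_le_nhds
    have h2 : Tendsto (fun ε : ℝ => ∫ z, θ z * f ((1 - ε)⁻¹ • (x - ε • z))) (𝓝[>] 0)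
        (𝓝 (∫ z, θ z * f x)) := by
      refine tendsto_integral_filter_of_dominated_convergence (fun z => |θ z| * M) ?_ ?_
        (hθi.abs.mul_const M) ?_
      · exact Eventually.of_forall fun ε => (hθ.mul (hf.comp (by fun_prop))).aestronglyMeasurable
      · refine Eventually.of_forall fun ε => Eventually.of_forall fun z => ?_
        rw [norm_mul, Real.norm_eq_abs (θ z)]
        exact mul_le_mul_of_nonneg_left (hM _) (abs_nonneg _)
      · refine Eventually.of_forall fun z => Tendsto.const_mul _ ?_
        have hc : ContinuousAt (fun ε : ℝ => (1 - ε)⁻¹ • (x - ε • z)) 0 :=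
          ContinuousAt.smul (ContinuousAt.inv₀ (by fun_prop) (by simp)) (by fun_prop)
        have h := (hf.continuousAt.comp hc).tendsto
        simp only [Function.comp_def, sub_zero, inv_one, zero_smul, one_smul] at h
        exact h.mono_left nhdsWithin_le_nhds
    rw [integral_mul_const, hθ1, one_mul] at h2
    have h3 := h1.mul h2
    rw [one_mul] at h3
    refine h3.congr' ?_
    filter_upwards [hev] with ε hε
    exact (dilateAverage_eq hε.1 (by linarith [hε.2]) θ f x).symm
  have hmeas : ∀ ε, StronglyMeasurable (dilateAverage ε θ f) := by
    intro ε
    have hc : Continuous (Function.uncurry fun x y : E =>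
        (ε ^ n)⁻¹ * θ (ε⁻¹ • x + (1 - ε⁻¹) • y) * f y) := by
      simp only [Function.uncurry_def]
      fun_prop
    exact hc.stronglyMeasurable.integral_prod_right
  suffices h : Tendsto (fun ε => ∫ x, (dilateAverage ε θ f x - f x) ^ 2) (𝓝[>] 0)
      (𝓝 (∫ _ : E, (0 : ℝ))) by simpa using h
  refine tendsto_integral_filter_of_dominated_convergence
    (B.indicator fun _ => (D + M) ^ 2) ?_ ?_ ((integrable_indicator_iff hB).2
      (integrableOn_const hBf)) ?_
  · exact Eventually.of_forall fun ε =>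
      (((hmeas ε).sub hf.stronglyMeasurable).pow 2).aestronglyMeasurable
  · filter_upwards [hev] with ε hε
    refine Eventually.of_forall fun x => ?_
    by_cases hx : x ∈ B
    · rw [indicator_of_mem hx, norm_pow, Real.norm_eq_abs]
      have h1 := hbound ε hε x
      have h2 := hM x
      rw [Real.norm_eq_abs] at h2
      have h3 := abs_sub (dilateAverage ε θ f x) (f x)
      gcongr
      linarith
    · have h1 : f x = 0 := image_eq_zero_of_notMem_tsupport fun h => hx (hfR h)
      have h2 : dilateAverage ε θ f x = 0 := by
        by_contra hne
        exact hx (join_subset_closedBall hε.1.le le_rfl hθR hfR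
          (support_dilateAverage_subset hε.1 (by linarith [hε.2]) θ f hne))
      rw [indicator_of_notMem hx, h1, h2]
      simp
  · refine Eventually.of_forall fun x => ?_
    have h := ((hlim x).sub_const (f x)).pow 2
    rwa [sub_self, zero_pow two_ne_zero] at h

end DilateAverage

/-! ### The truncated Bogovskii operator: divergence and bounds -/

section Bogovskii

variable {d : ℕ}

/-- The components of the truncated Bogovskii operator. -/
noncomputable def bogovskii (ε : ℝ) (θ f : Vec d → ℝ) (i : Fin d) (x : Vec d) : ℝ :=
  coneAverage d ε 1 (fun w => w i * θ w) f x - coneAverage d ε 1 θ (fun y => y i * f y) x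

theorem contDiff_coord_mul {θ : Vec d → ℝ} (hθ : ContDiff ℝ ∞ θ) (i : Fin d) :
    ContDiff ℝ ∞ fun w : Vec d => w i * θ w :=
  (EuclideanSpace.proj (𝕜 := ℝ) i).contDiff.mul hθ

theorem support_coord_mul_subset (θ : Vec d → ℝ) (i : Fin d) :
    Function.support (fun w : Vec d => w i * θ w) ⊆ Function.support θ :=
  fun x hx h0 => hx (by simp [h0])

theorem hasCompactSupport_coord_mul {θ : Vec d → ℝ} (hθ : HasCompactSupport θ) (i : Fin d) :
    HasCompactSupport fun w : Vec d => w i * θ w :=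
  hθ.mono (support_coord_mul_subset θ i)

theorem tsupport_coord_mul_subset (θ : Vec d → ℝ) (i : Fin d) :
    tsupport (fun w : Vec d => w i * θ w) ⊆ tsupport θ :=
  closure_mono (support_coord_mul_subset θ i)

theorem contDiff_bogovskii {ε : ℝ} (hε : 0 < ε) {θ f : Vec d → ℝ} (hθ : ContDiff ℝ ∞ θ)
    (hθs : HasCompactSupport θ) (hf : ContDiff ℝ ∞ f) (hfs : HasCompactSupport f) (i : Fin d) :
    ContDiff ℝ ∞ (bogovskii ε θ f i) :=
  (contDiff_coneAverage d hε 1 (contDiff_coord_mul hθ i) (hasCompactSupport_coord_mul hθs i)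
    (hf.continuous.integrable_of_hasCompactSupport hfs)).sub
  (contDiff_coneAverage d hε 1 hθ hθs ((contDiff_coord_mul hf
    i).continuous.integrable_of_hasCompactSupport (hasCompactSupport_coord_mul hfs i)))

theorem join_mono (a b : ℝ) {A A' B B' : Set (Vec d)} (hA : A ⊆ A') (hB : B ⊆ B') :
    join a b A B ⊆ join a b A' B' :=
  image_mono (prod_mono_right (prod_mono hA hB))

theorem support_bogovskii_subset {ε : ℝ} (hε : 0 < ε) (θ f : Vec d → ℝ) (i : Fin d) :
    Function.support (bogovskii ε θ f i) ⊆ join ε 1 (tsupport θ) (tsupport f) := by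
  intro x hx
  by_contra hcon
  have h1 : coneAverage d ε 1 (fun w => w i * θ w) f x = 0 := by
    by_contra hne
    exact hcon (join_mono _ _ (tsupport_coord_mul_subset θ i) subset_rfl
      (support_coneAverage_subset d hε 1 _ _ hne))
  have h2 : coneAverage d ε 1 θ (fun y => y i * f y) x = 0 := by
    by_contra hne
    exact hcon (join_mono _ _ subset_rfl (tsupport_coord_mul_subset f i)
      (support_coneAverage_subset d hε 1 _ _ hne))
  exact hx (by simp [bogovskii, h1, h2])

theorem fderiv_bogovskii_apply {ε : ℝ} (hε : 0 < ε) {θ f : Vec d → ℝ} (hθ : ContDiff ℝ ∞ θ)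
    (hθs : HasCompactSupport θ) (hf : ContDiff ℝ ∞ f) (hfs : HasCompactSupport f) (i : Fin d)
    (x v : Vec d) :
    fderiv ℝ (bogovskii ε θ f i) x v =
      fderiv ℝ (coneAverage d ε 1 (fun w => w i * θ w) f) x v -
        fderiv ℝ (coneAverage d ε 1 θ (fun y => y i * f y)) x v := by
  have h1 := hasFDerivAt_coneAverage d hε 1 (contDiff_coord_mul hθ i)
    (hasCompactSupport_coord_mul hθs i) (hf.continuous.integrable_of_hasCompactSupport hfs) x
  have h2 := hasFDerivAt_coneAverage d hε 1 hθ hθs ((contDiff_coord_mul hf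
    i).continuous.integrable_of_hasCompactSupport (hasCompactSupport_coord_mul hfs i)) x
  have h3 : HasFDerivAt (bogovskii ε θ f i) (_ - _) x := h1.sub h2
  rw [h1.fderiv, h2.fderiv, h3.fderiv]
  rfl

theorem sum_coord_mul_fderiv (θ : Vec d → ℝ) (w v : Vec d) :
    ∑ j, v j * fderiv ℝ θ w (EuclideanSpace.single j 1) = fderiv ℝ θ w v := by
  conv_rhs => rw [← (EuclideanSpace.basisFun (Fin d) ℝ).sum_repr v]
  simp

/-- Since `dw/dt = -(w - y)/t`, the divergence of the integrand `t⁻ᵈ f(y) (w - y) θ(w)` is the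
`t`-derivative of `-t⁻ᵈ θ(w) f(y)`. The endpoint `t = ε` yields the approximation of `f`, and `t =
1`, where `w = x`, yields `-θ(x) ∫ f`. -/
theorem sum_fderiv_bogovskii {ε : ℝ} (hε : 0 < ε) (hε' : ε ≤ 1) {θ f : Vec d → ℝ}
    (hθ : ContDiff ℝ ∞ θ) (hθs : HasCompactSupport θ) (hf : ContDiff ℝ ∞ f)
    (hfs : HasCompactSupport f) (x : Vec d) :
    ∑ j, fderiv ℝ (bogovskii ε θ f j) x (EuclideanSpace.single j 1) =
      dilateAverage ε θ f x - θ x * ∫ y, f y := by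
  have hfi : Integrable f := hf.continuous.integrable_of_hasCompactSupport hfs
  have hfji : ∀ j, Integrable fun y : Vec d => y j * f y := fun j =>
    (contDiff_coord_mul hf j).continuous.integrable_of_hasCompactSupport
      (hasCompactSupport_coord_mul hfs j)
  let e : Fin d → Vec d := fun j => EuclideanSpace.single j 1
  let W : ℝ × Vec d → Vec d := fun p => p.1⁻¹ • x + (1 - p.1⁻¹) • p.2
  let q : ℝ × Vec d → ℝ := fun p =>
    ((p.1 ^ (d + 1))⁻¹ * f p.2) * (d * θ (W p) + fderiv ℝ θ (W p) (W p - p.2))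
  have hI1 : ∀ j, Integrable (fun p : ℝ × Vec d => ((p.1 ^ (d + 1))⁻¹ * f p.2) •
      fderiv ℝ (fun w : Vec d => w j * θ w) (W p) (e j)) (slabMeasure (Vec d) ε 1) := fun j =>
    integrable_coneAverage (d + 1) hε 1 (h := fun w => fderiv ℝ (fun w : Vec d => w j * θ w) w (e j))
      (((contDiff_coord_mul hθ j).continuous_fderiv (by simp)).clm_apply continuous_const)
      ((hasCompactSupport_coord_mul hθs j).fderiv_apply (𝕜 := ℝ) (e j)) hfi x
  have hI2 : ∀ j, Integrable (fun p : ℝ × Vec d => ((p.1 ^ (d + 1))⁻¹ * (p.2 j * f p.2)) •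
      fderiv ℝ θ (W p) (e j)) (slabMeasure (Vec d) ε 1) := fun j =>
    integrable_coneAverage (d + 1) hε 1 (h := fun w => fderiv ℝ θ w (e j))
      ((hθ.continuous_fderiv (by simp)).clm_apply continuous_const)
      (hθs.fderiv_apply (𝕜 := ℝ) (e j)) (hfji j) x
  have hI12 : ∀ j, Integrable (fun p : ℝ × Vec d => ((p.1 ^ (d + 1))⁻¹ * f p.2) •
      fderiv ℝ (fun w : Vec d => w j * θ w) (W p) (e j) -
      ((p.1 ^ (d + 1))⁻¹ * (p.2 j * f p.2)) • fderiv ℝ θ (W p) (e j)) (slabMeasure (Vec d) ε 1) :=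
    fun j => (hI1 j).sub (hI2 j)
  have hq : ∀ p, ∑ j, (((p.1 ^ (d + 1))⁻¹ * f p.2) •
      fderiv ℝ (fun w : Vec d => w j * θ w) (W p) (e j) -
      ((p.1 ^ (d + 1))⁻¹ * (p.2 j * f p.2)) • fderiv ℝ θ (W p) (e j)) = q p := by
    intro p
    have hprod : ∀ j, fderiv ℝ (fun w : Vec d => w j * θ w) (W p) (e j) =
        W p j * fderiv ℝ θ (W p) (e j) + θ (W p) := by
      intro j
      have h := ((EuclideanSpace.proj (𝕜 := ℝ) j).hasFDerivAt (x := W p)).mul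
        (hθ.differentiable (by simp) (W p)).hasFDerivAt
      have h' : fderiv ℝ (fun w : Vec d => w j * θ w) (W p) = _ := h.fderiv
      rw [h']
      simp [e]
    have hsum := sum_coord_mul_fderiv θ (W p) (W p - p.2)
    simp only [q, ← hsum, hprod, smul_eq_mul, mul_add, Finset.mul_sum, Finset.sum_sub_distrib,
      Finset.sum_add_distrib, Finset.sum_const, Finset.card_univ, Fintype.card_fin, nsmul_eq_mul]
    rw [add_sub_right_comm, ← Finset.sum_sub_distrib, add_comm]
    congr 1
    · ring
    · refine Finset.sum_congr rfl fun j _ => ?_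
      simp only [PiLp.sub_apply, e]
      ring
  have hqi : Integrable q (slabMeasure (Vec d) ε 1) := by
    rw [← funext hq]
    exact integrable_finsetSum _ fun j _ => hI12 j
  have hlhs : ∑ j, fderiv ℝ (bogovskii ε θ f j) x (e j) = ∫ p, q p ∂slabMeasure (Vec d) ε 1 := by
    rw [← funext hq, integral_finsetSum _ fun j _ => hI12 j]
    refine Finset.sum_congr rfl fun j _ => ?_
    rw [fderiv_bogovskii_apply hε hθ hθs hf hfs, fderiv_coneAverage_apply d hε 1
      (contDiff_coord_mul hθ j) (hasCompactSupport_coord_mul hθs j) hfi,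
      fderiv_coneAverage_apply d hε 1 hθ hθs (hfji j), integral_sub (hI1 j) (hI2 j)]
    rfl
  have hinner : ∀ y, ∫ t in Ioc ε 1, q (t, y) =
      (ε ^ d)⁻¹ * θ (ε⁻¹ • x + (1 - ε⁻¹) • y) * f y - θ x * f y := by
    intro y
    let Φ : ℝ → ℝ := fun t => -((t ^ d)⁻¹ * θ (t⁻¹ • x + (1 - t⁻¹) • y) * f y)
    have hder : ∀ t ∈ uIcc ε 1, HasDerivAt Φ (q (t, y)) t := by
      intro t ht
      rw [uIcc_of_le hε'] at ht
      have ht0 : t ≠ 0 := (hε.trans_le ht.1).ne'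
      have h1 : HasDerivAt (fun t : ℝ => t⁻¹) (-(t ^ 2)⁻¹) t := hasDerivAt_inv ht0
      have h2 : HasDerivAt (fun t : ℝ => t⁻¹ • x + (1 - t⁻¹) • y)
          ((-(t ^ 2)⁻¹) • x + (-(-(t ^ 2)⁻¹)) • y) t :=
        (h1.smul_const x).add ((h1.const_sub 1).smul_const y)
      have h3 := (hθ.differentiable (by simp)
        (t⁻¹ • x + (1 - t⁻¹) • y)).hasFDerivAt.comp_hasDerivAt t h2
      have h4 : HasDerivAt (fun t : ℝ => (t ^ d)⁻¹) (-((d : ℝ) * (t ^ (d + 1))⁻¹)) t := by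
        have h := (hasDerivAt_pow d t).inv (pow_ne_zero d ht0)
        refine h.congr_deriv ?_
        rcases d with _ | m
        · simp
        · rw [Nat.add_sub_cancel]
          field_simp
          ring
      refine ((h4.mul h3).mul_const (f y)).neg.congr_deriv ?_
      have hv : (-(t ^ 2)⁻¹) • x + (-(-(t ^ 2)⁻¹)) • y =
          (-t⁻¹) • (t⁻¹ • x + (1 - t⁻¹) • y - y) := by
        rw [neg_neg, sub_smul, one_smul, smul_sub, smul_add, smul_sub, smul_smul, smul_smul]
        have : -t⁻¹ * t⁻¹ = -(t ^ 2)⁻¹ := by ring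
        rw [this, neg_smul (t ^ 2)⁻¹ y]
        abel
      simp only [q, W, Function.comp_apply]
      rw [hv, map_smul, smul_eq_mul, pow_succ, mul_inv]
      ring
    have hcont : ContinuousOn (fun t => q (t, y)) (uIcc ε 1) := by
      rw [uIcc_of_le hε']
      have hne : ∀ t ∈ Icc ε 1, t ≠ 0 := fun t ht => (hε.trans_le ht.1).ne'
      have hinv : ContinuousOn (fun t : ℝ => t⁻¹) (Icc ε 1) := continuousOn_inv₀.mono hne
      have hWc : ContinuousOn (fun t : ℝ => W (t, y)) (Icc ε 1) :=
        (hinv.smul continuousOn_const).add ((continuousOn_const.sub hinv).smul continuousOn_const)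
      have hp : ContinuousOn (fun t : ℝ => (t ^ (d + 1))⁻¹) (Icc ε 1) :=
        ContinuousOn.inv₀ (by fun_prop) fun t ht => pow_ne_zero _ (hne t ht)
      have hθW : ContinuousOn (fun t => θ (W (t, y))) (Icc ε 1) :=
        hθ.continuous.comp_continuousOn hWc
      change ContinuousOn (fun t => ((t ^ (d + 1))⁻¹ * f y) *
        (d * θ (W (t, y)) + fderiv ℝ θ (W (t, y)) (W (t, y) - y))) (Icc ε 1)
      exact (hp.mul continuousOn_const).mul ((continuousOn_const.mul hθW).add
        (((hθ.continuous_fderiv (by simp)).comp_continuousOn hWc).clm_apply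
          (hWc.sub continuousOn_const)))
    rw [← intervalIntegral.integral_of_le hε',
      intervalIntegral.integral_eq_sub_of_hasDerivAt hder hcont.intervalIntegrable]
    simp only [Φ, one_pow, inv_one, one_smul, sub_self, zero_smul, add_zero, one_mul]
    ring
  have hi1 : Integrable fun y => (ε ^ d)⁻¹ * θ (ε⁻¹ • x + (1 - ε⁻¹) • y) * f y :=
    Continuous.integrable_of_hasCompactSupport
      ((continuous_const.mul (hθ.continuous.comp (by fun_prop))).mul hf.continuous) hfs.mul_left
  rw [hlhs]
  unfold slabMeasure
  rw [integral_prod_symm _ hqi]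
  rw [integral_congr_ae (Eventually.of_forall hinner), integral_sub hi1 (hfi.const_mul _),
    integral_const_mul]
  simp [dilateAverage]

/-- Each component is a difference of two cone averages. In the second one the density is `y i * f
y`, and `|y i| ≤ R` on the support of `f` accounts for the factor `R ^ 2`. -/
theorem exists_integral_sq_bogovskii_le {θ : Vec d → ℝ} (hθ : ContDiff ℝ ∞ θ)
    (hθs : HasCompactSupport θ) {R : ℝ} (hR : tsupport θ ⊆ Metric.closedBall 0 R) :
    ∃ C, 0 ≤ C ∧ ∀ ε ∈ Ioc (0 : ℝ) (1 / 2), ∀ f : Vec d → ℝ, ContDiff ℝ ∞ f →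
      HasCompactSupport f → tsupport f ⊆ Metric.closedBall 0 R → ∀ i j,
      ∫ x, bogovskii ε θ f i x ^ 2 ≤ C * ∫ x, f x ^ 2 ∧
      ∫ x, fderiv ℝ (bogovskii ε θ f i) x (EuclideanSpace.single j 1) ^ 2 ≤
        C * ∫ x, f x ^ 2 := by
  have hfr : Module.finrank ℝ (Vec d) = d := by simp
  have h1 := fun i j => exists_integral_sq_coneAverage_le (contDiff_coord_mul hθ i)
    (hasCompactSupport_coord_mul hθs i) ((tsupport_coord_mul_subset θ i).trans hR)
    (EuclideanSpace.single j 1)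
  have h2 := fun j => exists_integral_sq_coneAverage_le hθ hθs hR (EuclideanSpace.single j 1)
  rw [hfr] at h1 h2
  choose C1 hC1 h1 using h1
  choose C2 hC2 h2 using h2
  have hsub : ∀ {φ ψ χ : Vec d → ℝ} {a b I : ℝ}, (∀ x, φ x = ψ x - χ x) →
      Integrable (fun x => ψ x ^ 2) → Integrable (fun x => χ x ^ 2) → ∫ x, ψ x ^ 2 ≤ a * I →
      ∫ x, χ x ^ 2 ≤ b * I → ∫ x, φ x ^ 2 ≤ (2 * a + 2 * b) * I := by
    intro φ ψ χ a b I hφ hψ hχ ha hb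
    calc ∫ x, φ x ^ 2 ≤ ∫ x, (2 * ψ x ^ 2 + 2 * χ x ^ 2) := by
          refine integral_mono_of_nonneg (Eventually.of_forall fun x => sq_nonneg _)
            ((hψ.const_mul 2).add (hχ.const_mul 2)) (Eventually.of_forall fun x => ?_)
          simp only [hφ]
          nlinarith [sq_nonneg (ψ x + χ x)]
      _ = 2 * (∫ x, ψ x ^ 2) + 2 * ∫ x, χ x ^ 2 := by
          rw [integral_add (hψ.const_mul 2) (hχ.const_mul 2), integral_const_mul,
            integral_const_mul]
      _ ≤ _ := by linarith
  let c : Fin d → Fin d → ℝ := fun i j => 2 * C1 i j + 2 * (C2 j * R ^ 2)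
  have hc : ∀ i j, 0 ≤ c i j := fun i j => by
    have := hC1 i j
    have := hC2 j
    positivity
  refine ⟨∑ i, ∑ j, c i j, Finset.sum_nonneg fun i _ => Finset.sum_nonneg fun j _ => hc i j,
    fun ε hε f hf hfs hfR i j => ?_⟩
  have hle : c i j ≤ ∑ i, ∑ j, c i j :=
    (Finset.single_le_sum (fun j _ => hc i j) (Finset.mem_univ j)).trans
      (Finset.single_le_sum (f := fun i => ∑ j, c i j)
        (fun i _ => Finset.sum_nonneg fun j _ => hc i j) (Finset.mem_univ i))
  have hI : 0 ≤ ∫ x, f x ^ 2 := integral_nonneg fun x => sq_nonneg _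
  have hfi : Integrable f := hf.continuous.integrable_of_hasCompactSupport hfs
  have hgs := hasCompactSupport_coord_mul hfs i
  have hgd := contDiff_coord_mul hf i
  have hgi : Integrable fun y : Vec d => y i * f y :=
    hgd.continuous.integrable_of_hasCompactSupport hgs
  have hg2 : ∫ y, (y i * f y) ^ 2 ≤ R ^ 2 * ∫ y, f y ^ 2 := by
    rw [← integral_const_mul]
    refine integral_mono_of_nonneg (Eventually.of_forall fun x => sq_nonneg _)
      ((hfs.integrable_sq hf.continuous).const_mul _) (Eventually.of_forall fun y => ?_)
    by_cases hy : y ∈ tsupport f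
    · have h3 : ‖y‖ ≤ R := by simpa using hfR hy
      have h4 : |y i| ≤ R := (PiLp.norm_apply_le y i).trans h3
      simp only [mul_pow]
      refine mul_le_mul_of_nonneg_right ?_ (sq_nonneg _)
      rw [← sq_abs]
      gcongr
    · simp [image_eq_zero_of_notMem_tsupport hy]
  obtain ⟨ha, hb⟩ := h1 i j ε hε f hf hfs hfR
  obtain ⟨ha', hb'⟩ := h2 j ε hε _ hgd hgs ((tsupport_coord_mul_subset f i).trans hfR)
  have hmul : ∀ {X : ℝ}, X ≤ C2 j * ∫ y, (y i * f y) ^ 2 → X ≤ C2 j * R ^ 2 * ∫ y, f y ^ 2 :=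
    fun hX => hX.trans (by
      rw [mul_assoc]
      exact mul_le_mul_of_nonneg_left hg2 (hC2 j))
  have hs1 := hasCompactSupport_coneAverage d hε.1 1 (hasCompactSupport_coord_mul hθs i) hfs
  have hd1 := contDiff_coneAverage d hε.1 1 (contDiff_coord_mul hθ i)
    (hasCompactSupport_coord_mul hθs i) hfi
  have hs2 := hasCompactSupport_coneAverage d hε.1 1 hθs hgs
  have hd2 := contDiff_coneAverage d hε.1 1 hθ hθs hgi
  have hder : ∀ {A : Vec d → ℝ}, ContDiff ℝ ∞ A → HasCompactSupport A →
      Integrable fun x => fderiv ℝ A x (EuclideanSpace.single j 1) ^ 2 := fun hA hs =>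
    (hs.fderiv_apply (𝕜 := ℝ) (EuclideanSpace.single j 1)).integrable_sq
      ((hA.continuous_fderiv (by simp)).clm_apply continuous_const)
  exact ⟨(hsub (fun x => rfl) (hs1.integrable_sq hd1.continuous) (hs2.integrable_sq hd2.continuous)
      ha (hmul ha')).trans (mul_le_mul_of_nonneg_right hle hI),
    (hsub (fun x => fderiv_bogovskii_apply hε.1 hθ hθs hf hfs i x _) (hder hd1 hs1)
      (hder hd2 hs2) hb (hmul hb')).trans (mul_le_mul_of_nonneg_right hle hI)⟩

end Bogovskii

/-! ### The Sobolev space as a Hilbert space, and the divergence operator -/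

section SobolevSpace

variable {d : ℕ} {Ω : Set (Vec d)}

theorem norm_sq_eq_integral {F : Type} [NormedAddCommGroup F] [InnerProductSpace ℝ F]
    (u : LSp F 2 Ω) : ‖u‖ ^ 2 = ∫ x in Ω, ‖u x‖ ^ 2 := by
  rw [← real_inner_self_eq_norm_sq, L2.inner_def]
  simp only [real_inner_self_eq_norm_sq]

/-- The `i`-th component of a vector-valued `L²` function. -/
noncomputable def coordL {ι : Type} [Fintype ι] (Ω : Set (Vec d)) (i : ι) :
    LSp (EuclideanSpace ℝ ι) 2 Ω →L[ℝ] LSp ℝ 2 Ω :=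
  (EuclideanSpace.proj (𝕜 := ℝ) i).compLpL 2 _

theorem coeFn_coordL {ι : Type} [Fintype ι] (i : ι) (u : LSp (EuclideanSpace ℝ ι) 2 Ω) :
    ∀ᵐ x ∂((volume : Measure (Vec d)).restrict Ω), coordL Ω i u x = u x i :=
  (EuclideanSpace.proj (𝕜 := ℝ) i).coeFn_compLpL u

theorem integral_coord_mul_eq_inner {ι : Type} [Fintype ι] (u : LSp (EuclideanSpace ℝ ι) 2 Ω)
    (i : ι) {ψ : Vec d → ℝ} (hψ : MemLp ψ 2 ((volume : Measure (Vec d)).restrict Ω)) :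
    ∫ x in Ω, u x i * ψ x = inner ℝ (hψ.toLp ψ) (coordL Ω i u) := by
  rw [L2.inner_def]
  refine integral_congr_ae ?_
  filter_upwards [coeFn_coordL i u, hψ.coeFn_toLp] with x h1 h2
  rw [h1, h2]
  rfl

/-- Every identity defining the weak gradient is an equality of continuous functionals, being a
pairing with a fixed `L²` function. Completeness of `H1 Ω` follows. -/
theorem isClosed_H1 (Ω : Set (Vec d)) :
    IsClosed (H1 Ω : Set (WithLp 2 (LSp (Vec d) 2 Ω × LSp (Mat d) 2 Ω))) := by
  have hset : (H1 Ω : Set (WithLp 2 (LSp (Vec d) 2 Ω × LSp (Mat d) 2 Ω))) =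
      ⋂ (φ : Vec d → ℝ) (_ : IsTestFunction Ω φ) (i : Fin d) (j : Fin d),
        {w | ∫ x in Ω, w.fst x i * partialDeriv φ j x = - ∫ x in Ω, w.snd x (i, j) * φ x} := by
    ext w
    simp only [mem_iInter]
    rfl
  rw [hset]
  refine isClosed_iInter fun φ => isClosed_iInter fun hφ => isClosed_iInter fun i =>
    isClosed_iInter fun j => ?_
  simp only [integral_coord_mul_eq_inner _ _ (hφ.memLp_partialDeriv j),
    integral_coord_mul_eq_inner _ _ hφ.memLp]
  have h1 : Continuous fun w : WithLp 2 (LSp (Vec d) 2 Ω × LSp (Mat d) 2 Ω) => w.fst :=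
    (WithLp.fstL 2 ℝ _ _).continuous
  have h2 : Continuous fun w : WithLp 2 (LSp (Vec d) 2 Ω × LSp (Mat d) 2 Ω) => w.snd :=
    (WithLp.sndL 2 ℝ _ _).continuous
  exact isClosed_eq (continuous_const.inner ((coordL Ω i).continuous.comp h1))
    (continuous_const.inner ((coordL Ω (i, j)).continuous.comp h2)).neg

instance (Ω : Set (Vec d)) : CompleteSpace (H1 Ω) := (isClosed_H1 Ω).completeSpace_coe

/-- The velocity as a continuous linear map. -/
noncomputable def velL (Ω : Set (Vec d)) : H1 Ω →L[ℝ] LSp (Vec d) 2 Ω :=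
  (WithLp.fstL 2 ℝ _ _).comp (H1 Ω).subtypeL

/-- The weak gradient as a continuous linear map. -/
noncomputable def gradL (Ω : Set (Vec d)) : H1 Ω →L[ℝ] LSp (Mat d) 2 Ω :=
  (WithLp.sndL 2 ℝ _ _).comp (H1 Ω).subtypeL

theorem gradL_apply (v : H1 Ω) : gradL Ω v = grad v := rfl

/-- The weak divergence as a continuous linear map. -/
noncomputable def divL (Ω : Set (Vec d)) : H1 Ω →L[ℝ] LSp ℝ 2 Ω :=
  ∑ i : Fin d, (coordL Ω (i, i)).comp (gradL Ω)

theorem coeFn_divL (v : H1 Ω) :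
    ∀ᵐ x ∂((volume : Measure (Vec d)).restrict Ω), divL Ω v x = div v x := by
  have h1 : divL Ω v = ∑ i : Fin d, coordL Ω (i, i) (grad v) := by
    simp [divL, gradL_apply]
  have h2 : ∀ᵐ x ∂((volume : Measure (Vec d)).restrict Ω), ∀ i : Fin d,
      coordL Ω (i, i) (grad v) x = grad v x (i, i) :=
    ae_all_iff.2 fun i => coeFn_coordL (i, i) (grad v)
  have h3 := Lp.coeFn_finsetSum (p := 2) (μ := (volume : Measure (Vec d)).restrict Ω)
    Finset.univ fun i : Fin d => coordL Ω (i, i) (grad v)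
  rw [h1]
  filter_upwards [h2, h3] with x h2x h3x
  rw [h3x, Finset.sum_apply]
  exact Finset.sum_congr rfl fun i _ => h2x i

theorem H1_norm_sq (v : H1 Ω) : ‖v‖ ^ 2 = ‖vel v‖ ^ 2 + ‖grad v‖ ^ 2 :=
  WithLp.prod_norm_sq_eq_of_L2 v.1

theorem vel_add (v w : H1 Ω) : vel (v + w) = vel v + vel w := rfl

theorem grad_add (v w : H1 Ω) : grad (v + w) = grad v + grad w := rfl

theorem vel_smul (c : ℝ) (v : H1 Ω) : vel (c • v) = c • vel v := rfl

theorem grad_smul (c : ℝ) (v : H1 Ω) : grad (c • v) = c • grad v := rfl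

theorem jacobian_add {φ ψ : Vec d → Vec d} {x : Vec d} (hφ : DifferentiableAt ℝ φ x)
    (hψ : DifferentiableAt ℝ ψ x) : jacobian (φ + ψ) x = jacobian φ x + jacobian ψ x := by
  ext ij
  simp [jacobian, fderiv_add hφ hψ]

theorem jacobian_smul (c : ℝ) {φ : Vec d → Vec d} {x : Vec d} (hφ : DifferentiableAt ℝ φ x) :
    jacobian (c • φ) x = c • jacobian φ x := by
  ext ij
  simp [jacobian, fderiv_const_smul hφ]

theorem IsRestriction.add {v w : H1 Ω} {φ ψ : Vec d → Vec d} (hv : IsRestriction v φ)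
    (hw : IsRestriction w ψ) (hφ : Differentiable ℝ φ) (hψ : Differentiable ℝ ψ) :
    IsRestriction (v + w) (φ + ψ) := by
  constructor
  · rw [vel_add]
    filter_upwards [Lp.coeFn_add (vel v) (vel w), hv.1, hw.1] with x h1 h2 h3
    rw [h1, Pi.add_apply, h2, h3, Pi.add_apply]
  · rw [grad_add]
    filter_upwards [Lp.coeFn_add (grad v) (grad w), hv.2, hw.2] with x h1 h2 h3
    rw [h1, Pi.add_apply, h2, h3, jacobian_add (hφ x) (hψ x)]

theorem IsRestriction.smul {v : H1 Ω} {φ : Vec d → Vec d} (hv : IsRestriction v φ) (c : ℝ)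
    (hφ : Differentiable ℝ φ) : IsRestriction (c • v) (c • φ) := by
  constructor
  · rw [vel_smul]
    filter_upwards [Lp.coeFn_smul c (vel v), hv.1] with x h1 h2
    rw [h1, Pi.smul_apply, h2, Pi.smul_apply]
  · rw [grad_smul]
    filter_upwards [Lp.coeFn_smul c (grad v), hv.2] with x h1 h2
    rw [h1, Pi.smul_apply, h2, jacobian_smul c (hφ x)]

theorem IsTestFunction.add {F : Type} [NormedAddCommGroup F] [NormedSpace ℝ F] {φ ψ : Vec d → F}
    (hφ : IsTestFunction Ω φ) (hψ : IsTestFunction Ω ψ) : IsTestFunction Ω (φ + ψ) :=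
  ⟨hφ.smooth.add hψ.smooth, hφ.compact.add hψ.compact,
    (tsupport_add φ ψ).trans (union_subset hφ.subset hψ.subset)⟩

theorem IsTestFunction.const_smul {F : Type} [NormedAddCommGroup F] [NormedSpace ℝ F]
    {φ : Vec d → F} (hφ : IsTestFunction Ω φ) (c : ℝ) : IsTestFunction Ω (c • φ) := by
  have hs : Function.support (c • φ) ⊆ Function.support φ := Function.support_const_smul_subset c φ
  exact ⟨hφ.smooth.const_smul c, hφ.compact.mono hs, (closure_mono hs).trans hφ.subset⟩

theorem IsTestFunction.zero (Ω : Set (Vec d)) (F : Type) [NormedAddCommGroup F] [NormedSpace ℝ F] :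
    IsTestFunction Ω (0 : Vec d → F) :=
  ⟨contDiff_const, HasCompactSupport.zero, by simp [tsupport]⟩

theorem isRestriction_zero : IsRestriction (0 : H1 Ω) 0 := by
  constructor
  · filter_upwards [Lp.coeFn_zero (Vec d) 2 ((volume : Measure (Vec d)).restrict Ω)] with x hx
    exact hx
  · filter_upwards [Lp.coeFn_zero (Mat d) 2 ((volume : Measure (Vec d)).restrict Ω)] with x hx
    refine Eq.trans hx ?_
    ext ij
    simp [jacobian]

/-- The elements of `H¹(Ω)^d` given by test functions. -/
def testSubmodule (Ω : Set (Vec d)) : Submodule ℝ (H1 Ω) where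
  carrier := {v | ∃ φ : Vec d → Vec d, IsTestFunction Ω φ ∧ IsRestriction v φ}
  zero_mem' := ⟨0, IsTestFunction.zero Ω _, isRestriction_zero⟩
  add_mem' := by
    rintro v w ⟨φ, hφ, hv⟩ ⟨ψ, hψ, hw⟩
    exact ⟨φ + ψ, hφ.add hψ, hv.add hw (hφ.smooth.differentiable (by simp))
      (hψ.smooth.differentiable (by simp))⟩
  smul_mem' := by
    rintro c v ⟨φ, hφ, hv⟩
    exact ⟨c • φ, hφ.const_smul c, hv.smul c (hφ.smooth.differentiable (by simp))⟩

/-- `H¹₀(Ω)^d` as a closed subspace. -/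
noncomputable def H10Submodule (Ω : Set (Vec d)) : Submodule ℝ (H1 Ω) :=
  (testSubmodule Ω).topologicalClosure

theorem jacobian_apply {φ : Vec d → Vec d} {x : Vec d} (hφ : DifferentiableAt ℝ φ x)
    (i j : Fin d) : jacobian φ x (i, j) =
      fderiv ℝ (fun y => φ y i) x (EuclideanSpace.single j 1) := by
  have h : HasFDerivAt (fun y => φ y i)
      ((EuclideanSpace.proj (𝕜 := ℝ) i).comp (fderiv ℝ φ x)) x :=
    (EuclideanSpace.proj (𝕜 := ℝ) i).hasFDerivAt.comp x hφ.hasFDerivAt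
  rw [h.fderiv]
  rfl

theorem setIntegral_eq_integral_of_tsupport_subset {F : Type} [NormedAddCommGroup F]
    [NormedSpace ℝ F] {G : Vec d → F} (hG : tsupport G ⊆ Ω) : ∫ x in Ω, G x = ∫ x, G x :=
  setIntegral_eq_integral_of_forall_compl_eq_zero fun _ hx =>
    image_eq_zero_of_notMem_tsupport fun h => hx (hG h)

theorem integral_mul_fderiv_eq {φ ψ : Vec d → ℝ} (hφ : ContDiff ℝ ∞ φ) (hψ : ContDiff ℝ ∞ ψ)
    (hψs : HasCompactSupport ψ) (v : Vec d) :
    ∫ x, φ x * fderiv ℝ ψ x v = -∫ x, fderiv ℝ φ x v * ψ x := by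
  have hdφ : Continuous fun x => fderiv ℝ φ x v :=
    (hφ.continuous_fderiv (by simp)).clm_apply continuous_const
  have hdψ : Continuous fun x => fderiv ℝ ψ x v :=
    (hψ.continuous_fderiv (by simp)).clm_apply continuous_const
  exact integral_mul_fderiv_eq_neg_fderiv_mul_of_integrable
    ((hdφ.mul hψ.continuous).integrable_of_hasCompactSupport hψs.mul_left)
    ((hφ.continuous.mul hdψ).integrable_of_hasCompactSupport
      (hψs.fderiv_apply (𝕜 := ℝ) v).mul_left)
    ((hφ.continuous.mul hψ.continuous).integrable_of_hasCompactSupport hψs.mul_left)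
    (fun x _ => hφ.differentiable (by simp) x) (fun x _ => hψ.differentiable (by simp) x)

theorem integral_fderiv_eq_zero {ψ : Vec d → ℝ} (hψ : ContDiff ℝ ∞ ψ) (hψs : HasCompactSupport ψ)
    (v : Vec d) : ∫ x, fderiv ℝ ψ x v = 0 := by
  have h := integral_mul_fderiv_eq (φ := fun _ => 1) contDiff_const hψ hψs v
  simpa using h

theorem contDiff_jacobian {φ : Vec d → Vec d} (hφ : ContDiff ℝ ∞ φ) : Continuous (jacobian φ) := by
  have h : Continuous (fderiv ℝ φ) := hφ.continuous_fderiv (by simp)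
  unfold jacobian
  refine (PiLp.continuous_toLp 2 _).comp (continuous_pi fun ij => ?_)
  exact (EuclideanSpace.proj (𝕜 := ℝ) ij.1).continuous.comp (h.clm_apply continuous_const)

theorem hasCompactSupport_jacobian {φ : Vec d → Vec d} (hφ : HasCompactSupport φ) :
    HasCompactSupport (jacobian φ) := by
  refine (hφ.fderiv ℝ).mono fun x hx h0 => hx ?_
  ext ij
  simp [jacobian, h0]

theorem IsTestFunction.exists_isRestriction {φ : Vec d → Vec d} (hφ : IsTestFunction Ω φ) :
    ∃ v ∈ H10 Ω, IsRestriction v φ := by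
  have h1 : MemLp φ 2 ((volume : Measure (Vec d)).restrict Ω) :=
    (hφ.smooth.continuous.memLp_of_hasCompactSupport hφ.compact).restrict Ω
  have h2 : MemLp (jacobian φ) 2 ((volume : Measure (Vec d)).restrict Ω) :=
    ((contDiff_jacobian hφ.smooth).memLp_of_hasCompactSupport
      (hasCompactSupport_jacobian hφ.compact)).restrict Ω
  have hw : IsWeakGradient Ω (h1.toLp φ) (h2.toLp (jacobian φ)) := by
    intro ψ hψ i j
    have hφi : ContDiff ℝ ∞ fun x => φ x i := (EuclideanSpace.proj (𝕜 := ℝ) i).contDiff.comp hφ.smooth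
    have e1 : ∫ x in Ω, h1.toLp φ x i * partialDeriv ψ j x =
        ∫ x in Ω, φ x i * partialDeriv ψ j x :=
      integral_congr_ae (h1.coeFn_toLp.mono fun x hx => by simp only [hx])
    have e2 : ∫ x in Ω, h2.toLp (jacobian φ) x (i, j) * ψ x =
        ∫ x in Ω, fderiv ℝ (fun y => φ y i) x (EuclideanSpace.single j 1) * ψ x :=
      integral_congr_ae (h2.coeFn_toLp.mono fun x hx => by
        simp only [hx, jacobian_apply (hφ.smooth.differentiable (by simp) x)])
    have t1 : tsupport (fun x => fderiv ℝ (fun y => φ y i) x (EuclideanSpace.single j 1) * ψ x) ⊆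
        Ω :=
      (closure_mono fun x (hx : _ * ψ x ≠ 0) => right_ne_zero_of_mul hx).trans hψ.subset
    have t2 : tsupport (fun x => φ x i * partialDeriv ψ j x) ⊆ tsupport (partialDeriv ψ j) :=
      closure_mono fun x (hx : _ * partialDeriv ψ j x ≠ 0) => right_ne_zero_of_mul hx
    have t3 : tsupport (partialDeriv ψ j) ⊆ tsupport ψ :=
      tsupport_fderiv_apply_subset ℝ (EuclideanSpace.single j 1)
    rw [e1, e2, setIntegral_eq_integral_of_tsupport_subset t1,
      setIntegral_eq_integral_of_tsupport_subset (t2.trans (t3.trans hψ.subset)),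
      ← integral_mul_fderiv_eq hφi hψ.smooth hψ.compact]
    rfl
  let v : H1 Ω := ⟨WithLp.toLp 2 (h1.toLp φ, h2.toLp (jacobian φ)), hw⟩
  have hv : IsRestriction v φ := ⟨h1.coeFn_toLp, h2.coeFn_toLp⟩
  exact ⟨v, subset_closure ⟨φ, hφ, hv⟩, hv⟩

theorem IsRestriction.div_eq {v : H1 Ω} {φ : Vec d → Vec d} (hv : IsRestriction v φ)
    (hφ : Differentiable ℝ φ) : ∀ᵐ x ∂((volume : Measure (Vec d)).restrict Ω),
      divL Ω v x = ∑ i, fderiv ℝ (fun y => φ y i) x (EuclideanSpace.single i 1) := by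
  filter_upwards [coeFn_divL v, hv.2] with x h1 h2
  rw [h1, div, h2]
  exact Finset.sum_congr rfl fun i _ => jacobian_apply (hφ x) i i

theorem isFiniteMeasure_restrict (hΩ : Bornology.IsBounded Ω) :
    IsFiniteMeasure ((volume : Measure (Vec d)).restrict Ω) :=
  ⟨by rw [Measure.restrict_apply_univ]; exact hΩ.measure_lt_top⟩

/-- The integral over a bounded set as a continuous linear functional. -/
theorem exists_integralL (hΩ : Bornology.IsBounded Ω) :
    ∃ L : LSp ℝ 2 Ω →L[ℝ] ℝ, ∀ q, L q = ∫ x in Ω, q x := by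
  have := isFiniteMeasure_restrict hΩ
  have h1 : MemLp (fun _ : Vec d => (1 : ℝ)) 2 ((volume : Measure (Vec d)).restrict Ω) :=
    memLp_const 1
  refine ⟨innerSL ℝ (h1.toLp _), fun q => ?_⟩
  rw [innerSL_apply_apply, L2.inner_def]
  refine integral_congr_ae (h1.coeFn_toLp.mono fun x hx => ?_)
  simp only [hx]
  simp

/-- Derivatives of compactly supported functions have integral zero, and this condition passes to
the closure. -/
theorem divL_mem_L20 (hΩ : Bornology.IsBounded Ω) {v : H1 Ω} (hv : v ∈ H10 Ω) :
    divL Ω v ∈ L20 Ω := by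
  obtain ⟨L, hL⟩ := exists_integralL hΩ
  have hcl : IsClosed {v : H1 Ω | L (divL Ω v) = 0} :=
    isClosed_eq (L.continuous.comp (divL Ω).continuous) continuous_const
  have hsub : H10 Ω ⊆ {v : H1 Ω | L (divL Ω v) = 0} := by
    refine closure_minimal ?_ hcl
    rintro w ⟨φ, hφ, hw⟩
    have hφi : ∀ i, ContDiff ℝ ∞ fun x => φ x i := fun i =>
      (EuclideanSpace.proj (𝕜 := ℝ) i).contDiff.comp hφ.smooth
    have hsup : ∀ i, Function.support (fun x => φ x i) ⊆ Function.support φ := fun i x hx h0 =>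
      hx (by simp [h0])
    have hφs : ∀ i, HasCompactSupport fun x => φ x i := fun i => hφ.compact.mono (hsup i)
    change L (divL Ω w) = 0
    rw [hL, integral_congr_ae (hw.div_eq (hφ.smooth.differentiable (by simp))),
      integral_finsetSum]
    · refine Finset.sum_eq_zero fun i _ => ?_
      rw [setIntegral_eq_integral_of_tsupport_subset, integral_fderiv_eq_zero (hφi i) (hφs i)]
      exact (tsupport_fderiv_apply_subset ℝ _).trans ((closure_mono (hsup i)).trans hφ.subset)
    · intro i _
      exact ((((hφi i).continuous_fderiv (by simp)).clm_apply
        continuous_const).integrable_of_hasCompactSupport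
        ((hφs i).fderiv_apply (𝕜 := ℝ) _)).integrableOn
  have h : L (divL Ω v) = 0 := hsub hv
  rw [hL] at h
  exact h

end SobolevSpace

/-! ### The Hilbert space lemmas on closed subspaces -/

section HilbertSubmodule

variable {H K : Type*} [NormedAddCommGroup H] [InnerProductSpace ℝ H] [CompleteSpace H]
  [NormedAddCommGroup K] [InnerProductSpace ℝ K] [CompleteSpace K]

theorem exists_mem_eq_of_tendsto_of_bounded {S : Submodule ℝ H} (hS : IsClosed (S : Set H))
    (T : H →L[ℝ] K) {u : ℕ → H} (huS : ∀ n, u n ∈ S) {C : ℝ} (hu : ∀ n, ‖u n‖ ≤ C) {f : K}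
    (hf : Tendsto (fun n => T (u n)) atTop (𝓝 f)) : ∃ v ∈ S, T v = f := by
  have : CompleteSpace S := hS.completeSpace_coe
  obtain ⟨v, hv⟩ := mem_range_of_tendsto_of_bounded (T.comp S.subtypeL)
    (u := fun n => ⟨u n, huS n⟩) hu hf
  exact ⟨v.1, v.2, hv⟩

theorem exists_mem_inner_comp_eq {S : Submodule ℝ H} (hS : IsClosed (S : Set H))
    {L : Submodule ℝ K} (hL : IsClosed (L : Set K)) (T : H →L[ℝ] K) (hT : ∀ v ∈ S, T v ∈ L)
    (hT' : ∀ f ∈ L, ∃ v ∈ S, T v = f) (F : H →L[ℝ] ℝ) (hF : ∀ v ∈ S, T v = 0 → F v = 0) :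
    ∃ p ∈ L, ∀ v ∈ S, F v = inner ℝ p (T v) := by
  have : CompleteSpace S := hS.completeSpace_coe
  have : CompleteSpace L := hL.completeSpace_coe
  obtain ⟨p, hp⟩ := exists_inner_comp_eq_of_surjective
    ((T.comp S.subtypeL).codRestrict L fun v => hT v.1 v.2)
    (fun f => by
      obtain ⟨v, hv, h⟩ := hT' f.1 f.2
      exact ⟨⟨v, hv⟩, Subtype.ext h⟩)
    (F.comp S.subtypeL) (fun v hv => hF v.1 v.2 (congrArg Subtype.val hv))
  exact ⟨p.1, p.2, fun v hv => hp ⟨v, hv⟩⟩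

end HilbertSubmodule

/-! ### Solving `div v = f` on star-shaped pieces -/

section StarShaped

variable {d : ℕ} {Ω : Set (Vec d)}

theorem IsTestFunction.mono {F : Type} [NormedAddCommGroup F] [NormedSpace ℝ F] {U : Set (Vec d)}
    {φ : Vec d → F} (hφ : IsTestFunction U φ) (hU : U ⊆ Ω) : IsTestFunction Ω φ :=
  ⟨hφ.smooth, hφ.compact, hφ.subset.trans hU⟩

/-- The elements of `L²(Ω)` given by test functions supported in `U`. -/
def testL2Submodule (Ω U : Set (Vec d)) : Submodule ℝ (LSp ℝ 2 Ω) where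
  carrier := {F | ∃ φ : Vec d → ℝ, IsTestFunction U φ ∧
    ∀ᵐ x ∂((volume : Measure (Vec d)).restrict Ω), F x = φ x}
  zero_mem' := ⟨0, IsTestFunction.zero U ℝ,
    Lp.coeFn_zero ℝ 2 ((volume : Measure (Vec d)).restrict Ω)⟩
  add_mem' := by
    rintro F G ⟨φ, hφ, hF⟩ ⟨ψ, hψ, hG⟩
    refine ⟨φ + ψ, hφ.add hψ, ?_⟩
    filter_upwards [Lp.coeFn_add F G, hF, hG] with x h1 h2 h3
    rw [h1, Pi.add_apply, h2, h3, Pi.add_apply]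
  smul_mem' := by
    rintro c F ⟨φ, hφ, hF⟩
    refine ⟨c • φ, hφ.const_smul c, ?_⟩
    filter_upwards [Lp.coeFn_smul c F, hF] with x h1 h2
    rw [h1, Pi.smul_apply, h2, Pi.smul_apply]

/-- By the double orthogonal complement: a `g` orthogonal to all test functions in `U` vanishes
almost everywhere on `U`, while `f` vanishes off `U`, so `g` is orthogonal to `f`. -/
theorem mem_closure_testL2Submodule {U : Set (Vec d)} (hU : IsOpen U) {f : LSp ℝ 2 Ω}
    (hf : ∀ᵐ x ∂((volume : Measure (Vec d)).restrict Ω), x ∉ U → f x = 0) :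
    f ∈ (testL2Submodule Ω U).topologicalClosure := by
  rw [← Submodule.orthogonal_orthogonal_eq_closure, Submodule.mem_orthogonal]
  intro g hg
  have hg0 : ∀ᵐ x ∂((volume : Measure (Vec d)).restrict Ω), x ∈ U → g x = 0 := by
    refine hU.ae_eq_zero_of_integral_contDiff_smul_eq_zero
      (((Lp.memLp g).locallyIntegrable (by norm_num)).locallyIntegrableOn U) ?_
    intro φ hφ hφs hφU
    have hm : MemLp φ 2 ((volume : Measure (Vec d)).restrict Ω) :=
      (hφ.continuous.memLp_of_hasCompactSupport hφs).restrict Ω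
    have h := (Submodule.mem_orthogonal _ g).1 hg (hm.toLp φ)
      ⟨φ, ⟨hφ, hφs, hφU⟩, hm.coeFn_toLp⟩
    rw [L2.inner_def] at h
    rw [← h]
    refine integral_congr_ae (hm.coeFn_toLp.mono fun x hx => ?_)
    simp only [hx]
    exact mul_comm _ _
  rw [L2.inner_def]
  refine integral_eq_zero_of_ae ?_
  filter_upwards [hf, hg0] with x h1 h2
  by_cases hx : x ∈ U
  · simp [h2 hx]
  · simp [h1 hx]

/-- The truncated Bogovskii operator as a vector field. -/
noncomputable def bogovskiiField (ε : ℝ) (θ f : Vec d → ℝ) (x : Vec d) : Vec d :=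
  WithLp.toLp 2 fun i => bogovskii ε θ f i x

theorem isTestFunction_bogovskiiField {U : Set (Vec d)} {ε : ℝ} (hε : 0 < ε)
    {θ f : Vec d → ℝ} (hθ : ContDiff ℝ ∞ θ) (hθs : HasCompactSupport θ) (hf : ContDiff ℝ ∞ f)
    (hfs : HasCompactSupport f) (hU : join ε 1 (tsupport θ) (tsupport f) ⊆ U) :
    IsTestFunction U (bogovskiiField ε θ f) := by
  have hK := isCompact_join ε 1 hθs hfs
  have hsub : tsupport (bogovskiiField ε θ f) ⊆ join ε 1 (tsupport θ) (tsupport f) := by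
    refine closure_minimal (fun x hx => ?_) hK.isClosed
    by_contra hcon
    refine hx ?_
    ext i
    by_contra hne
    exact hcon (support_bogovskii_subset hε θ f i hne)
  refine ⟨?_, hK.of_isClosed_subset (isClosed_tsupport _) hsub, hsub.trans hU⟩
  rw [contDiff_euclidean]
  exact fun i => contDiff_bogovskii hε hθ hθs hf hfs i

theorem norm_sq_le_of_isRestriction {v : H1 Ω} {φ : Vec d → Vec d} (hφ : IsTestFunction Ω φ)
    (hv : IsRestriction v φ) {I : ℝ} (h0 : ∀ i, ∫ x, φ x i ^ 2 ≤ I)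
    (h1 : ∀ i j, ∫ x, fderiv ℝ (fun y => φ y i) x (EuclideanSpace.single j 1) ^ 2 ≤ I) :
    ‖v‖ ^ 2 ≤ (d + d * d) * I := by
  have hd := hφ.smooth.differentiable (by simp)
  have hφi : ∀ i, ContDiff ℝ ∞ fun x => φ x i := fun i =>
    (EuclideanSpace.proj (𝕜 := ℝ) i).contDiff.comp hφ.smooth
  have hφs : ∀ i, HasCompactSupport fun x => φ x i := fun i =>
    hφ.compact.mono fun x hx h0 => hx (by simp [h0])
  have hi0 : ∀ i, Integrable fun x => φ x i ^ 2 := fun i =>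
    (hφs i).integrable_sq (hφi i).continuous
  have hi1 : ∀ i j, Integrable fun x =>
      fderiv ℝ (fun y => φ y i) x (EuclideanSpace.single j 1) ^ 2 := fun i j =>
    ((hφs i).fderiv_apply (𝕜 := ℝ) _).integrable_sq
      (((hφi i).continuous_fderiv (by simp)).clm_apply continuous_const)
  let D : Fin d × Fin d → Vec d → ℝ := fun ij x =>
    fderiv ℝ (fun y => φ y ij.1) x (EuclideanSpace.single ij.2 1)
  have hiD : ∀ ij, Integrable (fun x => D ij x ^ 2) := fun ij => hi1 ij.1 ij.2
  have hle : ∀ G : Vec d → ℝ, Integrable (fun x => G x ^ 2) → ∫ x, G x ^ 2 ≤ I →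
      ∫ x in Ω, G x ^ 2 ≤ I := fun G hG h =>
    (setIntegral_le_integral hG (Eventually.of_forall fun x => sq_nonneg (G x))).trans h
  have e0 : ‖vel v‖ ^ 2 = ∑ i, ∫ x in Ω, φ x i ^ 2 := by
    rw [norm_sq_eq_integral, ← integral_finsetSum _ fun i _ => (hi0 i).integrableOn]
    refine integral_congr_ae (hv.1.mono fun x hx => ?_)
    simp only [hx, EuclideanSpace.norm_sq_eq, Real.norm_eq_abs, sq_abs]
  have e1 : ‖grad v‖ ^ 2 = ∑ ij : Fin d × Fin d, ∫ x in Ω, D ij x ^ 2 := by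
    rw [norm_sq_eq_integral, ← integral_finsetSum _ fun ij _ => (hiD ij).integrableOn]
    refine integral_congr_ae (hv.2.mono fun x hx => ?_)
    simp only [hx, EuclideanSpace.norm_sq_eq, Real.norm_eq_abs, sq_abs]
    exact Finset.sum_congr rfl fun ij _ => by rw [jacobian_apply (hd x)]
  have s0 : ‖vel v‖ ^ 2 ≤ d * I := by
    rw [e0]
    refine (Finset.sum_le_card_nsmul _ _ I fun i _ =>
      hle (fun x => φ x i) (hi0 i) (h0 i)).trans ?_
    simp
  have s1 : ‖grad v‖ ^ 2 ≤ d * d * I := by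
    rw [e1]
    refine (Finset.sum_le_card_nsmul _ _ I fun ij _ =>
      hle (D ij) (hiD ij) (h1 ij.1 ij.2)).trans ?_
    simp
  rw [H1_norm_sq]
  linarith

theorem tsupport_sq_subset (φ : Vec d → ℝ) : tsupport (fun x => φ x ^ 2) ⊆ tsupport φ :=
  closure_mono fun x (hx : φ x ^ 2 ≠ 0) => pow_ne_zero_iff two_ne_zero |>.1 hx

theorem integral_sq_eq_norm_sq {φ : Vec d → ℝ} (hφ : tsupport φ ⊆ Ω) {F : LSp ℝ 2 Ω}
    (hF : ∀ᵐ x ∂((volume : Measure (Vec d)).restrict Ω), F x = φ x) :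
    ∫ x, φ x ^ 2 = ‖F‖ ^ 2 := by
  rw [norm_sq_eq_integral,
    ← setIntegral_eq_integral_of_tsupport_subset ((tsupport_sq_subset φ).trans hφ)]
  refine integral_congr_ae (hF.mono fun x hx => ?_)
  simp only [hx, Real.norm_eq_abs, sq_abs]

theorem norm_divL_sub_sq_le {ε : ℝ} (hε : 0 < ε) (hε' : ε ≤ 1)
    {θ φ : Vec d → ℝ} (hθ : ContDiff ℝ ∞ θ) (hθs : HasCompactSupport θ) (hφ : ContDiff ℝ ∞ φ)
    (hφs : HasCompactSupport φ) {F : LSp ℝ 2 Ω}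
    (hF : ∀ᵐ x ∂((volume : Measure (Vec d)).restrict Ω), F x = φ x) {u : H1 Ω}
    (hud : Differentiable ℝ (bogovskiiField ε θ φ)) (hu : IsRestriction u (bogovskiiField ε θ φ)) :
    ‖divL Ω u - F‖ ^ 2 ≤ 2 * (∫ x, (dilateAverage ε θ φ x - φ x) ^ 2) +
      2 * ((∫ x, φ x) ^ 2 * ∫ x, θ x ^ 2) := by
  have hsum := fun x => sum_fderiv_bogovskii hε hε' hθ hθs hφ hφs x
  have hdc : Continuous fun x => dilateAverage ε θ φ x - φ x := by
    -- Continuity of the average is read off from the divergence identity, whose other terms are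
    -- visibly continuous.
    have h1 : ∀ x, dilateAverage ε θ φ x = θ x * (∫ y, φ y) +
        ∑ j, fderiv ℝ (bogovskii ε θ φ j) x (EuclideanSpace.single j 1) := by
      intro x
      rw [hsum]
      ring
    simp only [h1]
    refine ((hθ.continuous.mul continuous_const).add (continuous_finsetSum _ fun j _ => ?_)).sub
      hφ.continuous
    exact ((contDiff_bogovskii hε hθ hθs hφ hφs j).continuous_fderiv (by simp)).clm_apply
      continuous_const
  have h1 : HasCompactSupport (dilateAverage ε θ φ) :=
    HasCompactSupport.intro (isCompact_join ε 1 hθs hφs) fun x hx => by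
      by_contra hne
      exact hx (support_dilateAverage_subset hε hε' θ _ hne)
  have hds : HasCompactSupport fun x => dilateAverage ε θ φ x - φ x := h1.sub hφs
  have hi1 : Integrable fun x => (dilateAverage ε θ φ x - φ x) ^ 2 := hds.integrable_sq hdc
  have hi2 : Integrable fun x => θ x ^ 2 := hθs.integrable_sq hθ.continuous
  set c := ∫ x, φ x with hc
  have hmaj : Integrable fun x => 2 * (dilateAverage ε θ φ x - φ x) ^ 2 +
      2 * (c ^ 2 * θ x ^ 2) := (hi1.const_mul 2).add ((hi2.const_mul _).const_mul 2)
  rw [norm_sq_eq_integral]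
  calc _ ≤ ∫ x in Ω, (2 * (dilateAverage ε θ φ x - φ x) ^ 2 + 2 * (c ^ 2 * θ x ^ 2)) := by
        refine integral_mono_of_nonneg (Eventually.of_forall fun x => sq_nonneg _)
          hmaj.integrableOn ?_
        filter_upwards [hu.div_eq hud, hF, Lp.coeFn_sub (divL Ω u) F] with x h1 h2 h3
        have h4 : divL Ω u x = dilateAverage ε θ φ x - θ x * c := h1.trans (hsum x)
        rw [h3, Pi.sub_apply, h4, h2, Real.norm_eq_abs, sq_abs]
        nlinarith [sq_nonneg (dilateAverage ε θ φ x - φ x + θ x * c)]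
    _ ≤ ∫ x, (2 * (dilateAverage ε θ φ x - φ x) ^ 2 + 2 * (c ^ 2 * θ x ^ 2)) :=
        setIntegral_le_integral hmaj (Eventually.of_forall fun x => by positivity)
    _ = _ := by
        rw [integral_add (hi1.const_mul 2) ((hi2.const_mul _).const_mul 2), integral_const_mul,
          integral_const_mul, integral_const_mul]

theorem exists_smooth_bump (z : Vec d) {ρ : ℝ} (hρ : 0 < ρ) :
    ∃ θ : Vec d → ℝ, ContDiff ℝ ∞ θ ∧ HasCompactSupport θ ∧ ∫ x, θ x = 1 ∧
      tsupport θ ⊆ Metric.ball z ρ := by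
  let b : ContDiffBump z := ⟨ρ / 4, ρ / 2, by positivity, by linarith⟩
  refine ⟨b.normed volume, b.contDiff_normed, b.hasCompactSupport_normed, b.integral_normed, ?_⟩
  rw [b.tsupport_normed_eq]
  exact Metric.closedBall_subset_ball (by change ρ / 2 < ρ; linarith)

/-- Approximate `f` by test functions `φₙ` in `U` and choose `εₙ` so that the approximation error is
below `1/(n + 1)`. The Bogovskii fields are bounded in `H1 Ω` and supported in `U`, and their
divergences tend to `f`: the remainder `θ ∫ φₙ` disappears because `∫ f = 0`. -/
theorem exists_divL_eq_of_starShaped (hΩ : Bornology.IsBounded Ω) {U : Set (Vec d)}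
    (hU : IsOpen U) (hUΩ : U ⊆ Ω) {z : Vec d} {ρ : ℝ} (hρ : 0 < ρ)
    (hstar : ∀ y ∈ U, ∀ w ∈ Metric.ball z ρ, ∀ t ∈ Icc (0 : ℝ) 1, t • w + (1 - t) • y ∈ U)
    {f : LSp ℝ 2 Ω} (hf : ∀ᵐ x ∂((volume : Measure (Vec d)).restrict Ω), x ∉ U → f x = 0)
    (hf0 : f ∈ L20 Ω) : ∃ v ∈ H10 Ω, divL Ω v = f := by
  obtain ⟨L, hL⟩ := exists_integralL hΩ
  obtain ⟨θ, hθ, hθs, hθ1, hθball⟩ := exists_smooth_bump z hρ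
  obtain ⟨R, hR⟩ := ((hΩ.subset hUΩ).union hθs.isBounded).subset_closedBall 0
  obtain ⟨C, hC, hbound⟩ := exists_integral_sq_bogovskii_le hθ hθs (subset_union_right.trans hR)
  obtain ⟨F, hFmem, hFlim⟩ := mem_closure_iff_seq_limit.1 (mem_closure_testL2Submodule hU hf)
  choose φ hφ hFφ using hFmem
  have hφR : ∀ n, tsupport (φ n) ⊆ Metric.closedBall 0 R := fun n =>
    (hφ n).subset.trans (subset_union_left.trans hR)
  have happrox : ∀ n : ℕ, ∃ ε ∈ Ioc (0 : ℝ) (1 / 2),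
      ∫ x, (dilateAverage ε θ (φ n) x - φ n x) ^ 2 < 1 / ((n : ℝ) + 1) := by
    intro n
    have h1 := tendsto_integral_sq_dilateAverage_sub hθ.continuous hθs hθ1
      (hφ n).smooth.continuous (hφ n).compact (subset_union_right.trans hR) (hφR n)
    have h2 := h1.eventually (gt_mem_nhds (by positivity : (0 : ℝ) < 1 / ((n : ℝ) + 1)))
    have h3 : ∀ᶠ ε in 𝓝[>] (0 : ℝ), ε ∈ Ioc (0 : ℝ) (1 / 2) := Ioc_mem_nhdsGT (by norm_num)
    obtain ⟨ε, hε1, hε2⟩ := (h3.and h2).exists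
    exact ⟨ε, hε1, hε2⟩
  choose ε hε happrox using happrox
  have hjoin : ∀ n, join (ε n) 1 (tsupport θ) (tsupport (φ n)) ⊆ U := by
    rintro n _ ⟨⟨t, w, y⟩, ⟨ht, hw, hy⟩, rfl⟩
    exact hstar y ((hφ n).subset hy) w (hθball hw) t ⟨(hε n).1.le.trans ht.1, ht.2⟩
  have htest : ∀ n, IsTestFunction Ω (bogovskiiField (ε n) θ (φ n)) := fun n =>
    (isTestFunction_bogovskiiField (hε n).1 hθ hθs (hφ n).smooth (hφ n).compact (hjoin n)).mono hUΩ
  choose u hu0 hu using fun n => (htest n).exists_isRestriction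
  have hFint : ∀ n, ∫ x, φ n x = L (F n) := by
    intro n
    rw [hL, integral_congr_ae (hFφ n),
      setIntegral_eq_integral_of_tsupport_subset ((hφ n).subset.trans hUΩ)]
  have hFsq : ∀ n, ∫ x, φ n x ^ 2 = ‖F n‖ ^ 2 := fun n =>
    integral_sq_eq_norm_sq ((hφ n).subset.trans hUΩ) (hFφ n)
  obtain ⟨M, hM⟩ : ∃ M, ∀ n, ‖F n‖ ≤ M := by
    obtain ⟨M, hM⟩ := hFlim.norm.bddAbove_range
    exact ⟨M, fun n => hM ⟨n, rfl⟩⟩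
  have hu_bound : ∀ n, ‖u n‖ ^ 2 ≤ (d + d * d) * (C * M ^ 2) := by
    intro n
    have hI : C * ∫ x, φ n x ^ 2 ≤ C * M ^ 2 := by
      rw [hFsq]
      have := hM n
      gcongr
    refine norm_sq_le_of_isRestriction (htest n) (hu n) (fun i => ?_) fun i j => ?_
    · exact (hbound (ε n) (hε n) (φ n) (hφ n).smooth (hφ n).compact (hφR n) i i).1.trans hI
    · exact (hbound (ε n) (hε n) (φ n) (hφ n).smooth (hφ n).compact (hφR n) i j).2.trans hI
  have hT : ∀ n, ‖divL Ω (u n) - F n‖ ^ 2 ≤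
      2 * (1 / ((n : ℝ) + 1)) + 2 * ((L (F n)) ^ 2 * ∫ x, θ x ^ 2) := by
    intro n
    have h := norm_divL_sub_sq_le (hε n).1 ((hε n).2.trans (by norm_num)) hθ hθs (hφ n).smooth
      (hφ n).compact (hFφ n) ((htest n).smooth.differentiable (by simp)) (hu n)
    rw [hFint] at h
    linarith [(happrox n).le]
  have hLF : Tendsto (fun n => L (F n)) atTop (𝓝 0) := by
    have h := (L.continuous.tendsto f).comp hFlim
    have hLf : L f = 0 := (hL f).trans hf0
    rwa [hLf] at h
  have hlim0 : Tendsto (fun n : ℕ => 2 * (1 / ((n : ℝ) + 1)) +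
      2 * ((L (F n)) ^ 2 * ∫ x, θ x ^ 2)) atTop (𝓝 0) := by
    have h := ((tendsto_one_div_add_atTop_nhds_zero_nat (𝕜 := ℝ)).const_mul 2).add
      (((hLF.pow 2).mul_const (∫ x, θ x ^ 2)).const_mul 2)
    simpa using h
  have hsq : Tendsto (fun n => ‖divL Ω (u n) - F n‖ ^ 2) atTop (𝓝 0) :=
    squeeze_zero (fun n => sq_nonneg _) hT hlim0
  have hnorm : Tendsto (fun n => ‖divL Ω (u n) - F n‖) atTop (𝓝 0) := by
    have h := hsq.sqrt
    simpa [Real.sqrt_sq] using h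
  have hTlim : Tendsto (fun n => divL Ω (u n)) atTop (𝓝 f) := by
    have h := (tendsto_zero_iff_norm_tendsto_zero.2 hnorm).add hFlim
    simpa using h
  exact exists_mem_eq_of_tendsto_of_bounded (S := H10Submodule Ω) isClosed_closure (divL Ω) hu0
    (fun n => Real.le_sqrt_of_sq_le (hu_bound n)) hTlim

end StarShaped

/-! ### Local star-shapedness of Lipschitz domains -/

section Geometry

variable {d : ℕ} {Ω : Set (Vec d)}

theorem norm_le_abs_inner_add_norm_orthogonalProjection {e : Vec d} (he : ‖e‖ = 1) (v : Vec d) :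
    ‖v‖ ≤ |inner ℝ e v| + ‖(Submodule.span ℝ {e})ᗮ.orthogonalProjectionOnto v‖ := by
  have h := (Submodule.span ℝ {e}).starProjection_add_starProjection_orthogonal v
  rw [Submodule.starProjection_unit_singleton ℝ he v] at h
  calc ‖v‖ = ‖inner ℝ e v • e + (Submodule.span ℝ {e})ᗮ.starProjection v‖ := by rw [h]
    _ ≤ ‖inner ℝ e v • e‖ + ‖(Submodule.span ℝ {e})ᗮ.starProjection v‖ := norm_add_le _ _
    _ = _ := by
      rw [norm_smul, he, mul_one, Real.norm_eq_abs]
      rfl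

/-- Take `U` to be the part above the graph of a thin cylinder around `x₀`, and as centre a small
ball at height `r / 4` over `x₀`. The cylinder is so thin that the graph varies little compared with
`r`, so every point of the ball sees all of `U`. -/
theorem IsLipschitzDomain.exists_starShaped_of_mem_frontier (hΩ : IsLipschitzDomain Ω)
    {x₀ : Vec d} (hx₀ : x₀ ∈ frontier Ω) :
    ∃ N ∈ 𝓝 x₀, ∃ U, IsOpen U ∧ U ⊆ Ω ∧ N ∩ Ω ⊆ U ∧ ∃ (z : Vec d) (ρ : ℝ), 0 < ρ ∧
      ∀ y ∈ U, ∀ w ∈ Metric.ball z ρ, ∀ t ∈ Icc (0 : ℝ) 1, t • w + (1 - t) • y ∈ U := by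
  obtain ⟨e, he, K, φ, hφ, r, hr, h⟩ := hΩ.lipschitz_boundary x₀ hx₀
  set P := (Submodule.span ℝ {e})ᗮ.orthogonalProjectionOnto with hP
  have hPe : P e = 0 := by
    refine Submodule.orthogonalProjectionOnto_eq_zero_iff.2 ?_
    rw [Submodule.orthogonal_orthogonal]
    exact Submodule.mem_span_singleton_self e
  have hPle : ∀ v, ‖P v‖ ≤ ‖v‖ := fun v => Submodule.norm_orthogonalProjectionOnto_apply_le _ v
  have hsle : ∀ v, |inner ℝ e v| ≤ ‖v‖ := fun v => by
    simpa [he] using abs_real_inner_le_norm e v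
  have hee : inner ℝ e e = (1 : ℝ) := by rw [real_inner_self_eq_norm_sq, he, one_pow]
  have hcφ : Continuous fun x => φ (P x) := hφ.continuous.comp P.continuous
  have hcs : Continuous fun x : Vec d => (inner ℝ e x : ℝ) := by fun_prop
  have hK : (0 : ℝ) ≤ K := K.2
  have hlip : ∀ x y, φ (P x) ≤ φ (P y) + K * ‖P (x - y)‖ := by
    intro x y
    have h1 := hφ.dist_le_mul (P x) (P y)
    rw [dist_eq_norm, dist_eq_norm, ← map_sub] at h1
    linarith [le_abs_self (φ (P x) - φ (P y)), Real.norm_eq_abs (φ (P x) - φ (P y))]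
  -- Otherwise a neighbourhood of `x₀` would lie below the graph and miss `Ω`. Only this half of the
  -- statement that `x₀` lies on the graph is needed.
  have hle0 : φ (P x₀) ≤ inner ℝ e x₀ := by
    by_contra! hlt
    have hV : {x | (inner ℝ e x : ℝ) < φ (P x)} ∩ Metric.ball x₀ r ∈ 𝓝 x₀ :=
      inter_mem ((isOpen_lt hcs hcφ).mem_nhds hlt) (Metric.ball_mem_nhds x₀ hr)
    obtain ⟨x, ⟨hx1, hx2⟩, hx3⟩ := mem_closure_iff_nhds.1 hx₀.1 _ hV
    exact lt_asymm hx1 ((h x hx2).1 hx3)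
  -- Chosen so that `K δ + δ = r / 24`: both the oscillation of the graph over the cylinder and the
  -- radius of the ball are then small against the height `r / 4`.
  set δ := r / (24 * (K + 1)) with hδ
  have hK1 : (0 : ℝ) < K + 1 := by linarith
  have hδ0 : 0 < δ := by positivity
  have hδK : K * δ + δ = r / 24 := by
    rw [hδ]
    field_simp
  have hKδ : 0 ≤ K * δ := by positivity
  set N := {x : Vec d | ‖P (x - x₀)‖ < δ ∧ |inner ℝ e (x - x₀)| < r / 2} with hN
  have hNopen : IsOpen N := by
    have h1 : IsOpen {x : Vec d | ‖P (x - x₀)‖ < δ} :=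
      isOpen_lt (P.continuous.comp (continuous_id.sub continuous_const)).norm continuous_const
    have h2 : IsOpen {x : Vec d | |(inner ℝ e (x - x₀) : ℝ)| < r / 2} :=
      isOpen_lt (hcs.comp (continuous_id.sub continuous_const)).abs continuous_const
    exact h1.inter h2
  have hNconv : Convex ℝ N := by
    rw [convex_iff_forall_pos]
    intro x hx y hy a b ha hb hab
    have hv : a • x + b • y - x₀ = a • (x - x₀) + b • (y - x₀) := by
      rw [smul_sub, smul_sub, sub_add_sub_comm, ← add_smul, hab, one_smul]
    refine ⟨?_, ?_⟩
    · rw [hv, map_add, map_smul, map_smul]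
      refine (norm_add_le _ _).trans_lt ?_
      rw [norm_smul, norm_smul, Real.norm_of_nonneg ha.le, Real.norm_of_nonneg hb.le]
      nlinarith [hx.1, hy.1]
    · rw [hv, inner_add_right, inner_smul_right, inner_smul_right]
      refine (abs_add_le _ _).trans_lt ?_
      rw [abs_mul, abs_mul, abs_of_pos ha, abs_of_pos hb]
      nlinarith [hx.2, hy.2]
  have hNball : N ⊆ Metric.ball x₀ r := by
    intro x hx
    rw [mem_ball_iff_norm]
    have := norm_le_abs_inner_add_norm_orthogonalProjection he (x - x₀)
    linarith [hx.1, hx.2]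
  refine ⟨N, hNopen.mem_nhds ⟨by simpa using hδ0, by simpa using hr⟩,
    N ∩ {x | φ (P x) < inner ℝ e x}, hNopen.inter (isOpen_lt hcφ hcs),
    fun x hx => (h x (hNball hx.1)).2 hx.2, fun x hx => ⟨hx.1, (h x (hNball hx.1)).1 hx.2⟩,
    x₀ + (r / 4) • e, δ, hδ0, ?_⟩
  intro y hy w hw t ht
  rw [mem_ball_iff_norm] at hw
  have hwz : w - x₀ = (w - (x₀ + (r / 4) • e)) + (r / 4) • e := by abel
  have hwP : ‖P (w - x₀)‖ < δ := by
    rw [hwz, map_add, map_smul, hPe, smul_zero, add_zero]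
    exact (hPle _).trans_lt hw
  have hws : |inner ℝ e (w - x₀) - r / 4| < δ := by
    rw [hwz, inner_add_right, inner_smul_right, hee, mul_one, add_sub_cancel_right]
    exact (hsle _).trans_lt hw
  rw [abs_lt] at hws
  have hwN : w ∈ N := ⟨hwP, abs_lt.2 ⟨by linarith, by linarith⟩⟩
  have hxN : t • w + (1 - t) • y ∈ N :=
    hNconv hwN hy.1 ht.1 (sub_nonneg.2 ht.2) (by ring)
  refine ⟨hxN, ?_⟩
  change φ (P (t • w + (1 - t) • y)) < inner ℝ e (t • w + (1 - t) • y)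
  rcases ht.1.eq_or_lt with rfl | ht0
  · simpa using hy.2
  have hys : φ (P y) < inner ℝ e y := hy.2
  have hsx : (inner ℝ e (t • w + (1 - t) • y) : ℝ) =
      t * inner ℝ e w + (1 - t) * inner ℝ e y := by
    rw [inner_add_right, inner_smul_right, inner_smul_right]
  rw [inner_sub_right] at hws
  rw [hsx]
  -- If `y` is at height at least `⟨e, x₀⟩ + K δ`, both endpoints are above a level that the graph
  -- does not exceed over the cylinder. If `y` is lower, then `w` exceeds it by at least `2 K δ`, so
  -- moving from `y` towards `w` gains height at least as fast as the graph can rise.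
  rcases le_or_gt (inner ℝ e x₀ + K * δ) (inner ℝ e y) with hA | hB
  · have h1 := hlip (t • w + (1 - t) • y) x₀
    have h2 : K * ‖P (t • w + (1 - t) • y - x₀)‖ ≤ K * δ :=
      mul_le_mul_of_nonneg_left hxN.1.le hK
    have h3 : inner ℝ e x₀ + K * δ < inner ℝ e w := by linarith
    have h4 : 0 ≤ 1 - t := sub_nonneg.2 ht.2
    nlinarith
  · have h1 := hlip (t • w + (1 - t) • y) y
    have hv : t • w + (1 - t) • y - y = t • ((w - x₀) - (y - x₀)) := by
      rw [sub_sub_sub_cancel_right, sub_smul, one_smul, smul_sub]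
      abel
    have h2 : ‖P ((w - x₀) - (y - x₀))‖ ≤ 2 * δ := by
      rw [map_sub]
      linarith [norm_sub_le (P (w - x₀)) (P (y - x₀)), hy.1.1]
    rw [hv, map_smul, norm_smul, Real.norm_of_nonneg ht0.le] at h1
    have h3 : K * (t * ‖P ((w - x₀) - (y - x₀))‖) ≤ t * (2 * (K * δ)) := by
      calc K * (t * ‖P ((w - x₀) - (y - x₀))‖) = t * (K * ‖P ((w - x₀) - (y - x₀))‖) := by ring
        _ ≤ t * (K * (2 * δ)) := by gcongr
        _ = _ := by ring
    have h4 : 2 * (K * δ) ≤ inner ℝ e w - inner ℝ e y := by linarith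
    have h5 := mul_le_mul_of_nonneg_left h4 ht0.le
    linarith

theorem IsLipschitzDomain.exists_starShaped (hΩ : IsLipschitzDomain Ω) {x₀ : Vec d}
    (hx₀ : x₀ ∈ closure Ω) :
    ∃ N ∈ 𝓝 x₀, ∃ U, IsOpen U ∧ U ⊆ Ω ∧ N ∩ Ω ⊆ U ∧ ∃ (z : Vec d) (ρ : ℝ), 0 < ρ ∧
      ∀ y ∈ U, ∀ w ∈ Metric.ball z ρ, ∀ t ∈ Icc (0 : ℝ) 1, t • w + (1 - t) • y ∈ U := by
  by_cases hx : x₀ ∈ Ω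
  · obtain ⟨r, hr, hball⟩ := Metric.isOpen_iff.1 hΩ.isOpen x₀ hx
    refine ⟨Metric.ball x₀ r, Metric.ball_mem_nhds x₀ hr, Metric.ball x₀ r, Metric.isOpen_ball,
      hball, inter_subset_left, x₀, r, hr, fun y hy w hw t ht => ?_⟩
    exact convex_ball x₀ r hw hy ht.1 (sub_nonneg.2 ht.2) (by ring)
  · exact hΩ.exists_starShaped_of_mem_frontier
      ⟨hx₀, by rwa [hΩ.isOpen.interior_eq]⟩

end Geometry

/-! ### Gluing local solutions along a connected cover -/

section Gluing

variable {d : ℕ} {Ω : Set (Vec d)}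

/-- `f` vanishes outside `U`. -/
def VanishesOff {Ω : Set (Vec d)} (U : Set (Vec d)) (f : LSp ℝ 2 Ω) : Prop :=
  ∀ᵐ x ∂((volume : Measure (Vec d)).restrict Ω), x ∉ U → f x = 0

theorem VanishesOff.mono {U V : Set (Vec d)} {f : LSp ℝ 2 Ω} (hf : VanishesOff U f)
    (h : U ⊆ V) : VanishesOff V f :=
  Eventually.mono hf fun _ hx hV => hx fun hU => hV (h hU)

theorem VanishesOff.sub {U : Set (Vec d)} {f g : LSp ℝ 2 Ω} (hf : VanishesOff U f)
    (hg : VanishesOff U g) : VanishesOff U (f - g) := by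
  unfold VanishesOff at *
  filter_upwards [hf, hg, Lp.coeFn_sub f g] with x h1 h2 h3 hx
  rw [h3, Pi.sub_apply, h1 hx, h2 hx, sub_zero]

theorem VanishesOff.smul {U : Set (Vec d)} {f : LSp ℝ 2 Ω} (hf : VanishesOff U f) (c : ℝ) :
    VanishesOff U (c • f) := by
  unfold VanishesOff at *
  filter_upwards [hf, Lp.coeFn_smul c f] with x h1 h3 hx
  rw [h3, Pi.smul_apply, h1 hx, smul_zero]

theorem VanishesOff.eq_zero {f : LSp ℝ 2 Ω} (hf : VanishesOff ∅ f) : f = 0 := by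
  rw [Lp.eq_zero_iff_ae_eq_zero]
  exact Eventually.mono hf fun x hx => hx (notMem_empty x)

theorem exists_vanishesOff_decomp {U V : Set (Vec d)} (hU : IsOpen U) {f : LSp ℝ 2 Ω}
    (hf : VanishesOff (U ∪ V) f) :
    ∃ g h : LSp ℝ 2 Ω, VanishesOff U g ∧ VanishesOff V h ∧ f = g + h := by
  have hm := (Lp.memLp f).indicator hU.measurableSet
  refine ⟨hm.toLp _, f - hm.toLp _, ?_, ?_, by abel⟩
  · unfold VanishesOff
    filter_upwards [hm.coeFn_toLp] with x hx hxU
    rw [hx, indicator_of_notMem hxU]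
  · unfold VanishesOff at *
    filter_upwards [hm.coeFn_toLp, Lp.coeFn_sub f (hm.toLp _), hf] with x h1 h2 h3 hxV
    rw [h2, Pi.sub_apply, h1]
    by_cases hxU : x ∈ U
    · rw [indicator_of_mem hxU, sub_self]
    · rw [indicator_of_notMem hxU, sub_zero]
      exact h3 fun hx => hx.elim hxU hxV

theorem exists_bump_vanishesOff (hΩ : Bornology.IsBounded Ω) {W : Set (Vec d)} (hW : IsOpen W)
    (hWΩ : W ⊆ Ω) (hne : W.Nonempty) :
    ∃ χ : LSp ℝ 2 Ω, VanishesOff W χ ∧ ∫ x in Ω, χ x = 1 := by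
  have := isFiniteMeasure_restrict hΩ
  have hμ : (volume : Measure (Vec d)).restrict Ω W ≠ ⊤ := measure_ne_top _ _
  have hpos : 0 < ((volume : Measure (Vec d)).restrict Ω).real W := by
    refine ENNReal.toReal_pos ?_ hμ
    rw [Measure.restrict_apply hW.measurableSet, inter_eq_left.2 hWΩ]
    exact (hW.measure_pos volume hne).ne'
  refine ⟨indicatorConstLp 2 hW.measurableSet hμ
    (((volume : Measure (Vec d)).restrict Ω).real W)⁻¹, ?_, ?_⟩
  · unfold VanishesOff
    filter_upwards [indicatorConstLp_coeFn (p := 2) (hs := hW.measurableSet) (hμs := hμ)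
      (c := (((volume : Measure (Vec d)).restrict Ω).real W)⁻¹)] with x hx hxW
    rw [hx, indicator_of_notMem hxW]
  · rw [integral_indicatorConstLp, smul_eq_mul, mul_inv_cancel₀ hpos.ne']

/-- If a subspace contains all mean-zero functions supported in any single member of a finite open
cover of a bounded connected set, then it contains all mean-zero functions. -/
theorem L20_subset_of_cover (hΩb : Bornology.IsBounded Ω) (hΩc : IsConnected Ω)
    (R : Submodule ℝ (LSp ℝ 2 Ω)) {ι : Type} (s : Finset ι) (U : ι → Set (Vec d))
    (hUo : ∀ i, IsOpen (U i)) (hUΩ : ∀ i, U i ⊆ Ω) (hcover : Ω ⊆ ⋃ i ∈ s, U i)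
    (hR : ∀ i ∈ s, ∀ f ∈ L20 Ω, VanishesOff (U i) f → f ∈ R) : L20 Ω ⊆ R := by
  obtain ⟨L, hL⟩ := exists_integralL hΩb
  have hR' : ∀ i ∈ s, ∀ f, L f = 0 → VanishesOff (U i) f → f ∈ R := fun i hi f hf =>
    hR i hi f ((hL f).symm.trans hf)
  obtain ⟨x₀, hx₀⟩ := hΩc.nonempty
  obtain ⟨i₀, hi₀, hx₀i⟩ := mem_iUnion₂.1 (hcover hx₀)
  obtain ⟨χ₀, hχ₀, hχ₀1⟩ := exists_bump_vanishesOff hΩb (hUo i₀) (hUΩ i₀) ⟨x₀, hx₀i⟩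
  rw [← hL] at hχ₀1
  -- Modulo `R`, a function supported in a good piece is determined by its integral: it equals that
  -- multiple of the reference bump `χ₀`.
  let Good : ι → Prop := fun i => ∀ f, VanishesOff (U i) f → f - L f • χ₀ ∈ R
  have hgood₀ : Good i₀ := fun f hf => hR' i₀ hi₀ _
    (by rw [map_sub, map_smul, hχ₀1, smul_eq_mul, mul_one, sub_self]) (hf.sub (hχ₀.smul _))
  -- Mass is transferred through a bump `χ` in the overlap: `f - L f • χ` has mean zero in the
  -- second piece, and `χ - χ₀` belongs to `R` because the first piece is good.
  have hstep : ∀ i j, j ∈ s → Good i → (U i ∩ U j).Nonempty → Good j := by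
    intro i j hj hi hne f hf
    obtain ⟨χ, hχ, hχ1⟩ := exists_bump_vanishesOff hΩb ((hUo i).inter (hUo j))
      (inter_subset_left.trans (hUΩ i)) hne
    rw [← hL] at hχ1
    have h1 : f - L f • χ ∈ R := hR' j hj _
      (by rw [map_sub, map_smul, hχ1, smul_eq_mul, mul_one, sub_self])
      (hf.sub ((hχ.mono inter_subset_right).smul _))
    have h2 := hi χ (hχ.mono inter_subset_left)
    rw [hχ1, one_smul] at h2
    have h3 := R.add_mem h1 (R.smul_mem (L f) h2)
    rw [smul_sub, sub_add_sub_cancel] at h3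
    exact h3
  have hall : ∀ i ∈ s, Good i := by
    intro j hj
    by_contra hbad
    -- An empty piece is trivially good, so a bad one is nonempty. The unions of good and of bad
    -- pieces then both meet the connected set `Ω`, hence overlap, contradicting `hstep`.
    have hne : (U j).Nonempty := by
      by_contra hempty
      rw [not_nonempty_iff_eq_empty] at hempty
      refine hbad fun f hf => ?_
      rw [hempty] at hf
      rw [hf.eq_zero, map_zero, zero_smul, sub_zero]
      exact R.zero_mem
    let V₁ := ⋃ i ∈ {i | i ∈ s ∧ Good i}, U i
    let V₂ := ⋃ i ∈ {i | i ∈ s ∧ ¬ Good i}, U i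
    have hV₁ : IsOpen V₁ := isOpen_biUnion fun i _ => hUo i
    have hV₂ : IsOpen V₂ := isOpen_biUnion fun i _ => hUo i
    have hcov : Ω ⊆ V₁ ∪ V₂ := by
      intro x hx
      obtain ⟨i, hi, hxi⟩ := mem_iUnion₂.1 (hcover hx)
      by_cases hg : Good i
      · exact Or.inl (mem_iUnion₂.2 ⟨i, ⟨hi, hg⟩, hxi⟩)
      · exact Or.inr (mem_iUnion₂.2 ⟨i, ⟨hi, hg⟩, hxi⟩)
    obtain ⟨y, hy⟩ := hne
    obtain ⟨x, -, hx1, hx2⟩ := hΩc.isPreconnected V₁ V₂ hV₁ hV₂ hcov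
      ⟨x₀, hx₀, mem_iUnion₂.2 ⟨i₀, ⟨hi₀, hgood₀⟩, hx₀i⟩⟩
      ⟨y, hUΩ j hy, mem_iUnion₂.2 ⟨j, ⟨hj, hbad⟩, hy⟩⟩
    obtain ⟨i, ⟨-, hgi⟩, hxi⟩ := mem_iUnion₂.1 hx1
    obtain ⟨k, ⟨hk, hbk⟩, hxk⟩ := mem_iUnion₂.1 hx2
    exact hbk (hstep i k hk hgi ⟨x, hxi, hxk⟩)
  -- Cutting with indicators splits a function into pieces supported in single members of the cover;
  -- no smooth partition of unity is needed in `L²`.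
  have hsum : ∀ t : Finset ι, t ⊆ s → ∀ f, VanishesOff (⋃ i ∈ t, U i) f → f - L f • χ₀ ∈ R := by
    classical
    intro t
    induction t using Finset.induction_on with
    | empty =>
      intro _ f hf
      simp only [Finset.notMem_empty, iUnion_of_empty, iUnion_empty] at hf
      rw [hf.eq_zero, map_zero, zero_smul, sub_zero]
      exact R.zero_mem
    | insert i t _ ih =>
      intro hts f hf
      rw [Finset.set_biUnion_insert] at hf
      obtain ⟨g, h, hg, hh, rfl⟩ := exists_vanishesOff_decomp (hUo i) hf
      have h1 := hall i (hts (Finset.mem_insert_self i t)) g hg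
      have h2 := ih ((Finset.subset_insert i t).trans hts) h hh
      have h3 := R.add_mem h1 h2
      rwa [sub_add_sub_comm, ← add_smul, ← map_add] at h3
  intro f hf
  have hfv : VanishesOff (⋃ i ∈ s, U i) f := by
    unfold VanishesOff
    have hΩo : IsOpen Ω := by
      rw [hcover.antisymm (iUnion₂_subset fun i _ => hUΩ i)]
      exact isOpen_biUnion fun i _ => hUo i
    filter_upwards [ae_restrict_mem hΩo.measurableSet] with x hx hx'
    exact absurd (hcover hx) hx'
  have h := hsum s subset_rfl f hfv
  have hLf : L f = 0 := (hL f).trans hf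
  rwa [hLf, zero_smul, sub_zero] at h

/-- On a bounded Lipschitz domain, the divergence maps `H¹₀(Ω)^d` onto `L²₀(Ω)`. -/
theorem IsLipschitzDomain.exists_divL_eq (hΩ : IsLipschitzDomain Ω) {f : LSp ℝ 2 Ω}
    (hf : f ∈ L20 Ω) : ∃ v ∈ H10 Ω, divL Ω v = f := by
  let R : Submodule ℝ (LSp ℝ 2 Ω) := (H10Submodule Ω).map (divL Ω).toLinearMap
  have hloc : ∀ x : Vec d, ∃ N ∈ 𝓝 x, ∃ U, IsOpen U ∧ U ⊆ Ω ∧ N ∩ Ω ⊆ U ∧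
      ∀ f ∈ L20 Ω, VanishesOff U f → f ∈ R := by
    intro x
    by_cases hx : x ∈ closure Ω
    · obtain ⟨N, hN, U, hUo, hUΩ, hNU, z, ρ, hρ, hstar⟩ := hΩ.exists_starShaped hx
      refine ⟨N, hN, U, hUo, hUΩ, hNU, fun f hf hfU => ?_⟩
      obtain ⟨v, hv, hvf⟩ := exists_divL_eq_of_starShaped hΩ.isBounded hUo hUΩ hρ hstar hfU hf
      exact ⟨v, hv, hvf⟩
    -- Points off the closure get the empty piece, so that the choice below is defined at every
    -- point.
    · refine ⟨(closure Ω)ᶜ, isClosed_closure.isOpen_compl.mem_nhds hx, ∅, isOpen_empty,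
        empty_subset _, fun y hy => hy.1 (subset_closure hy.2), fun f _ hfU => ?_⟩
      rw [hfU.eq_zero]
      exact R.zero_mem
  choose N hN U hUo hUΩ hNU hUR using hloc
  obtain ⟨s, -, hs⟩ := (hΩ.isBounded.isCompact_closure).elim_nhds_subcover N fun x _ => hN x
  have hcover : Ω ⊆ ⋃ i ∈ s, U i := by
    intro x hx
    obtain ⟨i, hi, hxi⟩ := mem_iUnion₂.1 (hs (subset_closure hx))
    exact mem_iUnion₂.2 ⟨i, hi, hNU i ⟨hxi, hx⟩⟩
  obtain ⟨v, hv, hvf⟩ := L20_subset_of_cover hΩ.isBounded hΩ.isConnected R s U hUo hUΩ hcover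
    (fun i _ => hUR i) hf
  exact ⟨v, hv, hvf⟩

end Gluing

/-! ### First-order conditions and the pressure -/

section Optimality

variable {d : ℕ} {Ω : Set (Vec d)}

/-- Test fields vanish on the frontier of the open set `Ω`, so adding them to the approximants of
`u` leaves the boundary error unchanged. -/
theorem HasTrace.add_of_mem_H10 (hΩ : IsOpen Ω) {u v : H1 Ω} {g : Vec d → Vec d}
    (hu : HasTrace u g) (hv : v ∈ H10 Ω) : HasTrace (u + v) g := by
  obtain ⟨hg, φ, w, hφw, hw, hlim⟩ := hu
  obtain ⟨z, hz, hzlim⟩ := mem_closure_iff_seq_limit.1 hv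
  choose ψ hψ hzψ using hz
  refine ⟨hg, fun n => φ n + ψ n, fun n => w n + z n, fun n => ⟨(hφw n).1.add (hψ n).smooth,
    (hφw n).2.add (hzψ n) ((hφw n).1.differentiable (by simp))
      ((hψ n).smooth.differentiable (by simp))⟩, hw.add hzlim, ?_⟩
  refine hlim.congr fun n => eLpNorm_congr_ae ?_
  filter_upwards [ae_restrict_mem isClosed_frontier.measurableSet] with x hx
  have h0 : ψ n x = 0 := image_eq_zero_of_notMem_tsupport fun h =>
    (hΩ.frontier_eq ▸ hx).2 ((hψ n).subset h)
  simp [h0]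

theorem add_smul_mem_H1gdiv (hΩ : IsOpen Ω) {u v : H1 Ω} {g : Vec d → Vec d}
    (hu : u ∈ H1gdiv Ω g) (hv : v ∈ H10 Ω) (hdiv : divL Ω v = 0) (s : ℝ) :
    u + s • v ∈ H1gdiv Ω g := by
  refine ⟨HasTrace.add_of_mem_H10 hΩ hu.1 ((H10Submodule Ω).smul_mem s hv), ?_⟩
  have hu0 : divL Ω u = 0 := by
    rw [Lp.eq_zero_iff_ae_eq_zero]
    filter_upwards [hu.2, coeFn_divL u] with x h1 h2
    rw [h2, h1, Pi.zero_apply]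
  have h0 : divL Ω (u + s • v) = 0 := by
    rw [map_add, map_smul, hu0, hdiv, smul_zero, add_zero]
  rw [Lp.eq_zero_iff_ae_eq_zero] at h0
  filter_upwards [h0, coeFn_divL (u + s • v)] with x h1 h2
  rw [← h2, h1, Pi.zero_apply]

/-- `α` is controlled on `[0, 1]` only, so measurability is obtained from its constant continuous
extension `IccExtend`, which agrees with `α` at almost all values taken by `ρ`. -/
theorem memLp_top_comp_of_continuousOn {X : Type*} [MeasurableSpace X] {μ : Measure X}
    {α : ℝ → ℝ} (hα : ContinuousOn α (Icc 0 1)) {ρ : X → ℝ} (hρm : AEStronglyMeasurable ρ μ)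
    (hρ : ∀ᵐ x ∂μ, 0 ≤ ρ x ∧ ρ x ≤ 1) : MemLp (fun x => α (ρ x)) ∞ μ := by
  obtain ⟨C, hC⟩ := isCompact_Icc.exists_bound_of_continuousOn hα
  refine memLp_top_of_bound ?_ C (hρ.mono fun x hx => hC _ hx)
  have hc : Continuous (IccExtend (zero_le_one (α := ℝ)) ((Icc (0 : ℝ) 1).domRestrict α)) :=
    hα.domRestrict.Icc_extend'
  refine (hc.comp_aestronglyMeasurable hρm).congr (hρ.mono fun x hx => ?_)
  exact IccExtend_of_mem _ _ hx

theorem memLp_weight_smul {α : ℝ → ℝ} (hα : ContinuousOn α (Icc 0 1)) {ρ : LSp ℝ ∞ Ω}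
    (hρ : ∀ᵐ x ∂((volume : Measure (Vec d)).restrict Ω), 0 ≤ ρ x ∧ ρ x ≤ 1)
    (u : LSp (Vec d) 2 Ω) :
    MemLp (fun x => α (ρ x) • u x) 2 ((volume : Measure (Vec d)).restrict Ω) :=
  (Lp.memLp u).smul (memLp_top_comp_of_continuousOn hα (Lp.aestronglyMeasurable ρ) hρ)

theorem integrable_weight_inner {α : ℝ → ℝ} (hα : ContinuousOn α (Icc 0 1)) {ρ : LSp ℝ ∞ Ω}
    (hρ : ∀ᵐ x ∂((volume : Measure (Vec d)).restrict Ω), 0 ≤ ρ x ∧ ρ x ≤ 1)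
    (u v : LSp (Vec d) 2 Ω) :
    Integrable (fun x => α (ρ x) * inner ℝ (u x) (v x))
      ((volume : Measure (Vec d)).restrict Ω) := by
  refine (L2.integrable_inner (𝕜 := ℝ) ((memLp_weight_smul hα hρ u).toLp _) v).congr ?_
  filter_upwards [(memLp_weight_smul hα hρ u).coeFn_toLp] with x hx
  rw [hx, real_inner_smul_left]

theorem aForm_eq {α : ℝ → ℝ} (hα : ContinuousOn α (Icc 0 1)) (ν : ℝ) {ρ : LSp ℝ ∞ Ω}
    (hρ : ∀ᵐ x ∂((volume : Measure (Vec d)).restrict Ω), 0 ≤ ρ x ∧ ρ x ≤ 1) (u v : H1 Ω) :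
    aForm α ν ρ u v = (∫ x in Ω, α (ρ x) * inner ℝ (vel u x) (vel v x)) +
      ν * inner ℝ (grad u) (grad v) := by
  unfold aForm
  rw [integral_add (integrable_weight_inner hα hρ _ _)
    ((L2.integrable_inner (𝕜 := ℝ) (grad u) (grad v)).const_mul ν), integral_const_mul,
    L2.inner_def]

theorem exists_aFormL {α : ℝ → ℝ} (hα : ContinuousOn α (Icc 0 1)) (ν : ℝ) {ρ : LSp ℝ ∞ Ω}
    (hρ : ∀ᵐ x ∂((volume : Measure (Vec d)).restrict Ω), 0 ≤ ρ x ∧ ρ x ≤ 1) (u : H1 Ω) :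
    ∃ A : H1 Ω →L[ℝ] ℝ, ∀ v, A v = aForm α ν ρ u v := by
  refine ⟨(innerSL ℝ ((memLp_weight_smul hα hρ (vel u)).toLp _)).comp (velL Ω) +
    ν • (innerSL ℝ (grad u)).comp (gradL Ω), fun v => ?_⟩
  have h : inner ℝ ((memLp_weight_smul hα hρ (vel u)).toLp _) (vel v) =
      ∫ x in Ω, α (ρ x) * inner ℝ (vel u x) (vel v x) := by
    rw [L2.inner_def]
    refine integral_congr_ae ?_
    filter_upwards [(memLp_weight_smul hα hρ (vel u)).coeFn_toLp] with x hx
    rw [hx, real_inner_smul_left]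
  rw [aForm_eq hα ν hρ, ← h]
  rfl

theorem lForm_eq (f : LSp (Vec d) 2 Ω) (v : H1 Ω) : lForm f v = inner ℝ f (vel v) := by
  rw [lForm, L2.inner_def]

theorem bForm_eq (v : H1 Ω) (q : LSp ℝ 2 Ω) : bForm v q = -inner ℝ q (divL Ω v) := by
  rw [bForm, L2.inner_def]
  congr 1
  refine integral_congr_ae ((coeFn_divL v).mono fun x hx => ?_)
  simp only [hx]
  exact mul_comm _ _

theorem aForm_comm (α : ℝ → ℝ) (ν : ℝ) (ρ : LSp ℝ ∞ Ω) (u v : H1 Ω) :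
    aForm α ν ρ u v = aForm α ν ρ v u := by
  simp only [aForm, real_inner_comm]

theorem J_eq {α : ℝ → ℝ} (hα : ContinuousOn α (Icc 0 1)) (ν : ℝ) {ρ : LSp ℝ ∞ Ω}
    (hρ : ∀ᵐ x ∂((volume : Measure (Vec d)).restrict Ω), 0 ≤ ρ x ∧ ρ x ≤ 1)
    (f : LSp (Vec d) 2 Ω) (v : H1 Ω) :
    J α ν f v ρ = (1 / 2) * aForm α ν ρ v v - lForm f v := by
  have h1 : Integrable (fun x => α (ρ x) * inner ℝ (vel v x) (vel v x) +
      ν * inner ℝ (grad v x) (grad v x)) ((volume : Measure (Vec d)).restrict Ω) :=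
    (integrable_weight_inner hα hρ _ _).add
      ((L2.integrable_inner (𝕜 := ℝ) (grad v) (grad v)).const_mul ν)
  have h2 : Integrable (fun x => 2 * inner ℝ (f x) (vel v x))
      ((volume : Measure (Vec d)).restrict Ω) :=
    (L2.integrable_inner (𝕜 := ℝ) f (vel v)).const_mul 2
  have h3 : J α ν f v ρ = (1 / 2) * ∫ x in Ω, ((α (ρ x) * inner ℝ (vel v x) (vel v x) +
      ν * inner ℝ (grad v x) (grad v x)) - 2 * inner ℝ (f x) (vel v x)) := by
    simp only [J, real_inner_self_eq_norm_sq]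
  rw [h3, integral_sub h1 h2, integral_const_mul, aForm, lForm]
  ring

theorem J_add_smul {α : ℝ → ℝ} (hα : ContinuousOn α (Icc 0 1)) (ν : ℝ) {ρ : LSp ℝ ∞ Ω}
    (hρ : ∀ᵐ x ∂((volume : Measure (Vec d)).restrict Ω), 0 ≤ ρ x ∧ ρ x ≤ 1)
    (f : LSp (Vec d) 2 Ω) (u v : H1 Ω) (s : ℝ) :
    J α ν f (u + s • v) ρ = J α ν f u ρ + s * (aForm α ν ρ u v - lForm f v) +
      s ^ 2 * ((1 / 2) * aForm α ν ρ v v) := by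
  have hadd : ∀ x y : H1 Ω, aForm α ν ρ x (u + s • y) = aForm α ν ρ x u + s * aForm α ν ρ x y := by
    intro x y
    obtain ⟨A, hA⟩ := exists_aFormL hα ν hρ x
    rw [← hA, ← hA, ← hA, map_add, map_smul, smul_eq_mul]
  have hl : lForm f (u + s • v) = lForm f u + s * lForm f v := by
    rw [lForm_eq, lForm_eq, lForm_eq, vel_add, vel_smul, inner_add_right, real_inner_smul_right]
  rw [J_eq hα ν hρ, J_eq hα ν hρ, hl, hadd, aForm_comm α ν ρ (u + s • v) u,
    aForm_comm α ν ρ (u + s • v) v, hadd, hadd, aForm_comm α ν ρ v u]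
  ring

theorem eq_zero_of_eventually_nonneg {a b : ℝ} (h : ∀ᶠ s in 𝓝 (0 : ℝ), 0 ≤ s * a + s ^ 2 * b) :
    a = 0 := by
  have hmin : IsLocalMin (fun s : ℝ => s * a + s ^ 2 * b) 0 := by
    filter_upwards [h] with s hs
    simpa using hs
  refine hmin.hasDerivAt_eq_zero ?_
  have h1 : HasDerivAt (fun s : ℝ => s * a + s ^ 2 * b) (1 * a + (2 * 0) * b) 0 :=
    ((hasDerivAt_id (0 : ℝ)).mul_const a).add (by simpa using (hasDerivAt_pow 2 (0 : ℝ)).mul_const b)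
  simpa using h1

/-- The admissible directions form a subspace, so `s` may have either sign and the linear
coefficient of the quadratic increment must vanish. -/
theorem aForm_eq_lForm_of_min (hΩ : IsOpen Ω) {α : ℝ → ℝ} (hα : ContinuousOn α (Icc 0 1))
    {ν γ : ℝ} {f : LSp (Vec d) 2 Ω} {g : Vec d → Vec d} {u : H1 Ω} {ρ : LSp ℝ ∞ Ω}
    (hmin : IsLocalMinimizer α ν γ f g u ρ) {v : H1 Ω} (hv : v ∈ H10 Ω) (hdiv : divL Ω v = 0) :
    aForm α ν ρ u v = lForm f v := by
  obtain ⟨hu, hρ, r, hr, hle⟩ := hmin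
  rw [← sub_eq_zero]
  refine eq_zero_of_eventually_nonneg (b := (1 / 2) * aForm α ν ρ v v) ?_
  have hsmall : ∀ᶠ s in 𝓝 (0 : ℝ), ‖s • v‖ < r := by
    have hc : Tendsto (fun s : ℝ => ‖s • v‖) (𝓝 0) (𝓝 ‖(0 : ℝ) • v‖) :=
      ((continuous_id.smul continuous_const).norm).tendsto 0
    rw [zero_smul, norm_zero] at hc
    exact hc.eventually (gt_mem_nhds hr)
  filter_upwards [hsmall] with s hs
  have h := hle (u + s • v) (add_smul_mem_H1gdiv hΩ hu hv hdiv s) ρ hρ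
    (by rwa [sub_add_cancel_left, norm_neg, sub_self, norm_zero, add_zero])
  rw [J_add_smul hα ν hρ.1] at h
  linarith

theorem add_mul_sub_mem_Icc {a b t : ℝ} (ha : a ∈ Icc (0 : ℝ) 1) (hb : b ∈ Icc (0 : ℝ) 1)
    (ht : t ∈ Icc (0 : ℝ) 1) : a + t * (b - a) ∈ Icc (0 : ℝ) 1 :=
  (convex_Icc (0 : ℝ) 1).add_smul_sub_mem ha hb ht

/-- The segment from `ρ x` to `η x` stays in `[0, 1]`, where the mean value inequality bounds the
quotients by `C`; dominated convergence does the rest. The filter is one-sided because `α` has only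
one-sided derivatives at the endpoints, and it excludes `t = 0` so that quotients are genuine
slopes. -/
theorem tendsto_integral_difference_quotient {X : Type*} [MeasurableSpace X] {μ : Measure X}
    {α : ℝ → ℝ} (hα : ContDiffOn ℝ 1 α (Icc 0 1)) {ρ η w : X → ℝ}
    (hρm : AEStronglyMeasurable ρ μ) (hηm : AEStronglyMeasurable η μ) (hw : Integrable w μ)
    (hρ : ∀ᵐ x ∂μ, ρ x ∈ Icc (0 : ℝ) 1) (hη : ∀ᵐ x ∂μ, η x ∈ Icc (0 : ℝ) 1) :
    Tendsto (fun t : ℝ => ∫ x, t⁻¹ * (α (ρ x + t * (η x - ρ x)) - α (ρ x)) * w x ∂μ)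
      (𝓝[Ioc 0 1] 0) (𝓝 (∫ x, derivWithin α (Icc 0 1) (ρ x) * (η x - ρ x) * w x ∂μ)) := by
  have hu : UniqueDiffOn ℝ (Icc (0 : ℝ) 1) := uniqueDiffOn_Icc zero_lt_one
  obtain ⟨C, hC⟩ := isCompact_Icc.exists_bound_of_continuousOn
    (hα.continuousOn_derivWithin hu le_rfl)
  have hd : DifferentiableOn ℝ α (Icc 0 1) := hα.differentiableOn one_ne_zero
  have hmem : ∀ᶠ t : ℝ in 𝓝[Ioc 0 1] 0, t ∈ Ioc (0 : ℝ) 1 := self_mem_nhdsWithin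
  refine tendsto_integral_filter_of_dominated_convergence (fun x => C * |w x|) ?_ ?_
    (hw.abs.const_mul C) ?_
  · filter_upwards [hmem] with t ht
    refine AEStronglyMeasurable.mul ?_ hw.aestronglyMeasurable
    refine AEStronglyMeasurable.const_mul ?_ _
    refine AEStronglyMeasurable.sub ?_ ?_
    · refine (memLp_top_comp_of_continuousOn hα.continuousOn (ρ := fun x => ρ x + t * (η x - ρ x))
        (hρm.add ((hηm.sub hρm).const_mul t)) ?_).1
      filter_upwards [hρ, hη] with x h1 h2
      exact add_mul_sub_mem_Icc h1 h2 (Ioc_subset_Icc_self ht)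
    · exact (memLp_top_comp_of_continuousOn hα.continuousOn hρm hρ).1
  · filter_upwards [hmem] with t ht
    filter_upwards [hρ, hη] with x h1 h2
    have h3 := (convex_Icc (0 : ℝ) 1).norm_image_sub_le_of_norm_derivWithin_le hd hC h1
      (add_mul_sub_mem_Icc h1 h2 (Ioc_subset_Icc_self ht))
    have hC0 : 0 ≤ C := (norm_nonneg _).trans (hC _ h1)
    have h4 : |η x - ρ x| ≤ 1 := abs_le.2 ⟨by linarith [h1.2, h2.1], by linarith [h1.1, h2.2]⟩
    have h5 : ‖α (ρ x + t * (η x - ρ x)) - α (ρ x)‖ ≤ C * t := by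
      refine h3.trans ?_
      rw [add_sub_cancel_left, norm_mul, Real.norm_of_nonneg ht.1.le, Real.norm_eq_abs]
      exact mul_le_mul_of_nonneg_left (mul_le_of_le_one_right ht.1.le h4) hC0
    rw [norm_mul, norm_mul, norm_inv, Real.norm_of_nonneg ht.1.le, Real.norm_eq_abs (w x)]
    refine mul_le_mul_of_nonneg_right ?_ (abs_nonneg _)
    rw [inv_mul_le_iff₀ ht.1, mul_comm t C]
    exact h5
  · filter_upwards [hρ, hη] with x h1 h2
    refine Tendsto.mul_const _ ?_
    have hx : HasDerivWithinAt (fun t : ℝ => ρ x + t * (η x - ρ x)) (η x - ρ x) (Ioc 0 1) 0 := by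
      have := ((hasDerivAt_id (0 : ℝ)).mul_const (η x - ρ x)).const_add (ρ x)
      simpa using this.hasDerivWithinAt
    have hα' : HasDerivWithinAt α (derivWithin α (Icc 0 1) (ρ x)) (Icc 0 1)
        (ρ x + 0 * (η x - ρ x)) := by
      rw [zero_mul, add_zero]
      exact (hd _ h1).hasDerivWithinAt
    have h := hα'.comp 0 hx fun t ht => add_mul_sub_mem_Icc h1 h2 (Ioc_subset_Icc_self ht)
    rw [hasDerivWithinAt_iff_tendsto_slope' (by simp)] at h
    refine h.congr fun t => ?_
    simp [slope, vsub_eq_sub]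

theorem add_smul_sub_mem_Cγ (hΩ : Bornology.IsBounded Ω) {γ : ℝ} {ρ η : LSp ℝ ∞ Ω}
    (hρ : ρ ∈ Cγ Ω γ) (hη : η ∈ Cγ Ω γ) {t : ℝ} (ht : t ∈ Icc (0 : ℝ) 1) :
    ρ + t • (η - ρ) ∈ Cγ Ω γ ∧ ∀ᵐ x ∂((volume : Measure (Vec d)).restrict Ω),
      (ρ + t • (η - ρ)) x = ρ x + t * (η x - ρ x) := by
  have := isFiniteMeasure_restrict hΩ
  have hcoe : ∀ᵐ x ∂((volume : Measure (Vec d)).restrict Ω),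
      (ρ + t • (η - ρ)) x = ρ x + t * (η x - ρ x) := by
    filter_upwards [Lp.coeFn_add ρ (t • (η - ρ)), Lp.coeFn_smul t (η - ρ), Lp.coeFn_sub η ρ]
      with x h1 h2 h3
    rw [h1, Pi.add_apply, h2, Pi.smul_apply, h3, Pi.sub_apply, smul_eq_mul]
  refine ⟨⟨?_, ?_⟩, hcoe⟩
  · filter_upwards [hcoe, hρ.1, hη.1] with x h1 h2 h3
    rw [h1]
    exact add_mul_sub_mem_Icc h2 h3 ht
  · have hρi : Integrable ρ ((volume : Measure (Vec d)).restrict Ω) :=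
      (Lp.memLp ρ).integrable le_top
    have hηi : Integrable η ((volume : Measure (Vec d)).restrict Ω) :=
      (Lp.memLp η).integrable le_top
    have hdi : Integrable (fun x => t * (η x - ρ x)) ((volume : Measure (Vec d)).restrict Ω) :=
      (hηi.sub hρi).const_mul t
    rw [integral_congr_ae hcoe, integral_add hρi hdi, integral_const_mul, integral_sub hηi hρi]
    have h1 := hρ.2
    have h2 := hη.2
    nlinarith [ht.1, ht.2, mul_le_mul_of_nonneg_left h2 ht.1,
      mul_le_mul_of_nonneg_left h1 (sub_nonneg.2 ht.2)]

/-- With `u` fixed, the gradient and force terms of `J` cancel, so minimality makes every difference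
quotient of the `α` term nonnegative for small `t`. -/
theorem cForm_nonneg_of_min (hΩ : Bornology.IsBounded Ω) {α : ℝ → ℝ}
    (hα : ContDiffOn ℝ 1 α (Icc 0 1)) {ν γ : ℝ} {f : LSp (Vec d) 2 Ω} {g : Vec d → Vec d}
    {u : H1 Ω} {ρ : LSp ℝ ∞ Ω} (hmin : IsLocalMinimizer α ν γ f g u ρ) {η : LSp ℝ ∞ Ω}
    (hη : η ∈ Cγ Ω γ) : 0 ≤ cForm α u ρ (η - ρ) := by
  obtain ⟨hu, hρ, r, hr, hle⟩ := hmin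
  have hsq : Integrable (fun x => ‖vel u x‖ ^ 2) ((volume : Measure (Vec d)).restrict Ω) :=
    (Lp.memLp (vel u)).integrable_norm_pow (by norm_num)
  have hlim := tendsto_integral_difference_quotient hα (Lp.aestronglyMeasurable ρ)
    (Lp.aestronglyMeasurable η) hsq hρ.1 hη.1
  have hc : cForm α u ρ (η - ρ) = (1 / 2) *
      ∫ x in Ω, derivWithin α (Icc 0 1) (ρ x) * (η x - ρ x) * ‖vel u x‖ ^ 2 := by
    rw [cForm]
    congr 1
    refine integral_congr_ae ?_
    filter_upwards [Lp.coeFn_sub η ρ] with x hx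
    rw [hx, Pi.sub_apply]
  rw [hc]
  refine mul_nonneg (by norm_num) ?_
  have : (𝓝[Ioc (0 : ℝ) 1] 0).NeBot := by
    rw [nhdsWithin_Ioc_eq_nhdsGT zero_lt_one]
    infer_instance
  refine ge_of_tendsto hlim ?_
  have hsmall : ∀ᶠ t in 𝓝[Ioc (0 : ℝ) 1] 0, ‖t • (η - ρ)‖ < r := by
    have hct : Tendsto (fun t : ℝ => ‖t • (η - ρ)‖) (𝓝 0) (𝓝 ‖(0 : ℝ) • (η - ρ)‖) :=
      ((continuous_id.smul continuous_const).norm).tendsto 0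
    rw [zero_smul, norm_zero] at hct
    exact nhdsWithin_le_nhds (hct.eventually (gt_mem_nhds hr))
  filter_upwards [hsmall, self_mem_nhdsWithin] with t hts ht
  obtain ⟨hmem, hcoe⟩ := add_smul_sub_mem_Cγ hΩ hρ hη (Ioc_subset_Icc_self ht)
  have h := hle u hu (ρ + t • (η - ρ)) hmem
    (by rwa [sub_add_cancel_left, norm_neg, sub_self, norm_zero, zero_add])
  rw [J_eq hα.continuousOn ν hρ.1, J_eq hα.continuousOn ν hmem.1, aForm_eq hα.continuousOn ν hρ.1,
    aForm_eq hα.continuousOn ν hmem.1] at h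
  have hdiff : (∫ x in Ω, t⁻¹ * (α (ρ x + t * (η x - ρ x)) - α (ρ x)) * ‖vel u x‖ ^ 2) =
      t⁻¹ * ((∫ x in Ω, α ((ρ + t • (η - ρ)) x) * inner ℝ (vel u x) (vel u x)) -
        ∫ x in Ω, α (ρ x) * inner ℝ (vel u x) (vel u x)) := by
    rw [← integral_sub (integrable_weight_inner hα.continuousOn hmem.1 _ _)
      (integrable_weight_inner hα.continuousOn hρ.1 _ _), ← integral_const_mul]
    refine integral_congr_ae ?_
    filter_upwards [hcoe] with x hx
    rw [hx, real_inner_self_eq_norm_sq]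
    ring
  rw [hdiff]
  exact mul_nonneg (inv_nonneg.2 ht.1.le) (by linarith)

theorem IsGlobalMinimizer.isLocalMinimizer {α : ℝ → ℝ} {ν γ : ℝ} {f : LSp (Vec d) 2 Ω}
    {g : Vec d → Vec d} {u : H1 Ω} {ρ : LSp ℝ ∞ Ω} (h : IsGlobalMinimizer α ν γ f g u ρ) :
    IsLocalMinimizer α ν γ f g u ρ :=
  ⟨h.1, h.2.1, 1, one_pos, fun w hw η hη _ => h.2.2 w hw η hη⟩

theorem exists_pressure (hΩ : IsLipschitzDomain Ω) {α : ℝ → ℝ} (hα : ContinuousOn α (Icc 0 1))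
    {ν γ : ℝ} {f : LSp (Vec d) 2 Ω} {g : Vec d → Vec d} {u : H1 Ω} {ρ : LSp ℝ ∞ Ω}
    (hmin : IsLocalMinimizer α ν γ f g u ρ) :
    ∃ p ∈ L20 Ω, ∀ v ∈ H10 Ω, aForm α ν ρ u v + bForm v p = lForm f v := by
  obtain ⟨L, hL⟩ := exists_integralL hΩ.isBounded
  obtain ⟨A, hA⟩ := exists_aFormL hα ν hmin.2.1.1 u
  have hmem : ∀ q, q ∈ LinearMap.ker L.toLinearMap ↔ q ∈ L20 Ω := fun q => by
    change L q = 0 ↔ _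
    rw [hL]
    rfl
  have hF : ∀ v, (A - (innerSL ℝ f).comp (velL Ω)) v = aForm α ν ρ u v - lForm f v := fun v => by
    rw [← hA, lForm_eq]
    rfl
  obtain ⟨p, hp, hpv⟩ := exists_mem_inner_comp_eq (S := H10Submodule Ω) isClosed_closure
    (L := LinearMap.ker L.toLinearMap) L.isClosed_ker (divL Ω)
    (fun v hv => (hmem _).2 (divL_mem_L20 hΩ.isBounded hv))
    (fun q hq => hΩ.exists_divL_eq ((hmem q).1 hq)) (A - (innerSL ℝ f).comp (velL Ω))
    (fun v hv hdiv => by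
      rw [hF, aForm_eq_lForm_of_min hΩ.isOpen hα hmin hv hdiv, sub_self])
  refine ⟨p, (hmem p).1 hp, fun v hv => ?_⟩
  have h := hpv v hv
  rw [hF] at h
  rw [bForm_eq]
  linarith

/-- Choosing `v` with `div v = p - q` gives `‖p - q‖² = 0`. -/
theorem eq_of_bForm_eq (hΩ : IsLipschitzDomain Ω) {p q : LSp ℝ 2 Ω} (hp : p ∈ L20 Ω)
    (hq : q ∈ L20 Ω) (h : ∀ v ∈ H10 Ω, bForm v p = bForm v q) : p = q := by
  obtain ⟨L, hL⟩ := exists_integralL hΩ.isBounded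
  have hp0 : L p = 0 := (hL p).trans hp
  have hq0 : L q = 0 := (hL q).trans hq
  have hpq : p - q ∈ L20 Ω := by
    change ∫ x in Ω, (p - q) x = 0
    rw [← hL, map_sub, hp0, hq0, sub_self]
  obtain ⟨v, hv, hdiv⟩ := hΩ.exists_divL_eq hpq
  have h1 := h v hv
  rw [bForm_eq, bForm_eq, hdiv, neg_inj, ← sub_eq_zero, ← inner_sub_left, inner_self_eq_zero] at h1
  exact sub_eq_zero.1 h1

theorem bForm_eq_zero {v : H1 Ω}
    (hv : ∀ᵐ x ∂((volume : Measure (Vec d)).restrict Ω), div v x = 0) (q : LSp ℝ 2 Ω) :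
    bForm v q = 0 := by
  rw [bForm, neg_eq_zero]
  refine integral_eq_zero_of_ae ?_
  filter_upwards [hv] with x hx
  rw [hx, mul_zero, Pi.zero_apply]

end Optimality

end BorrvallPetersson

/-! ### The optimality system -/

theorem proposition2 (d : ℕ) (hd : d = 2 ∨ d = 3)
    (Ω : Set (Vec d)) (hΩ : IsLipschitzDomain Ω)
    (ν γ : ℝ) (hν : 0 < ν) (hγ : γ ∈ Set.Ioo (0 : ℝ) 1)
    (f : LSp (Vec d) 2 Ω)
    (g : Vec d → Vec d)
    (Γ : Set (Vec d)) (hΓ : Γ ⊆ frontier Ω)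
    (hΓpos : 0 < Measure.hausdorffMeasure ((d : ℝ) - 1) Γ)
    (hgΓ : ∀ᵐ x ∂((Measure.hausdorffMeasure ((d : ℝ) - 1)).restrict Γ), g x = 0)
    (α : ℝ → ℝ) (αlo αhi : ℝ) (hαlo : 0 ≤ αlo)
    (hα1 : Set.MapsTo α (Set.Icc 0 1) (Set.Icc αlo αhi))
    (hα2 : ConvexOn ℝ (Set.Icc 0 1) α) (hα2' : AntitoneOn α (Set.Icc 0 1))
    (hα3 : α 0 = αhi) (hα3' : α 1 = αlo)
    (hα4 : ContDiffOn ℝ 2 α (Set.Icc 0 1))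
    (u : H1 Ω) (ρ : LSp ℝ ∞ Ω)
    (hmin : IsLocalMinimizer α ν γ f g u ρ ∨
      IsGlobalMinimizer α ν γ f g u ρ) :
    ∃! p : LSp ℝ 2 Ω, p ∈ L20 Ω ∧
      (∀ v ∈ H10 Ω,
        aForm α ν ρ u v + bForm v p =
          lForm f v) ∧
      (∀ q ∈ L20 Ω, bForm u q = 0) ∧
      (∀ η ∈ Cγ Ω γ, 0 ≤ cForm α u ρ (η - ρ)) := by
  have hloc : IsLocalMinimizer α ν γ f g u ρ := hmin.elim id fun h => h.isLocalMinimizer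
  obtain ⟨p, hp, hpv⟩ := exists_pressure hΩ hα4.continuousOn hloc
  refine ⟨p, ⟨hp, hpv, fun q _ => bForm_eq_zero hloc.1.2 q, fun η hη =>
    cForm_nonneg_of_min hΩ.isBounded (hα4.of_le one_le_two) hloc hη⟩, ?_⟩
  rintro q ⟨hq, hqv, -⟩
  exact eq_of_bForm_eq hΩ hq hp fun v hv => by linarith [hpv v hv, hqv v hv]
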